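/- Let $\omega,\lambda_1,\lambda_2>0$ and $\gamma(k)=\big(\omega^2+2\lambda_1(1-\cos k_1)+2\lambda_2(1-\cos k_2)\big)^{1/2}$ for $k=(k_1,k_2)\in\mathbb R^2$. Let $K_1$ be the set of all $k\in[-\pi,\pi]^2$ with $\det D^2\gamma(k)\ne 0$, and let $K_2$ (respectively $K_3$) be the set of all $k\in[-\pi,\pi]^2$ with $\det D^2\gamma(k)=0$ and $(\xi\cdot\nabla)^3\gamma(k)\neq 0$ (respectively $(\xi\cdot\nabla)^3\gamma(k)=0$), where $\xi\neq0$ is an eigenvector of $D^2\gamma(k)$ for the eigenvalue $0$. Put $$V_3=\nabla\gamma(K_3),\quad V_2=\nabla\gamma(K_2)\setminus V_3,\quad V_1=\nabla\gamma(K_1)\setminus(V_2\cup V_3),\quad V_0=\mathbb R^2\setminus\nabla\gamma([-\pi,\pi]^2).$$ Then there are two disjoint simple closed continuous curves $\Psi_1,\Psi_2\subset\mathbb R^2$ around the origin, with $\Psi_2$ inside $\Psi_1$, that split the plane into three connected open regions: the unbounded region $R_0$ outside $\Psi_1$, the bounded region $R_1$ between $\Psi_1$ and $\Psi_2$, and the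 bounded region $R_2$ enclosed by $\Psi_2$. Moreover: 1. The region enclosed by $\Psi_1$ is convex. 2. $\Psi_2$ consists of four concave simple arcs; each joins two consecutive ones of four points $(c_1,c_2),(-c_1,c_2),(-c_1,-c_2),(c_1,-c_2)$ with $c_1,c_2>0$, and different arcs meet only at common endpoints. Here an arc is concave if the open chord between any two distinct points of it is disjoint from the closure of the region enclosed by $\Psi_2$. At each of these four points $p$ the curve $\Psi_2$ has a cusp, that is, the unit vectors $(x-p)/|x-p|$ converge to a single limit as $x\to p$ along $\Psi_2\setminus\{p\}$. 3. $V_3$ is the set of these four points, $V_2=(\Psi_1\cup\Psi_2)\setminus V_3$, $V_1=R_1\cup R_2$, and $V_0=R_0$, whose boundary is $\Psi_1$. -/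

import Mathlib

open Set Filter Topology

noncomputable section

namespace LatticeVelocity

/-- The plane `ℝ²` with its Euclidean norm. -/
abbrev Plane : Type := EuclideanSpace ℝ (Fin 2)

/-- The dispersion relation
`γ(k) = (ω² + 2 λ₁ (1 - cos k₁) + 2 λ₂ (1 - cos k₂))^(1/2)`. It is regarded as a (periodic) function
on the whole plane, so that its derivatives make sense on the boundary of `[-π, π]²` too. -/
def disp (ω lam₁ lam₂ : ℝ) (k : Plane) : ℝ :=
  Real.sqrt (ω ^ 2 + (2 * lam₁ * (1 - Real.cos (k 0)) + 2 * lam₂ * (1 - Real.cos (k 1))))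

/-- The square `[-π, π]²`. -/
def square : Set Plane :=
  {k | ∀ i, k i ∈ Icc (-Real.pi) Real.pi}

/-- The Hessian `D²f(k)`, as the linear map that is the derivative of the gradient of `f` at `k`. -/
def hessian (f : Plane → ℝ) (k : Plane) : Plane →L[ℝ] Plane :=
  fderiv ℝ (gradient f) k

/-- The third directional derivative `(ξ · ∇)³ f(k)`. -/
def thirdDirDeriv (f : Plane → ℝ) (ξ k : Plane) : ℝ :=
  iteratedDeriv 3 (fun t : ℝ => f (k + t • ξ)) 0

/-- `K₁`: the points of the square at which the Hessian of `f` is nondegenerate. -/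
def K₁ (f : Plane → ℝ) : Set Plane :=
  {k ∈ square | (hessian f k).det ≠ 0}

/-- `K₂`: the Hessian is degenerate, but the third derivative in the direction of an eigenvector `ξ`
for the eigenvalue zero is not zero. -/
def K₂ (f : Plane → ℝ) : Set Plane :=
  {k ∈ square | (hessian f k).det = 0 ∧
    ∃ ξ : Plane, ξ ≠ 0 ∧ hessian f k ξ = 0 ∧ thirdDirDeriv f ξ k ≠ 0}

/-- `K₃`: the Hessian is degenerate, and the third derivative in the direction of an eigenvector `ξ`
for the eigenvalue zero vanishes as well. -/
def K₃ (f : Plane → ℝ) : Set Plane :=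
  {k ∈ square | (hessian f k).det = 0 ∧
    ∃ ξ : Plane, ξ ≠ 0 ∧ hessian f k ξ = 0 ∧ thirdDirDeriv f ξ k = 0}

/-- The velocities `∇f(k)` with `k ∈ K₃`. -/
def V₃ (f : Plane → ℝ) : Set Plane :=
  {v | ∃ k ∈ K₃ f, v = gradient f k}

/-- The velocities `∇f(k)` with `k ∈ K₂` that do not belong to `V₃`. -/
def V₂ (f : Plane → ℝ) : Set Plane :=
  {v | v ∉ V₃ f ∧ ∃ k ∈ K₂ f, v = gradient f k}

/-- The velocities `∇f(k)` with `k ∈ K₁` that belong neither to `V₂` nor to `V₃`. -/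
def V₁ (f : Plane → ℝ) : Set Plane :=
  {v | v ∉ V₂ f ∪ V₃ f ∧ ∃ k ∈ K₁ f, v = gradient f k}

/-- The velocities that are not of the form `∇f(k)` with `k` in the square. -/
def V₀ (f : Plane → ℝ) : Set Plane :=
  {v | ∀ k ∈ square, v ≠ gradient f k}

/-- `C` is a simple closed continuous curve: an injective continuous image of the circle. -/
def IsSimpleClosedCurve (C : Set Plane) : Prop :=
  ∃ c : Circle → Plane, Continuous c ∧ Function.Injective c ∧ range c = C

/-- `A` is a simple continuous arc from `x` to `y`. -/
def IsSimpleArc (A : Set Plane) (x y : Plane) : Prop :=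
  ∃ c : unitInterval → Plane,
    Continuous c ∧ Function.Injective c ∧ c 0 = x ∧ c 1 = y ∧ range c = A

/-- The region enclosed by `C`: the union of the bounded connected components of the complement. -/
def enclosedRegion (C : Set Plane) : Set Plane :=
  {x | x ∉ C ∧ Bornology.IsBounded (connectedComponentIn Cᶜ x)}

/-- The arc `A` of the boundary of the region `R` is (strictly) concave, that is, curved towards `R`:
the open chord between any two of its points lies outside the closure of `R`. -/
def IsConcaveArc (R A : Set Plane) : Prop :=
  ∀ x ∈ A, ∀ y ∈ A, x ≠ y → Disjoint (openSegment ℝ x y) (closure R)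

/-- The curve `C` has a cusp at `p`: the unit vectors from `p` towards the points `x` of `C` have one
common limit as `x` tends to `p`. So the two branches of a simple closed curve that meet at `p` leave
it in the same direction. -/
def HasCuspAt (C : Set Plane) (p : Plane) : Prop :=
  p ∈ C ∧ ∃ u : Plane, ‖u‖ = 1 ∧
    Tendsto (fun x : Plane => ‖x - p‖⁻¹ • (x - p)) (𝓝[C \ {p}] p) (𝓝 u)

end LatticeVelocity

end

/-! ### Topology of the plane: convex regions, enclosed regions, supporting lines. -/

namespace LatticeVelocity

/-! Write `a`, `b` for the two couplings, x = cos k₁, y = cos k₂ and M = ω² + 2a + 2b. Then γ² = M -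
2ax - 2by, and γ D²γ = diag(ax, by) - v vᵀ, where v = ∇γ has the components a sin k₁ / γ and b sin
k₂ / γ. The Hessian is therefore degenerate only where xy(M - ax - by) = bx + ay. Since M > 2a + 2b,
the solutions form an outer branch with x, y > 0 and an inner branch with xy < 0 or x = y = 0
(`critical_cases`). For ξ in the kernel, γ (ξ·∇)³γ = -(a sin k₁ ξ₁³ + b sin k₂ ξ₂³)
(`thirdDirDeriv_disp`).

Outer branch: the kernel contains (tan k₁, tan k₂) and the third derivative never vanishes. By
Cauchy–Schwarz, the linear functional with these coefficients attains its maximum over all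
velocities at ∇γ(k) (`IsOuterCritical.support`). Velocities of nondegenerate points are interior to
the range of ∇γ by the inverse function theorem, and those of inner points by an intermediate value
argument (`mem_range_of_le`). So the frontier of the compact range consists exactly of the outer
velocities. It has a supporting line at each point, which makes the range convex
(`convex_of_support`). The curve Ψ₁ is this frontier.

Inner branch: it has an explicit parametrization by m = -y/x. Up to signs the velocity is (V(m),
W(m)), where W' = S V' and V' is a positive multiple of a function E. The slope S is strictly
increasing (`strictMonoOn_critS`), and E changes sign exactly once, at some q (`critE_neg`). Hence
the part of the velocity curve in the first quadrant goes out along a strictly convex graph over the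
first axis and returns along a strictly convex graph over the second one, and the two have a common
tangent at their meeting point (`exists_arcPair`): this is a cusp. The third derivative along a
suitable kernel vector is -E/γ, so the cusps are exactly V₃. Reflections give all of Ψ₂, whose
topology follows from the inequalities in `HalfArc` and `ArcPair`. -/

theorem one_lt_rank_plane : 1 < Module.rank ℝ Plane := by
  rw [← Module.finrank_eq_rank, finrank_euclideanSpace_fin]
  norm_num

/-- Polar coordinates: the exterior is the image of (1, ∞) times the unit circle, and the circle is
connected because the dimension exceeds one. -/
theorem isPreconnected_compl_closedBall :
    IsPreconnected (Metric.closedBall (0 : Plane) 1)ᶜ := by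
  have h : (Metric.closedBall (0 : Plane) 1)ᶜ =
      (fun q : ℝ × Plane => q.1 • q.2) '' (Ioi (1 : ℝ) ×ˢ Metric.sphere (0 : Plane) 1) := by
    ext x
    simp only [mem_compl_iff, Metric.mem_closedBall, dist_zero_right, not_le, mem_image, mem_prod,
      mem_Ioi, mem_sphere_iff_norm, sub_zero, Prod.exists]
    constructor
    · intro hx
      refine ⟨‖x‖, ‖x‖⁻¹ • x, ⟨hx, ?_⟩, ?_⟩
      · rw [norm_smul, norm_inv, norm_norm, inv_mul_cancel₀ (by positivity)]
      · rw [smul_smul, mul_inv_cancel₀ (by positivity), one_smul]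
    · rintro ⟨r, y, ⟨hr, hy⟩, rfl⟩
      rw [norm_smul, hy, mul_one, Real.norm_eq_abs]
      exact lt_of_lt_of_le hr (le_abs_self r)
  rw [h]
  refine (isPreconnected_Ioi.prod (isPreconnected_sphere one_lt_rank_plane 0 1)).image _ ?_
  exact (continuous_fst.smul continuous_snd).continuousOn

/-- The plane as the target of the circle. -/
theorem exists_circle_param_sphere : ∃ c : Circle → Plane, Continuous c ∧ Function.Injective c ∧
    range c = Metric.sphere (0 : Plane) 1 := by
  refine ⟨fun z => Complex.orthonormalBasisOneI.repr (z : ℂ), by fun_prop, ?_, ?_⟩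
  · intro z w h
    exact Subtype.ext (Complex.orthonormalBasisOneI.repr.injective h)
  · ext x
    simp only [mem_range, mem_sphere_iff_norm, sub_zero]
    constructor
    · rintro ⟨z, rfl⟩
      rw [LinearIsometryEquiv.norm_map, Circle.norm_coe]
    · intro hx
      refine ⟨⟨Complex.orthonormalBasisOneI.repr.symm x, ?_⟩, ?_⟩
      · rw [Submonoid.unitSphere, Submonoid.mem_mk]
        exact mem_sphere_zero_iff_norm.2 (by rw [LinearIsometryEquiv.norm_map, hx])
      · exact LinearIsometryEquiv.apply_symm_apply _ _

theorem IsSimpleClosedCurve.image {S : Set Plane} (hS : IsSimpleClosedCurve S) {f : Plane → Plane}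
    (hf : ContinuousOn f S) (hi : InjOn f S) : IsSimpleClosedCurve (f '' S) := by
  obtain ⟨c, hc, hci, rfl⟩ := hS
  refine ⟨f ∘ c, hf.comp_continuous hc fun z => mem_range_self z, ?_, by rw [range_comp]⟩
  intro z w h
  exact hci (hi (mem_range_self z) (mem_range_self w) h)

theorem isSimpleClosedCurve_sphere : IsSimpleClosedCurve (Metric.sphere (0 : Plane) 1) :=
  exists_circle_param_sphere

/-- Some homeomorphism of the plane carries a bounded convex set with interior points to the unit
ball, frontier to sphere. The connectedness of the exterior is transported in the same way. -/
theorem isSimpleClosedCurve_frontier {B : Set Plane} (hc : Convex ℝ B)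
    (hne : (interior B).Nonempty) (hb : Bornology.IsBounded B) :
    IsSimpleClosedCurve (frontier B) := by
  obtain ⟨h, -, -, h3⟩ := exists_homeomorph_image_interior_closure_frontier_eq_unitBall hc hne hb
  have : frontier B = h.symm '' Metric.sphere 0 1 := by
    rw [← h3, ← image_comp]; simp
  rw [this]
  exact isSimpleClosedCurve_sphere.image h.symm.continuous.continuousOn h.symm.injective.injOn

theorem isPreconnected_compl_of_convex {B : Set Plane} (hc : Convex ℝ B) (hcl : IsClosed B)
    (hne : (interior B).Nonempty) (hb : Bornology.IsBounded B) : IsPreconnected Bᶜ := by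
  obtain ⟨h, -, h2, -⟩ := exists_homeomorph_image_interior_closure_frontier_eq_unitBall hc hne hb
  rw [hcl.closure_eq] at h2
  have : Bᶜ = h.symm '' (Metric.closedBall 0 1)ᶜ := by
    rw [← h2, ← image_compl_eq h.bijective, ← image_comp]; simp
  rw [this]
  exact isPreconnected_compl_closedBall.image _ h.symm.continuous.continuousOn

theorem not_isBounded_compl {B : Set Plane} (hb : Bornology.IsBounded B) :
    ¬ Bornology.IsBounded Bᶜ := by
  intro h
  have := hb.union h
  rw [union_compl_self] at this
  exact NormedSpace.unbounded_univ ℝ Plane this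

/-- The region enclosed by a set whose complement is split into a bounded open part and an open part
all of whose points can escape to infinity. -/
theorem enclosedRegion_eq {C I O : Set Plane} (hI : IsOpen I) (hO : IsOpen O) (hdisj : Disjoint I O)
    (hC : Cᶜ = I ∪ O) (hb : Bornology.IsBounded I)
    (hu : ∀ x ∈ O, ∃ S ⊆ O, x ∈ S ∧ IsPreconnected S ∧ ¬ Bornology.IsBounded S) :
    enclosedRegion C = I := by
  ext x
  constructor
  · rintro ⟨hx, hxb⟩
    have hx' : x ∈ I ∪ O := hC ▸ hx
    rcases hx' with h | h
    · exact h
    · obtain ⟨S, hSO, hxS, hS, hSb⟩ := hu x h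
      refine absurd (hxb.subset ?_) hSb
      exact hS.subset_connectedComponentIn hxS (hSO.trans (hC ▸ subset_union_right))
  · intro hx
    have hxC : x ∈ Cᶜ := hC ▸ Or.inl hx
    refine ⟨hxC, hb.subset ?_⟩
    refine isPreconnected_connectedComponentIn.subset_left_of_subset_union hI hO hdisj ?_ ?_
    · rw [← hC]; exact connectedComponentIn_subset _ _
    · exact ⟨x, mem_connectedComponentIn hxC, hx⟩

/-- A closed set that has a supporting hyperplane at each of its frontier points, nonconstant with
respect to some fixed interior point, is convex. -/
theorem convex_of_support {B : Set Plane} (hcl : IsClosed B) {o : Plane} (ho : o ∈ interior B)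
    (hs : ∀ f ∈ frontier B, ∃ l : Plane →L[ℝ] ℝ, l ≠ 0 ∧ ∀ w ∈ B, l w ≤ l f) : Convex ℝ B := by
  -- `B` is the intersection of its supporting half-planes; the condition over all upper bounds `r`
  -- describes such a half-plane without naming a supremum.
  have hB : B = ⋂ l ∈ {l : Plane →L[ℝ] ℝ | l ≠ 0 ∧ ∃ f ∈ frontier B, ∀ w ∈ B, l w ≤ l f},
      {w | ∀ r, (∀ x ∈ B, l x ≤ r) → l w ≤ r} := by
    apply Subset.antisymm
    · intro w hw
      simp only [mem_iInter]
      intro l _ r hr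
      exact hr w hw
    · intro w hw
      by_contra hwB
      -- The segment from `o` to a point `w` outside `B` crosses the frontier. The functional
      -- supporting `B` there has already increased from `o` to the crossing, so it increases
      -- further up to `w`, which the half-plane at that point forbids.
      let p : ℝ → Plane := fun t => o + t • (w - o)
      have hpc : Continuous p := by fun_prop
      have hp0 : p 0 = o := by simp [p]
      have hp1 : p 1 = w := by simp [p]
      have hseg : IsPreconnected (p '' Icc (0 : ℝ) 1) := isPreconnected_Icc.image _ hpc.continuousOn
      have : (p '' Icc (0 : ℝ) 1 ∩ frontier B).Nonempty := by
        by_contra hcon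
        obtain ⟨x, -, hx1, hx2⟩ := hseg _ _ isOpen_interior hcl.isOpen_compl (fun x hx => by
          by_contra hx'
          simp only [mem_union, mem_compl_iff, not_or, not_not] at hx'
          exact hcon ⟨x, hx, subset_closure hx'.2, hx'.1⟩) ⟨o, ⟨0, by simp, hp0⟩, ho⟩
          ⟨w, ⟨1, by simp, hp1⟩, hwB⟩
        exact hx2 (interior_subset hx1)
      obtain ⟨f, ⟨t, ht, rfl⟩, hf⟩ := this
      obtain ⟨l, hl0, hl⟩ := hs _ hf
      -- A nonzero functional cannot attain its maximum over `B` at the interior point `o`.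
      have hlo : l o < l (p t) := by
        obtain ⟨e, he⟩ : ∃ e, 0 < l e := by
          by_contra! hcon
          apply hl0
          ext e
          have h1 := hcon e
          have h2 := hcon (-e)
          simp only [map_neg] at h2
          simp only [zero_apply]
          linarith
        have hc : Tendsto (fun s : ℝ => o + s • e) (𝓝[>] 0) (𝓝 o) := by
          have : Continuous fun s : ℝ => o + s • e := by fun_prop
          simpa using (this.tendsto 0).mono_left nhdsWithin_le_nhds
        obtain ⟨s, hs1, hs2⟩ := ((hc.eventually (isOpen_interior.mem_nhds ho)).and
          self_mem_nhdsWithin).exists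
        have h1 := hl _ (interior_subset hs1)
        simp only [map_add, map_smul, smul_eq_mul] at h1
        have : 0 < s * l e := mul_pos hs2 he
        linarith
      have hw' := mem_iInter₂.1 hw l ⟨hl0, _, hf, hl⟩ _ hl
      have hlp : l (p t) = l o + t * (l w - l o) := by simp [p]
      have ht1 : t ≤ 1 := ht.2
      have ht0 : 0 < t := by
        rcases ht.1.lt_or_eq with h | h
        · exact h
        · subst h; simp at hlp; linarith
      have ht1' : t ≠ 1 := by
        rintro rfl
        rw [hp1] at hf
        exact hwB (hcl.frontier_subset hf)
      have : t < 1 := lt_of_le_of_ne ht1 ht1'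
      nlinarith
  rw [hB]
  refine convex_iInter₂ fun l _ => ?_
  intro x hx y hy α β hα hβ hαβ r hr
  have h1 := hx r hr
  have h2 := hy r hr
  simp only [map_add, map_smul, smul_eq_mul]
  calc α * l x + β * l y ≤ α * r + β * r := by gcongr
    _ = r := by rw [← add_mul, hαβ, one_mul]

end LatticeVelocity

/-! ### Half arcs, and the inside and the outside of the astroid. -/

namespace LatticeVelocity

/-- The function `φ` on `[0, c]` is positive, strictly increasing, strictly convex, with value `d` and
slope `σ` at the right end. -/
structure HalfArc (c d σ : ℝ) (φ : ℝ → ℝ) : Prop where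
  pos : 0 < c
  zero_pos : 0 < φ 0
  end_eq : φ c = d
  lt : ∀ s t, 0 ≤ s → s < t → t ≤ c → φ s < φ t
  slope_lt : ∀ s t, 0 ≤ s → s < t → t ≤ c → φ t - φ s < σ * (t - s)
  convex : StrictConvexOn ℝ (Icc 0 c) φ
  -- With `slope_lt`, this says that the left derivative at `c` is `σ`; no differentiability is
  -- asked for elsewhere.
  tangent : ∀ ε > 0, ∃ s, s < c ∧ ∀ t, 0 ≤ t → s < t → t < c → (σ - ε) * (c - t) ≤ φ c - φ t

/-- The even extension of a function on `[0, c]`, constant outside `[-c, c]`. -/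
def evenExt (φ : ℝ → ℝ) (c t : ℝ) : ℝ := φ (min |t| c)

theorem evenExt_neg (φ : ℝ → ℝ) (c t : ℝ) : evenExt φ c (-t) = evenExt φ c t := by
  simp [evenExt]

theorem evenExt_of_le {φ : ℝ → ℝ} {c t : ℝ} (h : |t| ≤ c) : evenExt φ c t = φ |t| := by
  simp [evenExt, h]

namespace HalfArc

variable {c d σ : ℝ} {φ : ℝ → ℝ}

theorem le (h : HalfArc c d σ φ) {s t : ℝ} (hs : 0 ≤ s) (hst : s ≤ t) (ht : t ≤ c) :
    φ s ≤ φ t := by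
  rcases hst.lt_or_eq with h' | rfl
  · exact (h.lt s t hs h' ht).le
  · rfl

theorem slope_le (h : HalfArc c d σ φ) {s t : ℝ} (hs : 0 ≤ s) (hst : s ≤ t) (ht : t ≤ c) :
    φ t - φ s ≤ σ * (t - s) := by
  rcases hst.lt_or_eq with h' | rfl
  · exact (h.slope_lt s t hs h' ht).le
  · simp

theorem d_pos (h : HalfArc c d σ φ) : 0 < d := by
  have := h.lt 0 c le_rfl h.pos le_rfl
  rw [h.end_eq] at this
  exact h.zero_pos.trans this

theorem slope_pos (h : HalfArc c d σ φ) : 0 < σ := by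
  have h1 := h.lt 0 c le_rfl h.pos le_rfl
  have h2 := h.slope_lt 0 c le_rfl h.pos le_rfl
  have h3 := h.pos
  by_contra! hσ
  nlinarith

theorem ext_of_ge (h : HalfArc c d σ φ) {t : ℝ} (ht : c ≤ |t|) : evenExt φ c t = d := by
  simp [evenExt, ht, h.end_eq]

theorem ext_mono (h : HalfArc c d σ φ) {s t : ℝ} (hst : |s| ≤ |t|) :
    evenExt φ c s ≤ evenExt φ c t :=
  h.le (le_min (abs_nonneg s) h.pos.le) (min_le_min_right _ hst) (min_le_right _ _)

theorem ext_le (h : HalfArc c d σ φ) (t : ℝ) : evenExt φ c t ≤ d := by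
  rw [← h.end_eq]
  exact h.le (le_min (abs_nonneg t) h.pos.le) (min_le_right _ _) le_rfl

theorem ext_pos (h : HalfArc c d σ φ) (t : ℝ) : 0 < evenExt φ c t :=
  h.zero_pos.trans_le (h.le le_rfl (le_min (abs_nonneg t) h.pos.le) (min_le_right _ _))

theorem ext_sub_le (h : HalfArc c d σ φ) {s t : ℝ} (hst : |s| ≤ |t|) :
    evenExt φ c t - evenExt φ c s ≤ σ * (|t| - |s|) := by
  refine (h.slope_le (le_min (abs_nonneg s) h.pos.le) (min_le_min_right _ hst)
    (min_le_right _ _)).trans ?_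
  refine mul_le_mul_of_nonneg_left ?_ h.slope_pos.le
  rcases le_total |t| c with h1 | h1
  · rw [min_eq_left h1, min_eq_left (hst.trans h1)]
  · rw [min_eq_right h1]
    rcases le_total |s| c with h2 | h2
    · rw [min_eq_left h2]; linarith
    · rw [min_eq_right h2]; linarith

theorem continuous_ext (h : HalfArc c d σ φ) : Continuous (evenExt φ c) := by
  have : LipschitzWith (Real.toNNReal σ) (evenExt φ c) := by
    refine LipschitzWith.of_dist_le_mul fun s t => ?_
    rw [Real.coe_toNNReal _ h.slope_pos.le, Real.dist_eq, Real.dist_eq]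
    have key : ∀ s t : ℝ, |s| ≤ |t| → |evenExt φ c s - evenExt φ c t| ≤ σ * |s - t| := by
      intro s t hst
      rw [abs_sub_comm, abs_of_nonneg (sub_nonneg.2 (h.ext_mono hst))]
      refine (h.ext_sub_le hst).trans (mul_le_mul_of_nonneg_left ?_ h.slope_pos.le)
      rw [abs_sub_comm]
      exact abs_sub_abs_le_abs_sub t s
    rcases le_total |s| |t| with hst | hst
    · exact key s t hst
    · rw [abs_sub_comm, abs_sub_comm s]
      exact key t s hst
  exact this.continuous

/-- If |p| = |q|, then q = -p, and strictness comes from the strict monotonicity of `φ`; otherwise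
it comes from the strict convexity of `φ` on `[0, c]`. -/
theorem ext_convex (h : HalfArc c d σ φ) {p q α β : ℝ} (hp : |p| ≤ c) (hq : |q| ≤ c) (hpq : p ≠ q)
    (hα : 0 < α) (hβ : 0 < β) (hαβ : α + β = 1) :
    evenExt φ c (α * p + β * q) < α * evenExt φ c p + β * evenExt φ c q := by
  have hle : |α * p + β * q| ≤ α * |p| + β * |q| := by
    refine (abs_add_le _ _).trans ?_
    rw [abs_mul, abs_mul, abs_of_pos hα, abs_of_pos hβ]
  have hc : α * |p| + β * |q| ≤ c := by
    calc α * |p| + β * |q| ≤ α * c + β * c := by gcongr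
      _ = c := by rw [← add_mul, hαβ, one_mul]
  rw [evenExt_of_le hp, evenExt_of_le hq, evenExt_of_le (hle.trans hc)]
  by_cases hpq' : |p| = |q|
  · have hq' : q = -p := by
      rcases abs_eq_abs.1 hpq' with h' | h'
      · exact absurd h' hpq
      · linarith
    have hp0 : 0 < |p| := by
      rw [abs_pos]
      rintro rfl
      exact hpq (by simp [hq'])
    rw [← hpq', ← add_mul, hαβ, one_mul]
    refine h.lt _ _ (abs_nonneg _) ?_ hp
    subst hq'
    rw [show α * p + β * -p = (α - β) * p by ring, abs_mul]
    have : |α - β| < 1 := by rw [abs_lt]; constructor <;> linarith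
    nlinarith
  · refine (h.le (abs_nonneg _) hle hc).trans_lt ?_
    exact h.convex.2 ⟨abs_nonneg _, hp⟩ ⟨abs_nonneg _, hq⟩ hpq' hα hβ hαβ

end HalfArc

/-- Two half arcs, a graph over the first axis and a graph over the second axis, that meet with a
common tangent at the point `(c, d)`. -/
structure ArcPair (c d σ : ℝ) (φ ψ : ℝ → ℝ) : Prop where
  fst : HalfArc c d σ φ
  snd : HalfArc d c σ⁻¹ ψ

/-- The closed curve formed by the reflected images of a pair of half arcs. -/
def astroid (c d : ℝ) (φ ψ : ℝ → ℝ) : Set Plane :=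
  {v | (|v 0| ≤ c ∧ |v 1| = evenExt φ c (v 0)) ∨ (|v 1| ≤ d ∧ |v 0| = evenExt ψ d (v 1))}

/-- The region inside `astroid`. -/
def astroidInside (c d : ℝ) (φ ψ : ℝ → ℝ) : Set Plane :=
  {v | |v 1| < evenExt φ c (v 0) ∧ |v 0| < evenExt ψ d (v 1)}

/-- The region outside `astroid`. -/
def astroidOutside (c d : ℝ) (φ ψ : ℝ → ℝ) : Set Plane :=
  {v | evenExt φ c (v 0) < |v 1| ∨ evenExt ψ d (v 1) < |v 0|}

theorem continuous_coord (i : Fin 2) : Continuous fun v : Plane => v i := by fun_prop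

theorem plane_ext {v w : Plane} (h0 : v 0 = w 0) (h1 : v 1 = w 1) : v = w := by
  ext i; fin_cases i <;> assumption

namespace ArcPair

variable {c d σ : ℝ} {φ ψ : ℝ → ℝ}

theorem swap (h : ArcPair c d σ φ ψ) : ArcPair d c σ⁻¹ ψ φ :=
  ⟨h.snd, by rw [inv_inv]; exact h.fst⟩

/-- The two arcs lie on opposite sides of their common tangent at (c, d): the first one strictly
above it, the second one to its right. Hence a point on or above the first arc with |p| < c is
strictly to the left of the second. This is why the arcs meet only at the corner. -/
theorem lt_ext (h : ArcPair c d σ φ ψ) {p q : ℝ} (hp : |p| < c) (hq : evenExt φ c p ≤ |q|) :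
    |p| < evenExt ψ d q := by
  rcases le_total d |q| with hd | hd
  · rwa [h.snd.ext_of_ge hd]
  · have h1 := h.snd.slope_le (abs_nonneg q) hd le_rfl
    rw [h.snd.end_eq] at h1
    rw [evenExt_of_le hd]
    rw [evenExt_of_le hp.le] at hq
    have h2 := h.fst.slope_lt _ _ (abs_nonneg p) hp le_rfl
    rw [h.fst.end_eq] at h2
    have hσ := h.fst.slope_pos
    have h3 : σ⁻¹ * (d - |q|) < c - |p| := by
      rw [inv_mul_lt_iff₀ hσ]; linarith
    linarith

theorem le_ext (h : ArcPair c d σ φ ψ) {p q : ℝ} (hp : |p| ≤ c) (hq : evenExt φ c p ≤ |q|) :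
    |p| ≤ evenExt ψ d q := by
  rcases hp.lt_or_eq with hp' | hp'
  · exact (h.lt_ext hp' hq).le
  · rw [h.fst.ext_of_ge hp'.ge] at hq
    rw [h.snd.ext_of_ge hq, hp']

theorem compl_astroid (h : ArcPair c d σ φ ψ) :
    (astroid c d φ ψ)ᶜ = astroidInside c d φ ψ ∪ astroidOutside c d φ ψ := by
  ext v
  simp only [astroid, astroidInside, astroidOutside, mem_compl_iff, mem_ofPred_eq, mem_union]
  constructor
  · intro hv
    by_contra hcon
    push Not at hcon hv
    obtain ⟨h1, h2, h3⟩ := hcon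
    rcases h2.lt_or_eq with h4 | h4
    · have h5 := h1 h4
      have h6 := le_antisymm h3 h5
      exact hv.2 (h4.le.trans (h.fst.ext_le _)) h6
    · exact hv.1 (h3.trans (h.snd.ext_le _)) h4
  · rintro (⟨h1, h2⟩ | h1 | h1) (⟨h3, h4⟩ | ⟨h3, h4⟩)
    · exact h1.ne h4
    · exact h2.ne h4
    · exact h1.ne' h4
    · exact absurd (h.swap.le_ext h3 h4.ge) (not_le.2 h1)
    · exact absurd (h.le_ext h3 h4.ge) (not_le.2 h1)
    · exact h1.ne' h4

theorem isOpen_inside (h : ArcPair c d σ φ ψ) : IsOpen (astroidInside c d φ ψ) := by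
  have h1 := h.fst.continuous_ext
  have h2 := h.snd.continuous_ext
  have h3 := continuous_coord 0
  have h4 := continuous_coord 1
  exact (isOpen_lt h4.abs (h1.comp h3)).inter (isOpen_lt h3.abs (h2.comp h4))

theorem isOpen_outside (h : ArcPair c d σ φ ψ) : IsOpen (astroidOutside c d φ ψ) := by
  have h1 := h.fst.continuous_ext
  have h2 := h.snd.continuous_ext
  have h3 := continuous_coord 0
  have h4 := continuous_coord 1
  exact (isOpen_lt (h1.comp h3) h4.abs).union (isOpen_lt (h2.comp h4) h3.abs)

theorem disjoint_inside_outside : Disjoint (astroidInside c d φ ψ) (astroidOutside c d φ ψ) := by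
  rw [Set.disjoint_left]
  rintro v ⟨h1, h2⟩ (h3 | h3)
  · exact lt_asymm h1 h3
  · exact lt_asymm h2 h3

theorem zero_mem_inside (h : ArcPair c d σ φ ψ) : (0 : Plane) ∈ astroidInside c d φ ψ :=
  ⟨by simpa using h.fst.ext_pos 0, by simpa using h.snd.ext_pos 0⟩

theorem inside_abs_lt (h : ArcPair c d σ φ ψ) {v : Plane} (hv : v ∈ astroidInside c d φ ψ) :
    |v 0| < c ∧ |v 1| < d :=
  ⟨hv.2.trans_le (h.snd.ext_le _), hv.1.trans_le (h.fst.ext_le _)⟩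

end ArcPair

/-- The factor has modulus one even at `x = 0`, where it is chosen arbitrarily. -/
theorem exists_sign (x : ℝ) : ∃ ε : ℝ, |ε| = 1 ∧ x = ε * |x| := by
  rcases le_total 0 x with h | h
  · exact ⟨1, by simp, by rw [abs_of_nonneg h, one_mul]⟩
  · exact ⟨-1, by simp, by rw [abs_of_nonpos h]; ring⟩

namespace ArcPair

variable {c d σ : ℝ} {φ ψ : ℝ → ℝ}

theorem inside_smul (h : ArcPair c d σ φ ψ) {v : Plane} (hv : v ∈ astroidInside c d φ ψ)
    (h0 : v 0 = 0 ∨ v 1 = 0) : segment ℝ v 0 ⊆ astroidInside c d φ ψ := by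
  rintro w ⟨α, β, hα, hβ, hαβ, rfl⟩
  have hα1 : α ≤ 1 := by linarith
  have key : ∀ r : ℝ, |α * r| ≤ |r| := fun r => by
    rw [abs_mul, abs_of_nonneg hα]
    exact mul_le_of_le_one_left (abs_nonneg r) hα1
  rcases h0 with h0 | h0
  · refine ⟨?_, ?_⟩
    · have := hv.1
      rw [h0] at this
      simpa [h0] using (key (v 1)).trans_lt this
    · simpa [h0] using h.snd.ext_pos _
  · refine ⟨?_, ?_⟩
    · simpa [h0] using h.fst.ext_pos _
    · have := hv.2
      rw [h0] at this
      simpa [h0] using (key (v 0)).trans_lt this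

/-- Moving towards the axes parallel to the tangent direction (1, σ) stays inside, because `φ` and
`ψ` have Lipschitz constants `σ` and `σ⁻¹`. Once an axis is reached, a segment leads to the origin.
-/
theorem isPreconnected_inside (h : ArcPair c d σ φ ψ) : IsPreconnected (astroidInside c d φ ψ) := by
  refine isPreconnected_of_forall 0 fun v hv => ?_
  have hσ := h.fst.slope_pos
  obtain ⟨ε₀, hε₀, hv0⟩ := exists_sign (v 0)
  obtain ⟨ε₁, hε₁, hv1⟩ := exists_sign (v 1)
  -- The largest displacement along (1, σ) before one of the coordinates vanishes.
  set t := min |v 0| (σ⁻¹ * |v 1|) with ht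
  have ht0 : 0 ≤ t := le_min (abs_nonneg _) (by positivity)
  have ht1 : t ≤ |v 0| := min_le_left _ _
  have ht2 : σ * t ≤ |v 1| := by
    have := min_le_right |v 0| (σ⁻¹ * |v 1|)
    rwa [← ht, inv_mul_eq_div, le_div_iff₀' hσ] at this
  set w : Plane := !₂[ε₀ * (|v 0| - t), ε₁ * (|v 1| - σ * t)] with hw
  have hseg : segment ℝ v w ⊆ astroidInside c d φ ψ := by
    rintro z ⟨α, β, hα, hβ, hαβ, rfl⟩
    have hα' : α = 1 - β := by linarith
    have e0 : (α • v + β • w) 0 = ε₀ * (|v 0| - β * t) := by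
      simp only [hw, PiLp.add_apply, PiLp.smul_apply, smul_eq_mul, Matrix.cons_val_zero]
      nth_rewrite 1 [hv0]
      rw [hα']; ring
    have e1 : (α • v + β • w) 1 = ε₁ * (|v 1| - σ * (β * t)) := by
      simp only [hw, PiLp.add_apply, PiLp.smul_apply, smul_eq_mul, Matrix.cons_val_one,
        Matrix.cons_val_fin_one]
      nth_rewrite 1 [hv1]
      rw [hα']; ring
    have hβt : 0 ≤ β * t := by positivity
    have hβt' : β * t ≤ t := mul_le_of_le_one_left ht0 (by linarith)
    have a0 : |(α • v + β • w) 0| = |v 0| - β * t := by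
      rw [e0, abs_mul, hε₀, one_mul, abs_of_nonneg]; linarith
    have a1 : |(α • v + β • w) 1| = |v 1| - σ * (β * t) := by
      rw [e1, abs_mul, hε₁, one_mul, abs_of_nonneg]; nlinarith
    have g1 := hv.1
    have g2 := hv.2
    refine ⟨?_, ?_⟩
    · have := h.fst.ext_sub_le (s := (α • v + β • w) 0) (t := v 0) (by rw [a0]; linarith)
      rw [a0] at this
      rw [a1]
      linarith
    · have := h.snd.ext_sub_le (s := (α • v + β • w) 1) (t := v 1)
        (by rw [a1]; nlinarith)
      rw [a1] at this
      rw [a0]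
      have e : σ⁻¹ * (|v 1| - (|v 1| - σ * (β * t))) = β * t := by field_simp; ring
      linarith
  have hwaxis : w 0 = 0 ∨ w 1 = 0 := by
    rcases min_choice |v 0| (σ⁻¹ * |v 1|) with h' | h'
    · left; simp [hw, ht, h']
    · right
      have : σ * t = |v 1| := by rw [ht, h', mul_inv_cancel_left₀ hσ.ne']
      simp [hw, this]
  refine ⟨segment ℝ v w ∪ segment ℝ w 0, union_subset hseg ?_, Or.inr (right_mem_segment _ _ _),
    Or.inl (left_mem_segment _ _ _), ?_⟩
  · exact h.inside_smul (hseg (right_mem_segment _ _ _)) hwaxis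
  · exact IsPreconnected.union w (right_mem_segment _ _ _) (left_mem_segment _ _ _)
      (convex_segment _ _).isPreconnected (convex_segment _ _).isPreconnected

/-- Increasing in modulus the coordinate that is too large leaves the other one unchanged, so the
defining inequality persists along a whole ray. -/
theorem escape_outside (h : ArcPair c d σ φ ψ) {v : Plane} (hv : v ∈ astroidOutside c d φ ψ) :
    ∃ S ⊆ astroidOutside c d φ ψ, v ∈ S ∧ IsPreconnected S ∧ ¬ Bornology.IsBounded S := by
  have key : ∀ (i : Fin 2) (w : Plane), w i ≠ 0 → ¬ Bornology.IsBounded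
      ((fun s : ℝ => v + s • w) '' Ici 0) := by
    intro i w hw hb
    obtain ⟨r, hr⟩ := hb.exists_norm_le
    set s := (|r| + |v i| + 1) / |w i|
    have hw' : 0 < |w i| := abs_pos.2 hw
    have hs : 0 ≤ s := by positivity
    have h1 := (PiLp.norm_apply_le (v + s • w) i).trans (hr _ ⟨s, hs, rfl⟩)
    have h2 : |s * w i| = |r| + |v i| + 1 := by
      rw [abs_mul, abs_of_nonneg hs]; simp only [s]; field_simp
    have h3 : |s * w i| ≤ |v i + s * w i| + |v i| := by
      have := abs_sub (v i + s * w i) (v i)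
      rwa [add_sub_cancel_left] at this
    simp only [PiLp.add_apply, PiLp.smul_apply, smul_eq_mul, Real.norm_eq_abs] at h1
    have := le_abs_self r
    linarith
  have hcont : ∀ w : Plane, IsPreconnected ((fun s : ℝ => v + s • w) '' Ici 0) := fun w =>
    isPreconnected_Ici.image _ (by fun_prop)
  have habs : ∀ r s : ℝ, 0 ≤ s → |r| ≤ |r + s * r| := fun r s hs => by
    rw [show r + s * r = (1 + s) * r by ring, abs_mul, abs_of_nonneg (by linarith : 0 ≤ 1 + s)]
    nlinarith [abs_nonneg r]
  rcases hv with hv | hv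
  · refine ⟨(fun s : ℝ => v + s • (!₂[0, v 1] : Plane)) '' Ici 0, ?_, ⟨0, by simp, by simp⟩,
      hcont _, key 1 _ ?_⟩
    · rintro _ ⟨s, hs, rfl⟩
      left
      simpa using hv.trans_le (habs (v 1) s hs)
    · have : 0 < |v 1| := (h.fst.ext_pos _).trans hv
      simpa using this
  · refine ⟨(fun s : ℝ => v + s • (!₂[v 0, 0] : Plane)) '' Ici 0, ?_, ⟨0, by simp, by simp⟩,
      hcont _, key 0 _ ?_⟩
    · rintro _ ⟨s, hs, rfl⟩
      right
      simpa using hv.trans_le (habs (v 0) s hs)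
    · have : 0 < |v 0| := (h.snd.ext_pos _).trans hv
      simpa using this

end ArcPair

end LatticeVelocity

/-! ### The astroid as a simple closed curve made of four concave arcs. -/

namespace LatticeVelocity

/-- The boundary of the rectangle `[-c, c] × [-d, d]`. -/
def rectBoundary (c d : ℝ) : Set Plane :=
  {v | (|v 0| = c ∧ |v 1| ≤ d) ∨ (|v 1| = d ∧ |v 0| ≤ c)}

theorem isSimpleClosedCurve_rectBoundary {c d : ℝ} (hc : 0 < c) (hd : 0 < d) :
    IsSimpleClosedCurve (rectBoundary c d) := by
  -- The gauge of the rectangle; radial projection by it carries the unit circle onto the boundary.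
  set μ : Plane → ℝ := fun v => max (|v 0| / c) (|v 1| / d) with hμ
  have hμc : Continuous μ := by
    have h3 := continuous_coord 0
    have h4 := continuous_coord 1
    exact (h3.abs.div_const c).max (h4.abs.div_const d)
  have hμp : ∀ v : Plane, v ≠ 0 → 0 < μ v := by
    intro v hv
    by_contra! hcon
    have h1 := (le_max_left _ _).trans hcon
    have h2 := (le_max_right _ _).trans hcon
    have h3 : |v 0| ≤ 0 := by
      by_contra! h; exact absurd h1 (not_le.2 (by positivity))
    have h4 : |v 1| ≤ 0 := by
      by_contra! h; exact absurd h2 (not_le.2 (by positivity))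
    apply hv
    exact plane_ext (by simpa using h3) (by simpa using h4)
  have hne : ∀ v ∈ Metric.sphere (0 : Plane) 1, v ≠ 0 := by
    rintro v hv rfl
    simp at hv
  have hμs : ∀ (r : ℝ) (v : Plane), 0 ≤ r → μ (r • v) = r * μ v := by
    intro r v hr
    simp only [hμ, PiLp.smul_apply, smul_eq_mul, abs_mul, abs_of_nonneg hr, mul_div_assoc]
    rw [mul_max_of_nonneg _ _ hr]
  have hrect : rectBoundary c d = {v | μ v = 1} := by
    ext v
    simp only [rectBoundary, hμ, mem_ofPred_eq]
    rw [← div_eq_one_iff_eq hc.ne', ← div_eq_one_iff_eq hd.ne', ← div_le_one hd, ← div_le_one hc]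
    constructor
    · rintro (⟨h1, h2⟩ | ⟨h1, h2⟩)
      · rw [h1, max_eq_left h2]
      · rw [h1, max_eq_right h2]
    · intro h
      rcases max_choice (|v 0| / c) (|v 1| / d) with h' | h'
      · left; exact ⟨h' ▸ h, h ▸ le_max_right _ _⟩
      · right; exact ⟨h' ▸ h, h ▸ le_max_left _ _⟩
  have himg : rectBoundary c d = (fun v => (μ v)⁻¹ • v) '' Metric.sphere (0 : Plane) 1 := by
    rw [hrect]
    ext v
    constructor
    · intro hv
      have hv1 : μ v = 1 := hv
      have hv0 : v ≠ 0 := by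
        rintro rfl
        simp [hμ] at hv1
      have hn : 0 < ‖v‖ := norm_pos_iff.2 hv0
      refine ⟨‖v‖⁻¹ • v, ?_, ?_⟩
      · rw [mem_sphere_zero_iff_norm, norm_smul, norm_inv, norm_norm, inv_mul_cancel₀ hn.ne']
      · simp only
        rw [hμs _ _ (by positivity), hv1, mul_one, inv_inv, smul_smul, mul_inv_cancel₀ hn.ne',
          one_smul]
    · rintro ⟨w, hw, rfl⟩
      have := hμp w (hne w hw)
      simp only [mem_ofPred_eq]
      rw [hμs _ _ (by positivity), inv_mul_cancel₀ this.ne']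
  rw [himg]
  refine isSimpleClosedCurve_sphere.image ?_ ?_
  · exact (hμc.continuousOn.inv₀ fun v hv => (hμp v (hne v hv)).ne').smul continuousOn_id
  · intro v hv w hw h
    have h1 := hμp v (hne v hv)
    have h2 := hμp w (hne w hw)
    simp only at h
    have hv1 := mem_sphere_zero_iff_norm.1 hv
    have hw1 := mem_sphere_zero_iff_norm.1 hw
    have h3 := congrArg norm h
    rw [norm_smul, norm_smul, hv1, hw1, mul_one, mul_one, norm_inv, norm_inv, inv_inj,
      Real.norm_of_nonneg h1.le, Real.norm_of_nonneg h2.le] at h3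
    rw [h3] at h
    exact smul_right_injective Plane (inv_ne_zero h2.ne') h

namespace ArcPair

variable {c d σ : ℝ} {φ ψ : ℝ → ℝ}

/-- The map from the boundary of the rectangle to the astroid. -/
noncomputable def rectMap (c d : ℝ) (φ ψ : ℝ → ℝ) (v : Plane) : Plane :=
  !₂[v 0 / c * evenExt ψ d (v 1), v 1 / d * evenExt φ c (v 0)]

theorem rectMap_side (h : ArcPair c d σ φ ψ) {v : Plane} (h0 : |v 0| = c) :
    rectMap c d φ ψ v 1 = v 1 ∧ |rectMap c d φ ψ v 0| = evenExt ψ d (v 1) := by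
  have hd := h.fst.d_pos
  have hc := h.fst.pos
  constructor
  · simp [rectMap, h.fst.ext_of_ge h0.ge, hd.ne']
  · simp [rectMap, abs_mul, abs_div, h0, abs_of_pos hc, hc.ne', abs_of_pos (h.snd.ext_pos _)]

theorem rectMap_top (h : ArcPair c d σ φ ψ) {v : Plane} (h0 : |v 1| = d) :
    rectMap c d φ ψ v 0 = v 0 ∧ |rectMap c d φ ψ v 1| = evenExt φ c (v 0) := by
  have hd := h.fst.d_pos
  have hc := h.fst.pos
  constructor
  · simp [rectMap, h.snd.ext_of_ge h0.ge, hc.ne']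
  · simp [rectMap, abs_mul, abs_div, h0, abs_of_pos hd, hd.ne', abs_of_pos (h.fst.ext_pos _)]

/-- By `lt_ext` the arcs cannot meet where |v 0| < c. This separates the images of horizontal and
vertical sides in `injOn_rectMap`. -/
theorem corner_of_mem_both (h : ArcPair c d σ φ ψ) {v : Plane}
    (h0 : |v 0| ≤ c) (h1 : |v 1| = evenExt φ c (v 0)) (h2 : |v 0| = evenExt ψ d (v 1)) :
    |v 0| = c ∧ |v 1| = d := by
  have hc : |v 0| = c := by
    by_contra hne
    exact (h.lt_ext (lt_of_le_of_ne h0 hne) h1.ge).ne h2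
  exact ⟨hc, by rw [h1, h.fst.ext_of_ge hc.ge]⟩

theorem rectMap_corner (h : ArcPair c d σ φ ψ) {v : Plane} (hv : v ∈ rectBoundary c d)
    (h0 : |rectMap c d φ ψ v 0| = c) (h1 : |rectMap c d φ ψ v 1| = d) : rectMap c d φ ψ v = v := by
  have : |v 0| = c ∧ |v 1| = d := by
    rcases hv with ⟨h2, -⟩ | ⟨h2, -⟩
    · exact ⟨h2, (h.rectMap_side h2).1 ▸ h1⟩
    · exact ⟨(h.rectMap_top h2).1 ▸ h0, h2⟩
  exact plane_ext (h.rectMap_top this.2).1 (h.rectMap_side this.1).1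

theorem eq_of_mul_eq {x y r s k : ℝ} (hr : 0 < r) (hs : 0 < s) (hk : 0 < k)
    (hx : |x| = k) (hy : |y| = k) (h : x * r = y * s) : x = y := by
  rcases abs_eq_abs.1 (hx.trans hy.symm) with h' | h'
  · exact h'
  · subst h'
    have h2 : y * (r + s) = 0 := by linarith
    have : y = 0 := by
      rcases mul_eq_zero.1 h2 with h3 | h3
      · exact h3
      · linarith
    simp [this] at hy
    linarith

theorem injOn_rectMap (h : ArcPair c d σ φ ψ) : InjOn (rectMap c d φ ψ) (rectBoundary c d) := by
  have hd := h.fst.d_pos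
  have hc := h.fst.pos
  have mixed : ∀ v w : Plane, |v 0| = c → v ∈ rectBoundary c d → |w 1| = d →
      |w 0| ≤ c → w ∈ rectBoundary c d →
      rectMap c d φ ψ v = rectMap c d φ ψ w → v = w := by
    intro v w hv hv' hw hw1 hw' hvw
    obtain ⟨a1, a2⟩ := h.rectMap_side hv
    obtain ⟨b1, b2⟩ := h.rectMap_top hw
    rw [hvw] at a1 a2
    have := h.corner_of_mem_both (v := rectMap c d φ ψ w) (by rw [b1]; exact hw1) (by rw [b2, b1])
      (by rw [a2, a1])
    rw [← h.rectMap_corner hw' this.1 this.2, ← hvw]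
    rw [← hvw] at this
    exact (h.rectMap_corner hv' this.1 this.2).symm
  intro v hv w hw hvw
  have hv0 := hv
  have hw0 := hw
  rcases hv with ⟨hv1, hv2⟩ | ⟨hv1, hv2⟩ <;> rcases hw with ⟨hw1, hw2⟩ | ⟨hw1, hw2⟩
  · have e1 : v 1 = w 1 := by
      rw [← (h.rectMap_side hv1).1, ← (h.rectMap_side hw1).1, hvw]
    refine plane_ext ?_ e1
    have h3 := congrFun (congrArg WithLp.ofLp hvw) 0
    simp only [rectMap, Matrix.cons_val_zero, div_mul_eq_mul_div] at h3
    rw [div_left_inj' hc.ne'] at h3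
    exact eq_of_mul_eq (h.snd.ext_pos _) (h.snd.ext_pos _) hc hv1 hw1 h3
  · exact mixed v w hv1 hv0 hw1 hw2 hw0 hvw
  · exact (mixed w v hw1 hw0 hv1 hv2 hv0 hvw.symm).symm
  · have e1 : v 0 = w 0 := by
      rw [← (h.rectMap_top hv1).1, ← (h.rectMap_top hw1).1, hvw]
    refine plane_ext e1 ?_
    have h3 := congrFun (congrArg WithLp.ofLp hvw) 1
    simp only [rectMap, Matrix.cons_val_one, Matrix.cons_val_fin_one, div_mul_eq_mul_div] at h3
    rw [div_left_inj' hd.ne'] at h3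
    exact eq_of_mul_eq (h.fst.ext_pos _) (h.fst.ext_pos _) hd hv1 hw1 h3

theorem image_rectMap (h : ArcPair c d σ φ ψ) :
    rectMap c d φ ψ '' rectBoundary c d = astroid c d φ ψ := by
  have hd := h.fst.d_pos
  have hc := h.fst.pos
  apply Subset.antisymm
  · rintro _ ⟨v, ⟨h1, h2⟩ | ⟨h1, h2⟩, rfl⟩
    · obtain ⟨a1, a2⟩ := h.rectMap_side h1
      right
      rw [a2, a1]
      exact ⟨h2, rfl⟩
    · obtain ⟨a1, a2⟩ := h.rectMap_top h1
      left
      rw [a2, a1]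
      exact ⟨h2, rfl⟩
  · rintro v (⟨h1, h2⟩ | ⟨h1, h2⟩)
    · obtain ⟨ε, hε, hv⟩ := exists_sign (v 1)
      have hw : |(!₂[v 0, ε * d] : Plane) 1| = d := by simp [abs_mul, hε, abs_of_pos hd]
      refine ⟨!₂[v 0, ε * d], Or.inr ⟨hw, by simpa using h1⟩, ?_⟩
      refine plane_ext ?_ ?_
      · rw [(h.rectMap_top hw).1]; simp
      · rw [hv, h2]
        simp [rectMap, hd.ne']
    · obtain ⟨ε, hε, hv⟩ := exists_sign (v 0)
      have hw : |(!₂[ε * c, v 1] : Plane) 0| = c := by simp [abs_mul, hε, abs_of_pos hc]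
      refine ⟨!₂[ε * c, v 1], Or.inl ⟨hw, by simpa using h1⟩, ?_⟩
      refine plane_ext ?_ ?_
      · rw [hv, h2]
        simp [rectMap, hc.ne']
      · rw [(h.rectMap_side hw).1]; simp

theorem isSimpleClosedCurve_astroid (h : ArcPair c d σ φ ψ) :
    IsSimpleClosedCurve (astroid c d φ ψ) := by
  rw [← h.image_rectMap]
  refine (isSimpleClosedCurve_rectBoundary h.fst.pos h.fst.d_pos).image ?_ h.injOn_rectMap
  have h1 := h.fst.continuous_ext
  have h2 := h.snd.continuous_ext
  have : Continuous (rectMap c d φ ψ) := by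
    refine (PiLp.continuous_toLp 2 _).comp (continuous_pi fun i => ?_)
    fin_cases i
    · exact ((continuous_coord 0).div_const c).mul (h2.comp (continuous_coord 1))
    · exact ((continuous_coord 1).div_const d).mul (h1.comp (continuous_coord 0))
  exact this.continuousOn

end ArcPair

/-- The four arcs of the astroid. -/
noncomputable def astroidArc (c d : ℝ) (φ ψ : ℝ → ℝ) : Fin 4 → Set Plane :=
  ![{v | |v 0| ≤ c ∧ v 1 = evenExt φ c (v 0)}, {v | |v 1| ≤ d ∧ v 0 = -evenExt ψ d (v 1)},
    {v | |v 0| ≤ c ∧ v 1 = -evenExt φ c (v 0)}, {v | |v 1| ≤ d ∧ v 0 = evenExt ψ d (v 1)}]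

/-- The four corners of the rectangle `[-c, c] × [-d, d]`. -/
noncomputable def rectCorner (c d : ℝ) : Fin 4 → Plane := ![!₂[c, d], !₂[-c, d], !₂[-c, -d], !₂[c, -d]]

/-- The arc is traversed from parameter `r` to `-r`, and `r` may be negative, so both orientations
are covered. -/
theorem isSimpleArc_of_param {g : ℝ → Plane} (hg : Continuous g) (hi : Function.Injective g)
    {r : ℝ} (hr : r ≠ 0) {A : Set Plane} {x y : Plane} (hx : g r = x) (hy : g (-r) = y)
    (hA : ∀ v, v ∈ A ↔ ∃ t, |t| ≤ |r| ∧ g t = v) : IsSimpleArc A x y := by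
  refine ⟨fun t => g (r * (1 - 2 * (t : ℝ))), by fun_prop, ?_, by simp [hx], ?_, ?_⟩
  · intro s t hst
    have := mul_left_cancel₀ hr (hi hst)
    exact Subtype.ext (by linarith)
  · rw [← hy]
    simp only [Set.Icc.coe_one]
    congr 1
    ring
  · ext v
    rw [hA]
    constructor
    · rintro ⟨t, rfl⟩
      refine ⟨_, ?_, rfl⟩
      rw [abs_mul]
      refine mul_le_of_le_one_right (abs_nonneg r) ?_
      have h1 := t.2.1
      have h2 := t.2.2
      rw [abs_le]
      constructor <;> linarith
    · rintro ⟨t, ht, rfl⟩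
      have h1 : |t / r| ≤ 1 := by
        rw [abs_div]; exact (div_le_one (abs_pos.2 hr)).2 ht
      rw [abs_le] at h1
      refine ⟨⟨(1 - t / r) / 2, by constructor <;> linarith⟩, ?_⟩
      simp only
      congr 1
      field_simp
      ring

theorem continuous_vec {f g : ℝ → ℝ} (hf : Continuous f) (hg : Continuous g) :
    Continuous fun t => (!₂[f t, g t] : Plane) := by
  refine (PiLp.continuous_toLp 2 _).comp (continuous_pi fun i => ?_)
  fin_cases i
  · exact hf
  · exact hg

namespace ArcPair

variable {c d σ : ℝ} {φ ψ : ℝ → ℝ}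

theorem isSimpleArc_arc (h : ArcPair c d σ φ ψ) (i : Fin 4) :
    IsSimpleArc (astroidArc c d φ ψ i) (rectCorner c d i) (rectCorner c d (i + 1)) := by
  have hd := h.fst.d_pos
  have hc := h.fst.pos
  have h1 := h.fst.continuous_ext
  have h2 := h.snd.continuous_ext
  have ec : evenExt φ c c = d := h.fst.ext_of_ge (le_abs_self c)
  have ed : evenExt ψ d d = c := h.snd.ext_of_ge (le_abs_self d)
  have inj0 : ∀ f : ℝ → ℝ, Function.Injective fun t => (!₂[t, f t] : Plane) := fun f s t hst => by
    simpa using congrFun (congrArg WithLp.ofLp hst) 0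
  have inj1 : ∀ f : ℝ → ℝ, Function.Injective fun t => (!₂[f t, t] : Plane) := fun f s t hst => by
    simpa using congrFun (congrArg WithLp.ofLp hst) 1
  have mem0 : ∀ (f : ℝ → ℝ) (r : ℝ) (v : Plane),
      (|v 0| ≤ r ∧ v 1 = f (v 0)) ↔ ∃ t, |t| ≤ r ∧ (!₂[t, f t] : Plane) = v := by
    intro f r v
    constructor
    · rintro ⟨a, b⟩
      exact ⟨v 0, a, plane_ext (by simp) (by simp [b])⟩
    · rintro ⟨t, ht, rfl⟩
      simpa using ht
  have mem1 : ∀ (f : ℝ → ℝ) (r : ℝ) (v : Plane),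
      (|v 1| ≤ r ∧ v 0 = f (v 1)) ↔ ∃ t, |t| ≤ r ∧ (!₂[f t, t] : Plane) = v := by
    intro f r v
    constructor
    · rintro ⟨a, b⟩
      exact ⟨v 1, a, plane_ext (by simp [b]) (by simp)⟩
    · rintro ⟨t, ht, rfl⟩
      simpa using ht
  fin_cases i
  · refine isSimpleArc_of_param (continuous_vec continuous_id h1) (inj0 _) (r := c) hc.ne' ?_ ?_ ?_
    · simp [rectCorner, ec]
    · simp [rectCorner, ec, evenExt_neg]
    · rw [abs_of_pos hc]; exact mem0 _ c
  · refine isSimpleArc_of_param (continuous_vec h2.neg continuous_id) (inj1 _) (r := d) hd.ne' ?_ ?_ ?_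
    · simp [rectCorner, ed]
    · simp [rectCorner, ed, evenExt_neg]
    · rw [abs_of_pos hd]; exact mem1 (fun t => -evenExt ψ d t) d
  · refine isSimpleArc_of_param (continuous_vec continuous_id h1.neg) (inj0 _) (r := -c)
      (neg_ne_zero.2 hc.ne') ?_ ?_ ?_
    · simp [rectCorner, ec, evenExt_neg]
    · simp [rectCorner, ec]
    · rw [abs_neg, abs_of_pos hc]; exact mem0 (fun t => -evenExt φ c t) c
  · refine isSimpleArc_of_param (continuous_vec h2 continuous_id) (inj1 _) (r := -d)
      (neg_ne_zero.2 hd.ne') ?_ ?_ ?_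
    · simp [rectCorner, ed, evenExt_neg]
    · simp [rectCorner, ed]
    · rw [abs_neg, abs_of_pos hd]; exact mem1 _ d

theorem iUnion_arc (h : ArcPair c d σ φ ψ) : ⋃ i, astroidArc c d φ ψ i = astroid c d φ ψ := by
  ext v
  have h1 := h.fst.ext_pos (v 0)
  have h2 := h.snd.ext_pos (v 1)
  simp only [mem_iUnion, Fin.exists_fin_succ, astroidArc, astroid, mem_ofPred_eq, abs_eq h1.le,
    abs_eq h2.le]
  simp
  tauto

theorem corner_mem (h : ArcPair c d σ φ ψ) (i : Fin 4) :
    rectCorner c d i ∈ astroidArc c d φ ψ i ∧ rectCorner c d (i + 1) ∈ astroidArc c d φ ψ i := by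
  obtain ⟨g, -, -, h0, h1, hg⟩ := h.isSimpleArc_arc i
  rw [← hg]
  exact ⟨⟨0, h0⟩, ⟨1, h1⟩⟩

theorem arc_inter_next (h : ArcPair c d σ φ ψ) (i : Fin 4) {v : Plane}
    (h1 : v ∈ astroidArc c d φ ψ i) (h2 : v ∈ astroidArc c d φ ψ (i + 1)) :
    v = rectCorner c d (i + 1) := by
  have hd := h.fst.d_pos
  have hc := h.fst.pos
  have e1 := h.fst.ext_pos (v 0)
  have e2 := h.snd.ext_pos (v 1)
  have key : ∀ ε₀ ε₁ : ℝ, |ε₀| = 1 → |ε₁| = 1 → |v 0| ≤ c → v 0 = ε₀ * evenExt ψ d (v 1) →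
      v 1 = ε₁ * evenExt φ c (v 0) → v = !₂[ε₀ * c, ε₁ * d] := by
    intro ε₀ ε₁ hε₀ hε₁ h3 h4 h5
    have h6 : |v 0| = evenExt ψ d (v 1) := by
      have := congrArg abs h4; rwa [abs_mul, hε₀, one_mul, abs_of_pos e2] at this
    have h7 : |v 1| = evenExt φ c (v 0) := by
      have := congrArg abs h5; rwa [abs_mul, hε₁, one_mul, abs_of_pos e1] at this
    obtain ⟨h8, h9⟩ := h.corner_of_mem_both h3 h7 h6
    refine plane_ext ?_ ?_
    · rw [h4, ← h6, h8]; simp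
    · rw [h5, ← h7, h9]; simp
  fin_cases i
  · have := key (-1) 1 (by simp) (by simp) h1.1 (by rw [neg_one_mul]; exact h2.2)
      (by rw [one_mul]; exact h1.2)
    simpa [rectCorner] using this
  · have := key (-1) (-1) (by simp) (by simp) h2.1 (by rw [neg_one_mul]; exact h1.2)
      (by rw [neg_one_mul]; exact h2.2)
    simpa [rectCorner] using this
  · have := key 1 (-1) (by simp) (by simp) h1.1 (by rw [one_mul]; exact h2.2)
      (by rw [neg_one_mul]; exact h1.2)
    simpa [rectCorner] using this
  · have := key 1 1 (by simp) (by simp) h2.1 (by rw [one_mul]; exact h1.2)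
      (by rw [one_mul]; exact h2.2)
    simpa [rectCorner] using this

theorem arc_inter_opposite (h : ArcPair c d σ φ ψ) (i : Fin 4) {v : Plane}
    (h1 : v ∈ astroidArc c d φ ψ i) (h2 : v ∈ astroidArc c d φ ψ (i + 2)) : False := by
  have e1 := h.fst.ext_pos (v 0)
  have e2 := h.snd.ext_pos (v 1)
  fin_cases i
  · have a1 : v 1 = evenExt φ c (v 0) := h1.2
    have a2 : v 1 = -evenExt φ c (v 0) := h2.2
    linarith
  · have a1 : v 0 = -evenExt ψ d (v 1) := h1.2
    have a2 : v 0 = evenExt ψ d (v 1) := h2.2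
    linarith
  · have a1 : v 1 = -evenExt φ c (v 0) := h1.2
    have a2 : v 1 = evenExt φ c (v 0) := h2.2
    linarith
  · have a1 : v 0 = evenExt ψ d (v 1) := h1.2
    have a2 : v 0 = -evenExt ψ d (v 1) := h2.2
    linarith

theorem arc_inter (h : ArcPair c d σ φ ψ) (i j : Fin 4) (hij : i ≠ j) :
    astroidArc c d φ ψ i ∩ astroidArc c d φ ψ j =
      {rectCorner c d i, rectCorner c d (i + 1)} ∩ {rectCorner c d j, rectCorner c d (j + 1)} := by
  have hsub : ∀ k, {rectCorner c d k, rectCorner c d (k + 1)} ⊆ astroidArc c d φ ψ k := fun k => by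
    rintro v (rfl | rfl)
    · exact (h.corner_mem k).1
    · exact (h.corner_mem k).2
  refine Subset.antisymm ?_ (inter_subset_inter (hsub i) (hsub j))
  have hcases : j = i + 1 ∨ j = i + 2 ∨ i = j + 1 := by revert i j; decide
  rintro v ⟨h1, h2⟩
  rcases hcases with rfl | rfl | rfl
  · have := h.arc_inter_next i h1 h2
    exact ⟨Or.inr this, Or.inl this⟩
  · exact (h.arc_inter_opposite i h1 h2).elim
  · have := h.arc_inter_next j h2 h1
    exact ⟨Or.inl this, Or.inr this⟩

theorem closure_inside_subset (h : ArcPair c d σ φ ψ) : closure (astroidInside c d φ ψ) ⊆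
    {v | |v 1| ≤ evenExt φ c (v 0) ∧ |v 0| ≤ evenExt ψ d (v 1)} := by
  have h1 := h.fst.continuous_ext
  have h2 := h.snd.continuous_ext
  have h3 := continuous_coord 0
  have h4 := continuous_coord 1
  refine closure_minimal (fun v hv => ⟨hv.1.le, hv.2.le⟩) ?_
  exact (isClosed_le h4.abs (h1.comp h3)).inter (isClosed_le h3.abs (h2.comp h4))

/-- An open chord of a strictly convex graph lies strictly above the graph, hence strictly beyond
the weak inequalities that hold on the closure of the inside. The other three arcs only differ by
signs and the exchange of the axes. -/
theorem isConcaveArc_arc (h : ArcPair c d σ φ ψ) (i : Fin 4) :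
    IsConcaveArc (astroidInside c d φ ψ) (astroidArc c d φ ψ i) := by
  intro x hx y hy hxy
  rw [Set.disjoint_left]
  rintro _ ⟨α, β, hα, hβ, hαβ, rfl⟩ hz
  have hz' := h.closure_inside_subset hz
  simp only [mem_ofPred_eq, PiLp.add_apply, PiLp.smul_apply, smul_eq_mul] at hz'
  obtain ⟨z1, z0⟩ := hz'
  rw [abs_le] at z0 z1
  fin_cases i
  · have a : |x 0| ≤ c ∧ x 1 = evenExt φ c (x 0) := hx
    have b : |y 0| ≤ c ∧ y 1 = evenExt φ c (y 0) := hy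
    have hne : x 0 ≠ y 0 := fun he => hxy (plane_ext he (by rw [a.2, b.2, he]))
    have := h.fst.ext_convex a.1 b.1 hne hα hβ hαβ
    rw [← a.2, ← b.2] at this
    linarith [z1.2]
  · have a : |x 1| ≤ d ∧ x 0 = -evenExt ψ d (x 1) := hx
    have b : |y 1| ≤ d ∧ y 0 = -evenExt ψ d (y 1) := hy
    have hne : x 1 ≠ y 1 := fun he => hxy (plane_ext (by rw [a.2, b.2, he]) he)
    have := h.snd.ext_convex a.1 b.1 hne hα hβ hαβ
    rw [a.2, b.2] at z0
    linarith [z0.1]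
  · have a : |x 0| ≤ c ∧ x 1 = -evenExt φ c (x 0) := hx
    have b : |y 0| ≤ c ∧ y 1 = -evenExt φ c (y 0) := hy
    have hne : x 0 ≠ y 0 := fun he => hxy (plane_ext he (by rw [a.2, b.2, he]))
    have := h.fst.ext_convex a.1 b.1 hne hα hβ hαβ
    rw [a.2, b.2] at z1
    linarith [z1.1]
  · have a : |x 1| ≤ d ∧ x 0 = evenExt ψ d (x 1) := hx
    have b : |y 1| ≤ d ∧ y 0 = evenExt ψ d (y 1) := hy
    have hne : x 1 ≠ y 1 := fun he => hxy (plane_ext (by rw [a.2, b.2, he]) he)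
    have := h.snd.ext_convex a.1 b.1 hne hα hβ hαβ
    rw [← a.2, ← b.2] at this
    linarith [z0.2]

end ArcPair
end LatticeVelocity

/-! ### Cusps, and the connectedness of the region around the astroid. -/

namespace LatticeVelocity

theorem HasCuspAt.map {C : Set Plane} {p : Plane} (h : HasCuspAt C p) (ρ : Plane ≃ₗᵢ[ℝ] Plane)
    (hρ : ∀ v, ρ v ∈ C ↔ v ∈ C) : HasCuspAt C (ρ p) := by
  obtain ⟨hp, u, hu, hlim⟩ := h
  refine ⟨(hρ p).2 hp, ρ u, by simpa using hu, ?_⟩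
  have h1 : Tendsto ρ.symm (𝓝[C \ {ρ p}] (ρ p)) (𝓝[C \ {p}] p) := by
    refine tendsto_nhdsWithin_of_tendsto_nhds_of_eventually_within _ ?_ ?_
    · have := (ρ.symm.continuous.tendsto (ρ p))
      rw [ρ.symm_apply_apply] at this
      exact this.mono_left nhdsWithin_le_nhds
    · filter_upwards [self_mem_nhdsWithin] with x hx
      refine ⟨?_, ?_⟩
      · rw [← hρ, ρ.apply_symm_apply]; exact hx.1
      · intro h2
        apply hx.2
        rw [mem_singleton_iff] at h2 ⊢
        rw [← h2, ρ.apply_symm_apply]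
  have h2 := (ρ.continuous.tendsto u).comp (hlim.comp h1)
  refine h2.congr fun x => ?_
  simp only [Function.comp_apply, map_smul, map_sub, ρ.apply_symm_apply]
  rw [← ρ.norm_map (ρ.symm x - p), map_sub, ρ.apply_symm_apply]

/-- The reflection that changes the sign of the first coordinate. -/
noncomputable def flip₀ : Plane ≃ₗᵢ[ℝ] Plane :=
  LinearIsometryEquiv.piLpCongrRight 2
    ![LinearIsometryEquiv.neg ℝ, LinearIsometryEquiv.refl ℝ ℝ]

theorem flip₀_apply (v : Plane) : flip₀ v 0 = -v 0 ∧ flip₀ v 1 = v 1 := by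
  constructor <;> simp [flip₀]

namespace ArcPair

variable {c d σ : ℝ} {φ ψ : ℝ → ℝ}

theorem flip₀_mem_astroid (v : Plane) : flip₀ v ∈ astroid c d φ ψ ↔ v ∈ astroid c d φ ψ := by
  obtain ⟨h0, h1⟩ := flip₀_apply v
  simp only [astroid, mem_ofPred_eq, h0, h1, abs_neg, evenExt_neg]

theorem neg_mem_astroid (v : Plane) :
    LinearIsometryEquiv.neg ℝ v ∈ astroid c d φ ψ ↔ v ∈ astroid c d φ ψ := by
  simp only [astroid, mem_ofPred_eq, LinearIsometryEquiv.coe_neg, PiLp.neg_apply, abs_neg,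
    evenExt_neg]

theorem tendsto_chord_slope (h : ArcPair c d σ φ ψ) :
    (∀ᶠ x in 𝓝[astroid c d φ ψ \ {!₂[c, d]}] (!₂[c, d] : Plane), x 0 < c) ∧
    Tendsto (fun x : Plane => (d - x 1) / (c - x 0))
      (𝓝[astroid c d φ ψ \ {!₂[c, d]}] (!₂[c, d] : Plane)) (𝓝 σ) := by
  have hd := h.fst.d_pos
  have hc := h.fst.pos
  have hσ := h.fst.slope_pos
  have near0 : ∀ s < c, ∀ᶠ x in 𝓝[astroid c d φ ψ \ {!₂[c, d]}] (!₂[c, d] : Plane), s < x 0 := by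
    intro s hs
    refine nhdsWithin_le_nhds ((isOpen_lt continuous_const (continuous_coord 0)).mem_nhds ?_)
    simpa using hs
  have near1 : ∀ s < d, ∀ᶠ x in 𝓝[astroid c d φ ψ \ {!₂[c, d]}] (!₂[c, d] : Plane), s < x 1 := by
    intro s hs
    refine nhdsWithin_le_nhds ((isOpen_lt continuous_const (continuous_coord 1)).mem_nhds ?_)
    simpa using hs
  have forms : ∀ᶠ x in 𝓝[astroid c d φ ψ \ {!₂[c, d]}] (!₂[c, d] : Plane),
      (0 < x 0 ∧ x 0 < c ∧ x 1 = φ (x 0)) ∨ (0 < x 1 ∧ x 1 < d ∧ x 0 = ψ (x 1)) := by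
    filter_upwards [near0 0 hc, near1 0 hd, self_mem_nhdsWithin] with x h0 h1 hx
    obtain ⟨hx, hne⟩ := hx
    have hne' : ¬ (x 0 = c ∧ x 1 = d) := fun hcd =>
      hne (plane_ext (by simpa using hcd.1) (by simpa using hcd.2))
    rcases hx with ⟨h2, h3⟩ | ⟨h2, h3⟩
    · left
      rw [evenExt_of_le h2, abs_of_pos h0, abs_of_pos h1] at h3
      rw [abs_of_pos h0] at h2
      refine ⟨h0, lt_of_le_of_ne h2 fun he => hne' ⟨he, ?_⟩, h3⟩
      rw [h3, he, h.fst.end_eq]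
    · right
      rw [evenExt_of_le h2, abs_of_pos h0, abs_of_pos h1] at h3
      rw [abs_of_pos h1] at h2
      refine ⟨h1, lt_of_le_of_ne h2 fun he => hne' ⟨?_, he⟩, h3⟩
      rw [h3, he, h.snd.end_eq]
  have lt0 : ∀ᶠ x in 𝓝[astroid c d φ ψ \ {!₂[c, d]}] (!₂[c, d] : Plane), x 0 < c := by
    filter_upwards [forms] with x hx
    rcases hx with hx | ⟨h1, h2, h3⟩
    · exact hx.2.1
    · rw [h3, ← h.snd.end_eq]
      exact h.snd.lt _ _ h1.le h2 le_rfl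
  refine ⟨lt0, ?_⟩
  rw [Metric.tendsto_nhds]
  intro ε₀ hε₀
  obtain ⟨ε, hε, hεε⟩ : ∃ ε, 0 < ε ∧ ε < ε₀ := ⟨ε₀ / 2, by linarith, by linarith⟩
  obtain ⟨s, hs, hs'⟩ := h.fst.tangent ε hε
  -- This tolerance turns the lower bound σ⁻¹ - ε' for slopes over the second axis into (σ + ε)⁻¹,
  -- that is, into the upper bound σ + ε for slopes over the first axis.
  have hε' : 0 < σ⁻¹ - (σ + ε)⁻¹ := by
    rw [sub_pos]; exact inv_strictAnti₀ hσ (by linarith)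
  obtain ⟨r, hr, hr'⟩ := h.snd.tangent _ hε'
  filter_upwards [forms, lt0, near0 s hs, near1 r hr] with x hx hlt h0 h1
  have hpos : 0 < c - x 0 := by linarith
  refine lt_of_le_of_lt ?_ hεε
  rw [Real.dist_eq, abs_le]
  rcases hx with ⟨h2, h3, h4⟩ | ⟨h2, h3, h4⟩
  · have h5 := hs' _ h2.le h0 h3
    have h6 := h.fst.slope_lt _ _ h2.le h3 le_rfl
    rw [h.fst.end_eq, ← h4] at h5 h6
    constructor
    · rw [neg_le_sub_iff_le_add, ← sub_le_iff_le_add, le_div_iff₀ hpos]; exact h5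
    · rw [sub_le_iff_le_add, div_le_iff₀ hpos]; nlinarith
  · have h5 := hr' _ h2.le h1 h3
    have h6 := h.snd.slope_lt _ _ h2.le h3 le_rfl
    rw [h.snd.end_eq, ← h4] at h5 h6
    rw [inv_mul_eq_div, lt_div_iff₀ hσ] at h6
    rw [sub_sub_cancel, inv_mul_eq_div, div_le_iff₀ (by linarith)] at h5
    constructor
    · rw [neg_le_sub_iff_le_add, ← sub_le_iff_le_add, le_div_iff₀ hpos]; nlinarith
    · rw [sub_le_iff_le_add, div_le_iff₀ hpos]; linarith

/-- Near the corner all points of the curve have x 0 < c, so the unit vector towards x is a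
continuous function `N` of the chord slope alone. The slope tends to `σ` along both arcs, hence
there is one limit. -/
theorem hasCuspAt_corner (h : ArcPair c d σ φ ψ) : HasCuspAt (astroid c d φ ψ) !₂[c, d] := by
  obtain ⟨hlt, hlim⟩ := h.tendsto_chord_slope
  have hmem : (!₂[c, d] : Plane) ∈ astroid c d φ ψ := by
    rw [← h.iUnion_arc]
    exact mem_iUnion.2 ⟨0, (h.corner_mem 0).1⟩
  set N : ℝ → Plane := fun κ => ‖(!₂[-1, -κ] : Plane)‖⁻¹ • !₂[-1, -κ] with hN
  have hne : ∀ κ : ℝ, (!₂[-1, -κ] : Plane) ≠ 0 := fun κ h0 => by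
    simpa using congrFun (congrArg WithLp.ofLp h0) 0
  have hcv : Continuous fun κ : ℝ => (!₂[-1, -κ] : Plane) :=
    continuous_vec continuous_const continuous_neg
  have hNc : Continuous N := (hcv.norm.inv₀ fun κ => norm_ne_zero_iff.2 (hne κ)).smul hcv
  refine ⟨hmem, N σ, ?_, ((hNc.tendsto σ).comp hlim).congr' ?_⟩
  · rw [hN]
    simp only
    rw [norm_smul, norm_inv, norm_norm, inv_mul_cancel₀ (norm_ne_zero_iff.2 (hne σ))]
  · filter_upwards [hlt] with x hx
    have hpos : 0 < c - x 0 := by linarith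
    have hx' : x - !₂[c, d] = (c - x 0) • (!₂[-1, -((d - x 1) / (c - x 0))] : Plane) := by
      refine plane_ext ?_ ?_
      · simp
      · simp; field_simp; ring
    rw [Function.comp_apply, hx', norm_smul, Real.norm_of_nonneg hpos.le, mul_inv, smul_smul, hN]
    field_simp

theorem hasCuspAt (h : ArcPair c d σ φ ψ) (i : Fin 4) :
    HasCuspAt (astroid c d φ ψ) (rectCorner c d i) := by
  have h0 := h.hasCuspAt_corner
  have h1 := h0.map flip₀ flip₀_mem_astroid
  have e1 : flip₀ (!₂[c, d] : Plane) = !₂[-c, d] :=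
    plane_ext (by simp [flip₀_apply]) (by simp [flip₀_apply])
  have h2 := h0.map (LinearIsometryEquiv.neg ℝ) neg_mem_astroid
  have e2 : LinearIsometryEquiv.neg ℝ (!₂[c, d] : Plane) = !₂[-c, -d] :=
    plane_ext (by simp) (by simp)
  have h3 := h1.map (LinearIsometryEquiv.neg ℝ) neg_mem_astroid
  have e3 : LinearIsometryEquiv.neg ℝ (!₂[-c, d] : Plane) = !₂[c, -d] :=
    plane_ext (by simp) (by simp)
  rw [e1] at h1 h3
  rw [e2] at h2
  rw [e3] at h3
  fin_cases i
  · exact h0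
  · exact h1
  · exact h2
  · exact h3

/-- A convex set that is symmetric under both reflections contains with each point the rectangle
spanned by its mirror images. -/
theorem mem_of_abs_le {U : Set Plane} (hU : Convex ℝ U) (hU0 : ∀ v ∈ U, flip₀ v ∈ U)
    (hUn : ∀ v ∈ U, -v ∈ U) {v w : Plane} (hv : v ∈ U) (h0 : |w 0| ≤ |v 0|) (h1 : |w 1| ≤ |v 1|) :
    w ∈ U := by
  have comb : ∀ x y : ℝ, |x| ≤ |y| → ∃ α β : ℝ, 0 ≤ α ∧ 0 ≤ β ∧ α + β = 1 ∧ α * y + β * -y = x := by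
    intro x y hxy
    by_cases hy : y = 0
    · subst hy
      refine ⟨1, 0, by simp, by simp, by simp, ?_⟩
      have : |x| ≤ 0 := by simpa using hxy
      have : x = 0 := by simpa using this
      simp [this]
    · have h2 : |x / y| ≤ 1 := by rw [abs_div]; exact (div_le_one (abs_pos.2 hy)).2 hxy
      rw [abs_le] at h2
      exact ⟨(1 + x / y) / 2, (1 - x / y) / 2, by linarith, by linarith, by ring, by field_simp; ring⟩
  obtain ⟨α, β, hα, hβ, hαβ, e0⟩ := comb _ _ h0
  obtain ⟨α', β', hα', hβ', hαβ', e1⟩ := comb _ _ h1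
  have m1 : (!₂[w 0, v 1] : Plane) ∈ U := by
    have := hU hv (hU0 v hv) hα hβ hαβ
    refine (plane_ext ?_ ?_ : _ = (!₂[w 0, v 1] : Plane)) ▸ this
    · simp [flip₀_apply, ← e0]
    · simp [flip₀_apply, ← add_mul, hαβ]
  have m2 : (!₂[w 0, -v 1] : Plane) ∈ U := by
    refine (plane_ext ?_ ?_ : flip₀ (-!₂[w 0, v 1]) = (!₂[w 0, -v 1] : Plane)) ▸ hU0 _ (hUn _ m1)
    · simp [flip₀_apply]
    · simp [flip₀_apply]
  have := hU m1 m2 hα' hβ' hαβ'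
  refine (plane_ext ?_ ?_ : _ = w) ▸ this
  · simp [← add_mul, hαβ']
  · simpa using e1

/-- The part of an open set between the top (`i = 1`) or the right (`i = 0`) arc and infinity. -/
theorem isPreconnected_beyond {U : Set Plane} (hU : Convex ℝ U) (hU0 : ∀ v ∈ U, flip₀ v ∈ U)
    (hUn : ∀ v ∈ U, -v ∈ U) {e : ℝ → ℝ} (he : ∀ s t, |s| ≤ |t| → e s ≤ e t)
    (i j : Fin 2) (hij : i ≠ j) : IsPreconnected {v : Plane | v ∈ U ∧ e (v j) < v i} := by
  have hmono : ∀ v w : Plane, v ∈ U → |w i| ≤ |v i| → |w j| ≤ |v j| → w ∈ U := by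
    intro v w hv h1 h2
    have : ∀ i j : Fin 2, i ≠ j → (i = 0 ∧ j = 1) ∨ (i = 1 ∧ j = 0) := by decide
    rcases this i j hij with ⟨rfl, rfl⟩ | ⟨rfl, rfl⟩
    · exact mem_of_abs_le hU hU0 hUn hv h1 h2
    · exact mem_of_abs_le hU hU0 hUn hv h2 h1
  refine isPreconnected_of_forall_pair fun v hv w hw => ?_
  set P : Plane → Plane := fun v => v i • EuclideanSpace.single i 1 with hP
  have hPi : ∀ v, P v i = v i := fun v => by simp [hP]
  have hPj : ∀ v, P v j = 0 := fun v => by simp [hP, hij.symm]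
  have seg1 : ∀ v : Plane, v ∈ U → e (v j) < v i →
      segment ℝ v (P v) ⊆ {v : Plane | v ∈ U ∧ e (v j) < v i} := by
    rintro v hv1 hv2 _ ⟨α, β, hα, hβ, hαβ, rfl⟩
    have ei : (α • v + β • P v) i = v i := by
      simp only [PiLp.add_apply, PiLp.smul_apply, smul_eq_mul, hPi]
      rw [← add_mul, hαβ, one_mul]
    have ej : |(α • v + β • P v) j| ≤ |v j| := by
      simp only [PiLp.add_apply, PiLp.smul_apply, smul_eq_mul, hPj, mul_zero, add_zero]
      rw [abs_mul, abs_of_nonneg hα]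
      exact mul_le_of_le_one_left (abs_nonneg _) (by linarith)
    refine ⟨hmono v _ hv1 (by rw [ei]) ej, ?_⟩
    rw [ei]
    exact (he _ _ ej).trans_lt hv2
  have seg2 : segment ℝ (P v) (P w) ⊆ {v : Plane | v ∈ U ∧ e (v j) < v i} := by
    have hPv := seg1 v hv.1 hv.2 (right_mem_segment _ _ _)
    have hPw := seg1 w hw.1 hw.2 (right_mem_segment _ _ _)
    rintro _ ⟨α, β, hα, hβ, hαβ, rfl⟩
    refine ⟨hU hPv.1 hPw.1 hα hβ hαβ, ?_⟩
    have h1 := hPv.2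
    have h2 := hPw.2
    simp only [PiLp.add_apply, PiLp.smul_apply, smul_eq_mul, hPj, hPi, mul_zero, add_zero] at h1 h2 ⊢
    exact convex_Ioi (e 0) h1 h2 hα hβ hαβ
  refine ⟨segment ℝ v (P v) ∪ segment ℝ (P v) (P w) ∪ segment ℝ w (P w), ?_,
    Or.inl (Or.inl (left_mem_segment _ _ _)), Or.inr (left_mem_segment _ _ _), ?_⟩
  · exact union_subset (union_subset (seg1 v hv.1 hv.2) seg2) (seg1 w hw.1 hw.2)
  · refine IsPreconnected.union (P w) (Or.inr (right_mem_segment _ _ _)) (right_mem_segment _ _ _)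
      (IsPreconnected.union (P v) (right_mem_segment _ _ _) (left_mem_segment _ _ _)
      (convex_segment _ _).isPreconnected (convex_segment _ _).isPreconnected)
      (convex_segment _ _).isPreconnected

/-- The region is the union of the parts beyond the top, right, bottom and left arcs. Each is
connected, and neighbouring parts overlap just outside a corner of the rectangle. -/
theorem isConnected_annulus (h : ArcPair c d σ φ ψ) {U : Set Plane} (hU : Convex ℝ U)
    (hUo : IsOpen U) (hU0 : ∀ v ∈ U, flip₀ v ∈ U) (hUn : ∀ v ∈ U, -v ∈ U)
    (hcd : (!₂[c, d] : Plane) ∈ U) : IsConnected (U ∩ astroidOutside c d φ ψ) := by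
  have hd := h.fst.d_pos
  have hc := h.fst.pos
  -- Since `U` is open, it contains a point slightly beyond the corner; its reflections link the
  -- four parts.
  obtain ⟨r, hr, hrU⟩ : ∃ r : ℝ, 1 < r ∧ (!₂[r * c, r * d] : Plane) ∈ U := by
    have hcont : Continuous fun r : ℝ => (!₂[r * c, r * d] : Plane) :=
      continuous_vec (by fun_prop) (by fun_prop)
    have h1 : ∀ᶠ r in 𝓝[>] (1 : ℝ), (!₂[r * c, r * d] : Plane) ∈ U := by
      refine ((hcont.tendsto 1).mono_left nhdsWithin_le_nhds).eventually (hUo.mem_nhds ?_)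
      simpa using hcd
    obtain ⟨r, h2, h3⟩ := (h1.and self_mem_nhdsWithin).exists
    exact ⟨r, h3, h2⟩
  have hrc : c < r * c := by nlinarith
  have hrd : d < r * d := by nlinarith
  set A : Set Plane := {v | v ∈ U ∧ evenExt φ c (v 0) < v 1} with hA
  set B : Set Plane := {v | v ∈ U ∧ evenExt ψ d (v 1) < v 0} with hB
  have hAc : IsPreconnected A :=
    isPreconnected_beyond hU hU0 hUn (fun s t => h.fst.ext_mono) 1 0 (by decide)
  have hBc : IsPreconnected B :=
    isPreconnected_beyond hU hU0 hUn (fun s t => h.snd.ext_mono) 0 1 (by decide)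
  have hAn : IsPreconnected ((fun v : Plane => -v) '' A) := hAc.image _ continuous_neg.continuousOn
  have hBn : IsPreconnected ((fun v : Plane => -v) '' B) := hBc.image _ continuous_neg.continuousOn
  have hrU' : (!₂[r * c, -(r * d)] : Plane) ∈ U :=
    mem_of_abs_le hU hU0 hUn hrU (by simp) (by simp)
  have mA : ∀ x y : ℝ, (!₂[x, y] : Plane) ∈ U → d < y → (!₂[x, y] : Plane) ∈ A := fun x y h1 h2 =>
    ⟨h1, by simpa using (h.fst.ext_le _).trans_lt h2⟩
  have mB : ∀ x y : ℝ, (!₂[x, y] : Plane) ∈ U → c < x → (!₂[x, y] : Plane) ∈ B := fun x y h1 h2 =>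
    ⟨h1, by simpa using (h.snd.ext_le _).trans_lt h2⟩
  have nU : ∀ x y : ℝ, (!₂[x, y] : Plane) ∈ U → (!₂[-x, -y] : Plane) ∈ U := fun x y h1 =>
    mem_of_abs_le hU hU0 hUn h1 (by simp) (by simp)
  have neg_eq : ∀ x y : ℝ, -(!₂[x, y] : Plane) = !₂[-x, -y] := fun x y =>
    plane_ext (by simp) (by simp)
  have hEq : U ∩ astroidOutside c d φ ψ =
      A ∪ B ∪ (fun v : Plane => -v) '' A ∪ (fun v : Plane => -v) '' B := by
    ext v
    constructor
    · rintro ⟨hv, h1 | h1⟩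
      · rcases lt_abs.1 h1 with h2 | h2
        · exact Or.inl (Or.inl (Or.inl ⟨hv, h2⟩))
        · refine Or.inl (Or.inr ⟨-v, ⟨hUn v hv, ?_⟩, by simp⟩)
          simpa [evenExt_neg] using h2
      · rcases lt_abs.1 h1 with h2 | h2
        · exact Or.inl (Or.inl (Or.inr ⟨hv, h2⟩))
        · refine Or.inr ⟨-v, ⟨hUn v hv, ?_⟩, by simp⟩
          simpa [evenExt_neg] using h2
    · rintro (((⟨hv, h1⟩ | ⟨hv, h1⟩) | ⟨w, ⟨hv, h1⟩, rfl⟩) | ⟨w, ⟨hv, h1⟩, rfl⟩)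
      · exact ⟨hv, Or.inl (h1.trans_le (le_abs_self _))⟩
      · exact ⟨hv, Or.inr (h1.trans_le (le_abs_self _))⟩
      · refine ⟨hUn w hv, Or.inl ?_⟩
        simpa [evenExt_neg] using h1.trans_le (le_abs_self _)
      · refine ⟨hUn w hv, Or.inr ?_⟩
        simpa [evenExt_neg] using h1.trans_le (le_abs_self _)
  refine ⟨⟨_, hrU, Or.inl ?_⟩, ?_⟩
  · exact ((mA _ _ hrU hrd).2).trans_le (le_abs_self _)
  rw [hEq]
  have hmn := mA _ _ (nU _ _ hrU') (by simpa using hrd)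
  refine IsPreconnected.union (-!₂[r * c, -(r * d)]) ?_ ⟨_, mB _ _ hrU' hrc, rfl⟩
    (IsPreconnected.union (!₂[r * c, -(r * d)]) ?_ ?_
      (IsPreconnected.union (!₂[r * c, r * d]) (mA _ _ hrU hrd) (mB _ _ hrU hrc) hAc hBc) hAn) hBn
  · rw [neg_eq]
    exact Or.inl (Or.inl hmn)
  · exact Or.inr (mB _ _ hrU' hrc)
  · exact ⟨_, hmn, by simp [neg_eq]⟩

end ArcPair
end LatticeVelocity

/-! ### From a parametrized curve to a convex graph. -/

namespace LatticeVelocity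

/-- A curve whose tangent slope `σ` is strictly increasing is the graph of a strictly convex
function. -/
theorem exists_halfArc_of_param {V₁ V₂ σ : ℝ → ℝ} {p q : ℝ} (hpq : p < q)
    (h1 : ContinuousOn V₁ (Icc p q)) (h2 : ContinuousOn V₂ (Icc p q))
    (hd : ∀ m ∈ Ioo p q, ∃ r, 0 < r ∧ HasDerivAt V₁ r m ∧ HasDerivAt V₂ (σ m * r) m)
    (hσ : StrictMonoOn σ (Icc p q)) (hσc : ∀ ε > 0, ∃ m ∈ Ioo p q, σ q - ε < σ m)
    (hσ0 : 0 ≤ σ p) (hV₁ : V₁ p = 0) (hV₂ : 0 < V₂ p) :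
    ∃ φ, HalfArc (V₁ q) (V₂ q) (σ q) φ ∧ (∀ m ∈ Icc p q, φ (V₁ m) = V₂ m) ∧
      (∀ m ∈ Icc p q, V₁ m ∈ Icc 0 (V₁ q)) ∧ ∀ t ∈ Icc 0 (V₁ q), ∃ m ∈ Icc p q, V₁ m = t := by
  have hmono : StrictMonoOn V₁ (Icc p q) := by
    refine strictMonoOn_of_deriv_pos (convex_Icc p q) h1 fun m hm => ?_
    rw [interior_Icc] at hm
    obtain ⟨r, hr, hr1, -⟩ := hd m hm
    rwa [hr1.deriv]
  have hp : p ∈ Icc p q := left_mem_Icc.2 hpq.le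
  have hq : q ∈ Icc p q := right_mem_Icc.2 hpq.le
  have hsurj : ∀ t ∈ Icc 0 (V₁ q), ∃ m ∈ Icc p q, V₁ m = t := by
    intro t ht
    rw [← hV₁] at ht
    exact intermediate_value_Icc hpq.le h1 ht
  -- Cauchy's mean value theorem makes each chord slope a value of `σ` in between. Monotonicity, the
  -- slope bound, convexity and the end tangent all follow from this.
  have hslope : ∀ m ∈ Icc p q, ∀ n ∈ Icc p q, m < n →
      ∃ ξ ∈ Ioo m n, V₂ n - V₂ m = σ ξ * (V₁ n - V₁ m) := by
    intro m hm n hn hmn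
    have hsub : Icc m n ⊆ Icc p q := Icc_subset_Icc hm.1 hn.2
    have hsub' : Ioo m n ⊆ Ioo p q := Ioo_subset_Ioo hm.1 hn.2
    choose! r hr using hd
    obtain ⟨ξ, hξ, he⟩ := exists_ratio_hasDerivAt_eq_ratio_slope V₁ r hmn (h1.mono hsub)
      (fun x hx => (hr x (hsub' hx)).2.1) V₂ (fun x => σ x * r x) (h2.mono hsub)
      (fun x hx => (hr x (hsub' hx)).2.2)
    refine ⟨ξ, hξ, ?_⟩
    have := (hr ξ (hsub' hξ)).1
    have h3 : (V₂ n - V₂ m - σ ξ * (V₁ n - V₁ m)) * r ξ = 0 := by linear_combination he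
    rcases mul_eq_zero.1 h3 with h4 | h4
    · linarith
    · exact absurd h4 this.ne'
  set g := Function.invFunOn V₁ (Icc p q) with hg
  have hgV : ∀ m ∈ Icc p q, g (V₁ m) = m := fun m hm => hmono.injOn.leftInvOn_invFunOn hm
  have hrange : ∀ m ∈ Icc p q, V₁ m ∈ Icc 0 (V₁ q) := fun m hm =>
    ⟨hV₁ ▸ hmono.monotoneOn hp hm hm.1, hmono.monotoneOn hm hq hm.2⟩
  refine ⟨V₂ ∘ g, ⟨?_, ?_, ?_, ?_, ?_, ?_, ?_⟩, fun m hm => by simp [hgV m hm], hrange, hsurj⟩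
  · rw [← hV₁]; exact hmono hp hq hpq
  · have : (V₂ ∘ g) 0 = V₂ p := by rw [Function.comp_apply, ← hV₁, hgV p hp]
    rwa [this]
  · rw [Function.comp_apply, hgV q hq]
  · intro s t hs hst ht
    obtain ⟨m, hm, rfl⟩ := hsurj s ⟨hs, hst.le.trans ht⟩
    obtain ⟨n, hn, rfl⟩ := hsurj t ⟨hs.trans hst.le, ht⟩
    have hmn : m < n := (hmono.lt_iff_lt hm hn).1 hst
    obtain ⟨ξ, hξ, he⟩ := hslope m hm n hn hmn
    rw [Function.comp_apply, Function.comp_apply, hgV m hm, hgV n hn, ← sub_pos, he]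
    refine mul_pos ?_ (sub_pos.2 hst)
    exact hσ0.trans_lt (hσ hp ⟨hm.1.trans hξ.1.le, hξ.2.le.trans hn.2⟩ (hm.1.trans_lt hξ.1))
  · intro s t hs hst ht
    obtain ⟨m, hm, rfl⟩ := hsurj s ⟨hs, hst.le.trans ht⟩
    obtain ⟨n, hn, rfl⟩ := hsurj t ⟨hs.trans hst.le, ht⟩
    have hmn : m < n := (hmono.lt_iff_lt hm hn).1 hst
    obtain ⟨ξ, hξ, he⟩ := hslope m hm n hn hmn
    rw [Function.comp_apply, Function.comp_apply, hgV m hm, hgV n hn, he]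
    refine mul_lt_mul_of_pos_right ?_ (sub_pos.2 hst)
    exact hσ ⟨hm.1.trans hξ.1.le, hξ.2.le.trans hn.2⟩ hq (hξ.2.trans_le hn.2)
  · refine strictConvexOn_of_slope_strict_mono_adjacent (convex_Icc _ _) ?_
    intro x y z hx hz hxy hyz
    have hy : y ∈ Icc 0 (V₁ q) := ⟨hx.1.trans hxy.le, hyz.le.trans hz.2⟩
    obtain ⟨l, hl, rfl⟩ := hsurj x hx
    obtain ⟨m, hm, rfl⟩ := hsurj y hy
    obtain ⟨n, hn, rfl⟩ := hsurj z hz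
    obtain ⟨ξ, hξ, he⟩ := hslope l hl m hm ((hmono.lt_iff_lt hl hm).1 hxy)
    obtain ⟨η, hη, he'⟩ := hslope m hm n hn ((hmono.lt_iff_lt hm hn).1 hyz)
    simp only [Function.comp_apply]
    rw [hgV l hl, hgV m hm, hgV n hn, he, he', mul_div_cancel_right₀ _ (sub_pos.2 hxy).ne',
      mul_div_cancel_right₀ _ (sub_pos.2 hyz).ne']
    exact hσ ⟨hl.1.trans hξ.1.le, hξ.2.le.trans hm.2⟩ ⟨hm.1.trans hη.1.le, hη.2.le.trans hn.2⟩
      (hξ.2.trans hη.1)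
  · intro ε hε
    obtain ⟨m, hm, hmε⟩ := hσc ε hε
    have hm' : m ∈ Icc p q := Ioo_subset_Icc_self hm
    refine ⟨V₁ m, hmono hm' hq hm.2, fun t ht0 ht htq => ?_⟩
    obtain ⟨n, hn, rfl⟩ := hsurj t ⟨ht0, htq.le⟩
    have hmn : m < n := (hmono.lt_iff_lt hm' hn).1 ht
    have hnq : n < q := (hmono.lt_iff_lt hn hq).1 htq
    obtain ⟨ξ, hξ, he⟩ := hslope n hn q hq hnq
    simp only [Function.comp_apply]
    rw [hgV n hn, hgV q hq, he]
    refine mul_le_mul_of_nonneg_right ?_ (sub_pos.2 htq).le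
    refine hmε.le.trans (hσ hm' ⟨hn.1.trans hξ.1.le, hξ.2.le⟩ (hmn.trans hξ.1)).le

/-! ### Explicit coordinates on the inner critical curve. -/

/-- The value of `γ²` at the point of the inner critical curve with parameter `m`. -/
noncomputable def critD (a b M m : ℝ) : ℝ :=
  Real.sqrt (M ^ 2 - 4 * a ^ 2 - 4 * b ^ 2 + 4 * a * b * (m + m⁻¹))

/-- The value of `cos k₁` at the point of the inner critical curve with `cos k₂ = -m cos k₁`. -/
noncomputable def critX (a b M m : ℝ) : ℝ := 2 * (a - b * m⁻¹) / (M + critD a b M m)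

/-- The value of `cos k₂` at the point of the inner critical curve with `cos k₂ = -m cos k₁`. -/
noncomputable def critY (a b M m : ℝ) : ℝ := critX b a M m⁻¹

section crit

variable {a b M m : ℝ}

theorem critD_arg_pos (ha : 0 < a) (hb : 0 < b) (hM : 2 * a + 2 * b < M) (hm : 0 < m) :
    0 < M ^ 2 - 4 * a ^ 2 - 4 * b ^ 2 + 4 * a * b * (m + m⁻¹) := by
  have h1 : 2 ≤ m + m⁻¹ := by
    have : m + m⁻¹ - 2 = (m - 1) ^ 2 * m⁻¹ := by field_simp; ring
    have : 0 ≤ (m - 1) ^ 2 * m⁻¹ := by positivity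
    linarith
  have hab := mul_pos ha hb
  nlinarith [sq_nonneg (a - b)]

theorem critD_pos (ha : 0 < a) (hb : 0 < b) (hM : 2 * a + 2 * b < M) (hm : 0 < m) :
    0 < critD a b M m := Real.sqrt_pos.2 (critD_arg_pos ha hb hM hm)

theorem critD_sq (ha : 0 < a) (hb : 0 < b) (hM : 2 * a + 2 * b < M) (hm : 0 < m) :
    critD a b M m ^ 2 = M ^ 2 - 4 * a ^ 2 - 4 * b ^ 2 + 4 * a * b * (m + m⁻¹) :=
  Real.sq_sqrt (critD_arg_pos ha hb hM hm).le

/-- Exchanging the axes replaces (a, b, m) by (b, a, m⁻¹). Through this symmetry facts about `critX`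
and `critV` yield those about `critY` and `critW`. -/
theorem critD_swap (a b M m : ℝ) : critD b a M m⁻¹ = critD a b M m := by
  unfold critD
  congr 1
  rw [inv_inv]
  ring

theorem critY_swap (a b M m : ℝ) : critY b a M m⁻¹ = critX a b M m := by
  rw [critY, inv_inv]

theorem critX_mul (ha : 0 < a) (hb : 0 < b) (hM : 2 * a + 2 * b < M) (hm : 0 < m) :
    critX a b M m * (M + critD a b M m) = 2 * (a - b * m⁻¹) := by
  have := critD_pos ha hb hM hm
  rw [critX, div_mul_cancel₀]
  linarith

theorem critY_eq (hm : 0 < m) : critY a b M m = -m * critX a b M m := by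
  rw [critY, critX, critX, critD_swap, inv_inv]
  rw [mul_div_assoc', show -m * (2 * (a - b * m⁻¹)) = 2 * (b - a * m) by field_simp; ring]

/-- With y = -mx the critical equation, after division by x, is quadratic in x; `critD` is the root
of its discriminant and `critX` the rationalized form of one solution. The spurious factor M + D is
positive. -/
theorem critD_eq (ha : 0 < a) (hb : 0 < b) (hM : 2 * a + 2 * b < M) (hm : 0 < m) :
    critD a b M m = M - 2 * a * critX a b M m - 2 * b * critY a b M m := by
  have h1 := critX_mul ha hb hM hm
  have h2 := critD_sq ha hb hM hm
  have h3 := critD_pos ha hb hM hm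
  rw [critY_eq hm]
  set x := critX a b M m
  set D := critD a b M m
  have h4 : (M + D) * (D - (M - 2 * a * x - 2 * b * (-m * x))) = 0 := by
    have h5 : (M + D) * (D - (M - 2 * a * x - 2 * b * (-m * x))) =
      D ^ 2 - M ^ 2 + (2 * a - 2 * b * m) * (x * (M + D)) := by ring
    rw [h5, h1, h2]
    field_simp
    ring
  rcases mul_eq_zero.1 h4 with h | h
  · linarith
  · linarith

/-- The degeneracy equation xyγ² = bx(1 - y²) + ay(1 - x²) with y = -mx, divided by x. In this form
it also holds at x = 0. -/
theorem crit_rel (ha : 0 < a) (hb : 0 < b) (hM : 2 * a + 2 * b < M) (hm : 0 < m) :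
    b * (1 - critY a b M m ^ 2) - a * m * (1 - critX a b M m ^ 2) =
      -(m * critX a b M m * critD a b M m) := by
  have h1 := critX_mul ha hb hM hm
  have h2 := critD_eq ha hb hM hm
  rw [critY_eq hm] at h2 ⊢
  set x := critX a b M m
  set D := critD a b M m
  have h3 : m * (x * (M + D)) = 2 * (a * m - b) := by rw [h1]; field_simp
  have h4 : M = D + 2 * a * x + 2 * b * (-m * x) := by linarith
  rw [h4] at h3
  linear_combination (1 / 2 : ℝ) * h3

theorem critX_lt_one (ha : 0 < a) (hb : 0 < b) (hM : 2 * a + 2 * b < M) (hm : 0 < m) :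
    critX a b M m < 1 := by
  have h3 := critD_pos ha hb hM hm
  have : 0 < b * m⁻¹ := by positivity
  rw [critX, div_lt_one (by linarith)]
  linarith

theorem critY_lt_one (ha : 0 < a) (hb : 0 < b) (hM : 2 * a + 2 * b < M) (hm : 0 < m) :
    critY a b M m < 1 := critX_lt_one hb ha (by linarith) (inv_pos.2 hm)

theorem hasDerivAt_critD (ha : 0 < a) (hb : 0 < b) (hM : 2 * a + 2 * b < M) (hm : 0 < m) :
    HasDerivAt (critD a b M) (2 * a * b * (1 - (m ^ 2)⁻¹) / critD a b M m) m := by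
  have h1 : HasDerivAt (fun m : ℝ => M ^ 2 - 4 * a ^ 2 - 4 * b ^ 2 + 4 * a * b * (m + m⁻¹))
      (4 * a * b * (1 + -(m ^ 2)⁻¹)) m :=
    (((hasDerivAt_id m).add (hasDerivAt_inv hm.ne')).const_mul (4 * a * b)).const_add _
  have h2 := h1.sqrt (critD_arg_pos ha hb hM hm).ne'
  refine h2.congr_deriv ?_
  have := critD_pos ha hb hM hm
  rw [← critD]
  field_simp
  ring

theorem hasDerivAt_critX (ha : 0 < a) (hb : 0 < b) (hM : 2 * a + 2 * b < M) (hm : 0 < m) :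
    HasDerivAt (critX a b M) (b * (1 - critY a b M m ^ 2) / (m ^ 2 * critD a b M m)) m := by
  have hD := critD_pos ha hb hM hm
  have h1 : HasDerivAt (fun m : ℝ => 2 * (a - b * m⁻¹)) (2 * -(b * -(m ^ 2)⁻¹)) m :=
    (((hasDerivAt_inv hm.ne').const_mul b).const_sub a).const_mul 2
  have h2 := h1.div ((hasDerivAt_critD ha hb hM hm).const_add M) (by linarith)
  refine h2.congr_deriv ?_
  have r1 := critX_mul ha hb hM hm
  have r2 := critD_eq ha hb hM hm
  rw [← r1]
  rw [critY_eq hm] at r2 ⊢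
  set x := critX a b M m
  set D := critD a b M m
  have hMD : M + D ≠ 0 := by linarith
  have h3 : m * (x * (M + D)) = 2 * (a * m - b) := by rw [r1]; field_simp
  field_simp
  have h4 : M = D + 2 * a * x - 2 * b * m * x := by linarith
  rw [h4] at h3 ⊢
  linear_combination (m * x) * h3

theorem hasDerivAt_critY (ha : 0 < a) (hb : 0 < b) (hM : 2 * a + 2 * b < M) (hm : 0 < m) :
    HasDerivAt (critY a b M) (-(a * (1 - critX a b M m ^ 2) / critD a b M m)) m := by
  have h1 := (hasDerivAt_critX hb ha (by linarith : 2 * b + 2 * a < M) (inv_pos.2 hm)).comp m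
    (hasDerivAt_inv hm.ne')
  refine h1.congr_deriv ?_
  rw [critY_swap, critD_swap]
  have hD := critD_pos ha hb hM hm
  field_simp

end crit

end LatticeVelocity

/-! ### Ends of the inner critical curve, and the single sign change of `critE`. -/

namespace LatticeVelocity

/-- The parameter at which the inner critical curve meets the line `k₁ = π`. -/
noncomputable def critStart (a b M : ℝ) : ℝ :=
  ((M + 2 * a) - Real.sqrt ((M + 2 * a) ^ 2 - 4 * b ^ 2)) / (2 * b)

/-- The function whose zeros are the parameters of the cusps. -/
noncomputable def critE (a b M m : ℝ) : ℝ :=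
  b * (1 - critY a b M m ^ 2) ^ 2 - a * m ^ 3 * (1 - critX a b M m ^ 2) ^ 2

/-- The first coordinate of the velocity along the inner critical curve. -/
noncomputable def critV (a b M m : ℝ) : ℝ :=
  a * Real.sqrt (1 - critX a b M m ^ 2) / Real.sqrt (critD a b M m)

/-- The second coordinate of the velocity along the inner critical curve. -/
noncomputable def critW (a b M m : ℝ) : ℝ := critV b a M m⁻¹

/-- The slope of the curve of the velocities along the inner critical curve. -/
noncomputable def critS (a b M m : ℝ) : ℝ :=
  m * Real.sqrt (1 - critX a b M m ^ 2) / Real.sqrt (1 - critY a b M m ^ 2)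

section crit

variable {a b M m : ℝ}

/-- For x = -1 and y = m the critical equation becomes bm² + b = (M + 2a)m, and `critStart` is its
smaller root. There γ² = b(m⁻¹ - m), positive because the root is below one. -/
theorem critStart_spec (ha : 0 < a) (hb : 0 < b) (hM : 2 * a + 2 * b < M) :
    0 < critStart a b M ∧ critStart a b M < 1 ∧ critX a b M (critStart a b M) = -1 := by
  set K := M + 2 * a with hK
  set r := Real.sqrt (K ^ 2 - 4 * b ^ 2) with hr
  have hK2 : 2 * b < K := by linarith
  have hpos : 0 < K ^ 2 - 4 * b ^ 2 := by nlinarith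
  have hr0 : 0 < r := Real.sqrt_pos.2 hpos
  have hr2 : r ^ 2 = K ^ 2 - 4 * b ^ 2 := Real.sq_sqrt hpos.le
  set t := critStart a b M with ht
  have htdef : 2 * b * t = K - r := by
    rw [ht, critStart, mul_div_cancel₀ _ (by positivity : 2 * b ≠ 0)]
  have hrK : r < K := by nlinarith
  have ht0 : 0 < t := by
    by_contra! h
    nlinarith
  have hq : b * t ^ 2 + b = K * t := by
    have h1 : r = K - 2 * b * t := by linarith
    rw [h1] at hr2
    have h2 : 4 * b * (b * t ^ 2 + b - K * t) = 0 := by linear_combination hr2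
    rcases mul_eq_zero.1 h2 with h | h <;> nlinarith
  have ht1 : t < 1 := by
    by_contra! h
    nlinarith
  refine ⟨ht0, ht1, ?_⟩
  have hD := critD_pos ha hb hM ht0
  have hsq := critD_sq ha hb hM ht0
  have hD' : critD a b M t = b * t⁻¹ - b * t := by
    have h1 : 0 < b * t⁻¹ - b * t := by
      have : b * t⁻¹ - b * t = b * (1 - t ^ 2) * t⁻¹ := by field_simp
      rw [this]
      have : 0 < 1 - t ^ 2 := by nlinarith
      positivity
    have h2 : critD a b M t ^ 2 = (b * t⁻¹ - b * t) ^ 2 := by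
      have hM' : M = b * t + b * t⁻¹ - 2 * a := by
        have : K = b * t + b * t⁻¹ := by field_simp; linarith
        linarith
      rw [hsq, hM']
      field_simp
      ring
    exact (sq_eq_sq₀ hD.le h1.le).1 h2
  have hM' : M = b * t + b * t⁻¹ - 2 * a := by
    have : K = b * t + b * t⁻¹ := by field_simp; linarith
    linarith
  rw [critX, hD', div_eq_iff]
  · linarith
  · rw [← hD']; linarith

theorem critX_neg_iff (ha : 0 < a) (hb : 0 < b) (hM : 2 * a + 2 * b < M) (hm : 0 < m) :
    critX a b M m < 0 ↔ m < b / a := by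
  have h1 := critD_pos ha hb hM hm
  have h2 : 0 < M + critD a b M m := by linarith
  rw [critX, div_neg_iff, lt_div_iff₀ ha]
  have h3 : m * (a - b * m⁻¹) = m * a - b := by field_simp
  constructor
  · rintro (⟨-, h⟩ | ⟨h, -⟩)
    · linarith
    · nlinarith
  · intro h
    right
    refine ⟨?_, h2⟩
    by_contra! h4
    nlinarith

theorem critX_eq_zero_iff (ha : 0 < a) (hb : 0 < b) (hM : 2 * a + 2 * b < M) (hm : 0 < m) :
    critX a b M m = 0 ↔ m = b / a := by
  have h1 := critD_pos ha hb hM hm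
  have h2 : M + critD a b M m ≠ 0 := by linarith
  rw [critX, div_eq_zero_iff, or_iff_left h2, eq_div_iff ha.ne']
  have h3 : m * (a - b * m⁻¹) = m * a - b := by field_simp
  constructor
  · intro h
    have : a - b * m⁻¹ = 0 := by linarith
    rw [this] at h3
    linarith
  · intro h
    rw [h, sub_self] at h3
    rcases mul_eq_zero.1 h3 with h4 | h4
    · exact absurd h4 hm.ne'
    · linarith

theorem strictMonoOn_critX (ha : 0 < a) (hb : 0 < b) (hM : 2 * a + 2 * b < M) :
    StrictMonoOn (critX a b M) (Ioc 0 (b / a)) := by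
  refine strictMonoOn_of_deriv_pos (convex_Ioc _ _) ?_ ?_
  · exact fun m hm => (hasDerivAt_critX ha hb hM hm.1).continuousAt.continuousWithinAt
  · intro m hm
    rw [interior_Ioc] at hm
    rw [(hasDerivAt_critX ha hb hM hm.1).deriv]
    have h1 := critY_lt_one ha hb hM hm.1
    have h2 := (critX_neg_iff ha hb hM hm.1).2 hm.2
    have h3 := critY_eq (a := a) (b := b) (M := M) hm.1
    have h4 : 0 < critY a b M m := by rw [h3]; nlinarith [hm.1]
    have h5 := critD_pos ha hb hM hm.1
    have h6 : 0 < 1 - critY a b M m ^ 2 := by nlinarith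
    have := hm.1
    positivity

theorem critStart_lt (ha : 0 < a) (hb : 0 < b) (hM : 2 * a + 2 * b < M) :
    critStart a b M < b / a := by
  obtain ⟨h1, -, h2⟩ := critStart_spec ha hb hM
  exact (critX_neg_iff ha hb hM h1).1 (by rw [h2]; norm_num)

theorem neg_one_le_critX_iff (ha : 0 < a) (hb : 0 < b) (hM : 2 * a + 2 * b < M) (hm : 0 < m) :
    -1 ≤ critX a b M m ↔ critStart a b M ≤ m := by
  obtain ⟨h1, -, h2⟩ := critStart_spec ha hb hM
  have h3 := critStart_lt ha hb hM
  rcases le_or_gt m (b / a) with h | h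
  · rw [← h2]
    exact (strictMonoOn_critX ha hb hM).le_iff_le ⟨h1, h3.le⟩ ⟨hm, h⟩
  · have h4 : ¬ critX a b M m < 0 := fun h5 => lt_asymm h ((critX_neg_iff ha hb hM hm).1 h5)
    constructor
    · intro _; exact (h3.trans h).le
    · intro _; linarith

theorem neg_one_lt_critX_iff (ha : 0 < a) (hb : 0 < b) (hM : 2 * a + 2 * b < M) (hm : 0 < m) :
    -1 < critX a b M m ↔ critStart a b M < m := by
  obtain ⟨h1, -, h2⟩ := critStart_spec ha hb hM
  have h3 := critStart_lt ha hb hM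
  rcases le_or_gt m (b / a) with h | h
  · rw [← h2]
    exact (strictMonoOn_critX ha hb hM).lt_iff_lt ⟨h1, h3.le⟩ ⟨hm, h⟩
  · have h4 : ¬ critX a b M m < 0 := fun h5 => lt_asymm h ((critX_neg_iff ha hb hM hm).1 h5)
    constructor
    · intro _; exact h3.trans h
    · intro _; linarith

theorem neg_one_le_critY_iff (ha : 0 < a) (hb : 0 < b) (hM : 2 * a + 2 * b < M) (hm : 0 < m) :
    -1 ≤ critY a b M m ↔ m ≤ (critStart b a M)⁻¹ := by
  have hM' : 2 * b + 2 * a < M := by linarith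
  rw [critY, neg_one_le_critX_iff hb ha hM' (inv_pos.2 hm),
    le_inv_comm₀ (critStart_spec hb ha hM').1 hm]

theorem neg_one_lt_critY_iff (ha : 0 < a) (hb : 0 < b) (hM : 2 * a + 2 * b < M) (hm : 0 < m) :
    -1 < critY a b M m ↔ m < (critStart b a M)⁻¹ := by
  have hM' : 2 * b + 2 * a < M := by linarith
  rw [critY, neg_one_lt_critX_iff hb ha hM' (inv_pos.2 hm),
    lt_inv_comm₀ (critStart_spec hb ha hM').1 hm]

/-- The exchange of the axes reverses the sign of `critE` and the order of the parameters, which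
reduces x > 0 to x < 0. -/
theorem critE_swap (hm : 0 < m) : critE b a M m⁻¹ = -(m ^ 3)⁻¹ * critE a b M m := by
  rw [critE, critE, critY_swap, ← critY]
  field_simp
  ring

/-- `crit_rel` rearranges to b(1 - y)² - am(1 - x)² = -mx(M - 2a - 2b), which is positive for x < 0.
Multiplying by (1 + x)² ≤ 1 ≤ (1 + y)² gives the claim. This is where M > 2a + 2b enters beyond the
positivity of γ. -/
theorem crit_lt_of_neg (ha : 0 < a) (hb : 0 < b) (hM : 2 * a + 2 * b < M) (hm : 0 < m)
    (hx : critX a b M m < 0) (hx1 : -1 ≤ critX a b M m) :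
    a * m * (1 - critX a b M m ^ 2) ^ 2 < b * (1 - critY a b M m ^ 2) ^ 2 := by
  have h1 := crit_rel ha hb hM hm
  have h2 := critD_eq ha hb hM hm
  have h3 := critY_eq (a := a) (b := b) (M := M) hm
  set x := critX a b M m
  set y := critY a b M m
  rw [h2] at h1
  have hy : 0 < y := by rw [h3]; nlinarith
  have h4 : a * m * (1 - x) ^ 2 < b * (1 - y) ^ 2 := by
    have h5 : b * (1 - y) ^ 2 - a * m * (1 - x) ^ 2 = m * -x * (M - 2 * a - 2 * b) := by
      rw [h3] at h1 ⊢
      linear_combination h1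
    have : 0 < m * -x * (M - 2 * a - 2 * b) :=
      mul_pos (mul_pos hm (by linarith)) (by linarith)
    linarith
  have h6 : (1 + x) ^ 2 ≤ 1 := by nlinarith
  have h7 : 1 ≤ (1 + y) ^ 2 := by nlinarith
  calc a * m * (1 - x ^ 2) ^ 2 = (a * m * (1 - x) ^ 2) * (1 + x) ^ 2 := by ring
    _ ≤ (a * m * (1 - x) ^ 2) * 1 := by gcongr
    _ < b * (1 - y) ^ 2 * 1 := by linarith
    _ ≤ b * (1 - y) ^ 2 * (1 + y) ^ 2 := by gcongr
    _ = b * (1 - y ^ 2) ^ 2 := by ring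

theorem critE_pos_of_le_one (ha : 0 < a) (hb : 0 < b) (hM : 2 * a + 2 * b < M) (hm : 0 < m)
    (hx : critX a b M m < 0) (hx1 : -1 ≤ critX a b M m) (hm1 : m ≤ 1) : 0 < critE a b M m := by
  have h := crit_lt_of_neg ha hb hM hm hx hx1
  have h2 : a * m ^ 3 * (1 - critX a b M m ^ 2) ^ 2 ≤ a * m * (1 - critX a b M m ^ 2) ^ 2 := by
    gcongr
    exact pow_le_of_le_one hm.le hm1 (by norm_num)
  rw [critE]
  linarith

theorem hasDerivAt_cuspFun {u : ℝ} (hu : u ≠ 0) :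
    HasDerivAt (fun u : ℝ => (1 - u ^ 2) ^ 2 / u ^ 3) ((u ^ 2 + 3) * (u ^ 2 - 1) / u ^ 4) u := by
  have h1 : HasDerivAt (fun u : ℝ => (1 - u ^ 2) ^ 2) (2 * (1 - u ^ 2) * (-(2 * u))) u := by
    have := ((hasDerivAt_pow 2 u).const_sub 1).pow 2
    refine this.congr_deriv ?_
    simp
  have h2 := h1.div (hasDerivAt_pow 3 u) (pow_ne_zero 3 hu)
  refine h2.congr_deriv ?_
  field_simp
  norm_num
  ring

/-- For m ≤ 1 and x < 0 the function `critE` is positive, so E ≤ 0 forces m > 1. From there on E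
divided by -y³ is strictly increasing, so E cannot become nonnegative again. -/
theorem critE_neg_of_neg (ha : 0 < a) (hb : 0 < b) (hM : 2 * a + 2 * b < M) (hm : 0 < m) {n : ℝ}
    (hmn : m < n) (hx1 : -1 ≤ critX a b M m) (hn : critX a b M n < 0) (hE : critE a b M m ≤ 0) :
    critE a b M n < 0 := by
  have hn0 : 0 < n := hm.trans hmn
  have hnb := (critX_neg_iff ha hb hM hn0).1 hn
  have hneg : ∀ l ∈ Icc m n, critX a b M l < 0 := fun l hl =>
    (critX_neg_iff ha hb hM (hm.trans_le hl.1)).2 (hl.2.trans_lt hnb)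
  have hx := hneg m ⟨le_rfl, hmn.le⟩
  have hm1 : 1 < m := by
    by_contra! h
    exact absurd (critE_pos_of_le_one ha hb hM hm hx hx1 h) (not_lt.2 hE)
  -- As y = l(-x), this is -E/y³, and it separates into one function (1 - u²)²/u³ evaluated at u =
  -- -x and at u = y. Its derivative turns out to be a positive multiple of l² - 1.
  set G : ℝ → ℝ := fun l => a * ((1 - (-critX a b M l) ^ 2) ^ 2 / (-critX a b M l) ^ 3) -
    b * ((1 - critY a b M l ^ 2) ^ 2 / critY a b M l ^ 3) with hG
  have hGE : ∀ l ∈ Icc m n, G l = -critE a b M l / (l * -critX a b M l) ^ 3 := by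
    intro l hl
    have h1 := hneg l hl
    have h0 : 0 < l := hm.trans_le hl.1
    simp only [hG, critE]
    have h2 := critY_eq (a := a) (b := b) (M := M) h0
    rw [h2]
    have h1' := h1.ne
    field_simp
    ring
  have hYpos : ∀ l ∈ Icc m n, 0 < critY a b M l := fun l hl => by
    have h0 : 0 < l := hm.trans_le hl.1
    rw [critY_eq h0]; nlinarith [hneg l hl]
  have hGd : ∀ l ∈ Icc m n, HasDerivAt G (a * (((-critX a b M l) ^ 2 + 3) *
      ((-critX a b M l) ^ 2 - 1) / (-critX a b M l) ^ 4 *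
      -(b * (1 - critY a b M l ^ 2) / (l ^ 2 * critD a b M l))) -
      b * ((critY a b M l ^ 2 + 3) * (critY a b M l ^ 2 - 1) / critY a b M l ^ 4 *
      -(a * (1 - critX a b M l ^ 2) / critD a b M l))) l := by
    intro l hl
    have h0 : 0 < l := hm.trans_le hl.1
    refine HasDerivAt.sub (HasDerivAt.const_mul a ?_) (HasDerivAt.const_mul b ?_)
    · exact (hasDerivAt_cuspFun (neg_ne_zero.2 (hneg l hl).ne)).comp l
        (hasDerivAt_critX ha hb hM h0).neg
    · exact (hasDerivAt_cuspFun (hYpos l hl).ne').comp l (hasDerivAt_critY ha hb hM h0)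
  have hGm : StrictMonoOn G (Icc m n) := by
    refine strictMonoOn_of_deriv_pos (convex_Icc m n)
      (fun l hl => (hGd l hl).continuousAt.continuousWithinAt) fun l hl => ?_
    rw [interior_Icc] at hl
    have hl' := Ioo_subset_Icc_self hl
    have h0 : 0 < l := hm.trans hl.1
    rw [(hGd l hl').deriv]
    have h1 := hneg l hl'
    have h2 := hYpos l hl'
    have h3 := critY_lt_one ha hb hM h0
    have h4 : -1 < critX a b M l := hx1.trans_lt
      (strictMonoOn_critX ha hb hM ⟨hm, (hmn.trans hnb).le⟩ ⟨h0, (hl.2.trans hnb).le⟩ hl.1)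
    have h5 := critD_pos ha hb hM h0
    have h6 := critY_eq (a := a) (b := b) (M := M) h0
    have h7 : 0 < 1 - critX a b M l ^ 2 := by nlinarith
    have h8 : 0 < 1 - critY a b M l ^ 2 := by nlinarith
    have key : (a * (((-critX a b M l) ^ 2 + 3) *
      ((-critX a b M l) ^ 2 - 1) / (-critX a b M l) ^ 4 *
      -(b * (1 - critY a b M l ^ 2) / (l ^ 2 * critD a b M l))) -
      b * ((critY a b M l ^ 2 + 3) * (critY a b M l ^ 2 - 1) / critY a b M l ^ 4 *
      -(a * (1 - critX a b M l ^ 2) / critD a b M l))) =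
      3 * a * b * (1 - critX a b M l ^ 2) * (1 - critY a b M l ^ 2) * (l ^ 2 - 1) /
        (critD a b M l * (l * critX a b M l) ^ 4) := by
      rw [h6]
      have h1' := h1.ne
      field_simp
      ring
    rw [key]
    have h9 : 0 < l ^ 2 - 1 := by nlinarith [hl.1]
    have h10 : 0 < (l * critX a b M l) ^ 4 := by
      have : l * critX a b M l ≠ 0 := mul_ne_zero h0.ne' h1.ne
      positivity
    positivity
  have h1 := hGm (left_mem_Icc.2 hmn.le) (right_mem_Icc.2 hmn.le) hmn
  rw [hGE m (left_mem_Icc.2 hmn.le), hGE n (right_mem_Icc.2 hmn.le)] at h1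
  have p1 : 0 < (m * -critX a b M m) ^ 3 := pow_pos (mul_pos hm (by linarith)) 3
  have p2 : 0 < (n * -critX a b M n) ^ 3 := pow_pos (mul_pos hn0 (by linarith)) 3
  have h2 : 0 ≤ -critE a b M m / (m * -critX a b M m) ^ 3 := div_nonneg (by linarith) p1.le
  have h3 := h2.trans_lt h1
  have := (div_pos_iff_of_pos_right p2).1 h3
  linarith

theorem critE_neg_of_pos (ha : 0 < a) (hb : 0 < b) (hM : 2 * a + 2 * b < M) (hm : 0 < m)
    (hx : 0 < critX a b M m) (hy : -1 ≤ critY a b M m) (hm1 : 1 ≤ m) : critE a b M m < 0 := by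
  have hM' : 2 * b + 2 * a < M := by linarith
  have h := critE_pos_of_le_one hb ha hM' (inv_pos.2 hm) (m := m⁻¹) ?_ hy (inv_le_one_of_one_le₀ hm1)
  · rw [critE_swap hm] at h
    have : 0 < (m ^ 3)⁻¹ := by positivity
    by_contra! h2
    nlinarith
  · rw [← critY, critY_eq hm]; nlinarith

/-- Along the inner critical curve the function `critE` changes sign only once. -/
theorem critE_neg (ha : 0 < a) (hb : 0 < b) (hM : 2 * a + 2 * b < M) (hm : 0 < m) {n : ℝ}
    (hmn : m < n) (hx : -1 ≤ critX a b M m) (hy : -1 ≤ critY a b M n) (hE : critE a b M m ≤ 0) :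
    critE a b M n < 0 := by
  have hM' : 2 * b + 2 * a < M := by linarith
  have hn : 0 < n := hm.trans hmn
  have hpos : ∀ l, 0 < l → b / a < l → 0 < critX a b M l := fun l h0 h1 => by
    rcases lt_trichotomy (critX a b M l) 0 with h | h | h
    · exact absurd ((critX_neg_iff ha hb hM h0).1 h) (not_lt.2 h1.le)
    · exact absurd ((critX_eq_zero_iff ha hb hM h0).1 h) h1.ne'
    · exact h
  have hE0 : ∀ l, 0 < l → critX a b M l = 0 → critE a b M l = b - a * l ^ 3 := fun l h0 h1 => by
    rw [critE, critY_eq h0, h1]; ring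
  rcases lt_trichotomy (critX a b M m) 0 with h | h | h
  · have hm1 : 1 < m := by
      by_contra! h1
      exact absurd (critE_pos_of_le_one ha hb hM hm h hx h1) (not_lt.2 hE)
    rcases lt_trichotomy (critX a b M n) 0 with h2 | h2 | h2
    · exact critE_neg_of_neg ha hb hM hm hmn hx h2 hE
    · rw [hE0 n hn h2]
      have h3 := (critX_eq_zero_iff ha hb hM hn).1 h2
      rw [eq_div_iff ha.ne'] at h3
      have : b = a * n := by linarith
      rw [this]
      have : n < n ^ 3 := by nlinarith [mul_pos hn hn]
      nlinarith
    · exact critE_neg_of_pos ha hb hM hn h2 hy (hm1.trans hmn).le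
  · have h3 := (critX_eq_zero_iff ha hb hM hm).1 h
    rw [hE0 m hm h] at hE
    have hba : b = a * m := by rw [h3]; field_simp
    have hm1 : 1 ≤ m := by
      by_contra! h1
      have : m ^ 3 < m := by nlinarith [mul_pos hm hm, mul_pos hm (sub_pos.2 h1)]
      nlinarith
    exact critE_neg_of_pos ha hb hM hn (hpos n hn (h3 ▸ hmn)) hy (hm1.trans hmn.le)
  · have hba : b / a < m := by
      by_contra! h1
      rcases h1.lt_or_eq with h1 | h1
      · exact lt_asymm h ((critX_neg_iff ha hb hM hm).2 h1)
      · exact h.ne' ((critX_eq_zero_iff ha hb hM hm).2 h1)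
    have hxn := hpos n hn (hba.trans hmn)
    -- For x > 0 the claim is the contrapositive of `critE_neg_of_neg` with the axes exchanged: E(n)
    -- ≥ 0 would force E(m) > 0.
    by_contra! hcon
    have hi : n⁻¹ < m⁻¹ := inv_strictAnti₀ hm hmn
    have p1 : 0 < (m ^ 3)⁻¹ := by positivity
    have p2 : 0 < (n ^ 3)⁻¹ := by positivity
    have := critE_neg_of_neg hb ha hM' (inv_pos.2 hn) hi hy
      (by rw [← critY, critY_eq hm]; nlinarith) (by rw [critE_swap hn]; nlinarith)
    rw [critE_swap hm] at this
    nlinarith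

end crit

end LatticeVelocity

/-! ### The velocity along the inner critical curve: slopes and half arcs. -/

namespace LatticeVelocity

section crit

variable {a b M m : ℝ}

theorem hasDerivAt_one_sub_critX_sq (ha : 0 < a) (hb : 0 < b) (hM : 2 * a + 2 * b < M)
    (hm : 0 < m) : HasDerivAt (fun l => 1 - critX a b M l ^ 2)
      (-(2 * critX a b M m * (b * (1 - critY a b M m ^ 2) / (m ^ 2 * critD a b M m)))) m := by
  refine (((hasDerivAt_critX ha hb hM hm).pow 2).const_sub 1).congr_deriv ?_
  norm_num

theorem hasDerivAt_one_sub_critY_sq (ha : 0 < a) (hb : 0 < b) (hM : 2 * a + 2 * b < M)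
    (hm : 0 < m) : HasDerivAt (fun l => 1 - critY a b M l ^ 2)
      (-(2 * critY a b M m * -(a * (1 - critX a b M m ^ 2) / critD a b M m))) m := by
  refine (((hasDerivAt_critY ha hb hM hm).pow 2).const_sub 1).congr_deriv ?_
  norm_num

/-- This and `hasDerivAt_critW` have the common factor `critE`, so both coordinates turn back at its
zero, and their ratio is `critS`. -/
theorem hasDerivAt_critV (ha : 0 < a) (hb : 0 < b) (hM : 2 * a + 2 * b < M) (hm : 0 < m)
    (hx : -1 < critX a b M m) :
    HasDerivAt (critV a b M) (a * b * critE a b M m / (m ^ 3 * critD a b M m ^ 2 *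
      Real.sqrt (critD a b M m) * Real.sqrt (1 - critX a b M m ^ 2))) m := by
  have hx1 := critX_lt_one ha hb hM hm
  have hD := critD_pos ha hb hM hm
  have hs : 0 < 1 - critX a b M m ^ 2 := by nlinarith
  have h1 : HasDerivAt (fun l => a * Real.sqrt (1 - critX a b M l ^ 2)) _ m :=
    ((hasDerivAt_one_sub_critX_sq ha hb hM hm).sqrt hs.ne').const_mul a
  have h2 := h1.div ((hasDerivAt_critD ha hb hM hm).sqrt hD.ne') (Real.sqrt_pos.2 hD).ne'
  refine h2.congr_deriv ?_
  have h3 := crit_rel ha hb hM hm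
  have h4 := critY_eq (a := a) (b := b) (M := M) hm
  rw [critE]
  have hq := Real.sq_sqrt hD.le
  have hq0 := Real.sqrt_pos.2 hD
  have hr := Real.sq_sqrt hs.le
  have hr0 := Real.sqrt_pos.2 hs
  set x := critX a b M m
  set y := critY a b M m
  set D := critD a b M m
  set q := Real.sqrt D
  set r := Real.sqrt (1 - x ^ 2)
  rw [← hq] at h3 ⊢
  field_simp
  rw [hr]
  have hy2 : y ^ 2 = m ^ 2 * x ^ 2 := by rw [h4]; ring
  have key : -x * (1 - y ^ 2) * q ^ 2 * m - (1 - x ^ 2) * a * (m ^ 3 - m) =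
      b * (1 - y ^ 2) ^ 2 - a * m ^ 3 * (1 - x ^ 2) ^ 2 := by
    have : m * x * q ^ 2 = a * m * (1 - x ^ 2) - b * (1 - y ^ 2) := by linarith
    linear_combination (-(1 - y ^ 2)) * this + a * m * (1 - x ^ 2) * hy2
  linear_combination key

theorem hasDerivAt_critW (ha : 0 < a) (hb : 0 < b) (hM : 2 * a + 2 * b < M) (hm : 0 < m)
    (hy : -1 < critY a b M m) :
    HasDerivAt (critW a b M) (a * b * critE a b M m / (m ^ 2 * critD a b M m ^ 2 *
      Real.sqrt (critD a b M m) * Real.sqrt (1 - critY a b M m ^ 2))) m := by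
  have h1 := (hasDerivAt_critV hb ha (by linarith : 2 * b + 2 * a < M) (inv_pos.2 hm) hy).comp m
    (hasDerivAt_inv hm.ne')
  refine h1.congr_deriv ?_
  rw [critD_swap, critE_swap hm, ← critY]
  have hy1 := critY_lt_one ha hb hM hm
  have hD := Real.sqrt_pos.2 (critD_pos ha hb hM hm)
  have hs : 0 < Real.sqrt (1 - critY a b M m ^ 2) := Real.sqrt_pos.2 (by nlinarith)
  have := critD_pos ha hb hM hm
  field_simp

theorem critS_swap (a b M m : ℝ) : critS b a M m⁻¹ = (critS a b M m)⁻¹ := by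
  rw [critS, critS, critY_swap, ← critY, inv_div, mul_comm m, inv_mul_eq_div, div_div,
    mul_comm m]

/-- The square of the slope is differentiated to avoid roots. Its derivative is positive because the
numerator times -x is the difference whose sign `crit_lt_of_neg` gives, directly for x < 0 and with
exchanged axes for x > 0. -/
theorem hasDerivAt_critS_sq (ha : 0 < a) (hb : 0 < b) (hM : 2 * a + 2 * b < M) (hm : 0 < m)
    (hx : -1 < critX a b M m) (hy : -1 < critY a b M m) :
    ∃ r, 0 < r ∧ HasDerivAt (fun m => m ^ 2 * (1 - critX a b M m ^ 2) / (1 - critY a b M m ^ 2))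
      r m := by
  have hx1 := critX_lt_one ha hb hM hm
  have hy1 := critY_lt_one ha hb hM hm
  have hD := critD_pos ha hb hM hm
  have hs : 0 < 1 - critX a b M m ^ 2 := by nlinarith
  have hs' : 0 < 1 - critY a b M m ^ 2 := by nlinarith
  have h1 : HasDerivAt (fun m => m ^ 2 * (1 - critX a b M m ^ 2) / (1 - critY a b M m ^ 2))
      (((2 * m * (1 - critX a b M m ^ 2) + m ^ 2 *
        -(2 * critX a b M m * (b * (1 - critY a b M m ^ 2) / (m ^ 2 * critD a b M m)))) *
        (1 - critY a b M m ^ 2) - m ^ 2 * (1 - critX a b M m ^ 2) *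
        -(2 * critY a b M m * -(a * (1 - critX a b M m ^ 2) / critD a b M m))) /
        (1 - critY a b M m ^ 2) ^ 2) m := by
    refine (((hasDerivAt_pow 2 m).mul (hasDerivAt_one_sub_critX_sq ha hb hM hm)).div
      (hasDerivAt_one_sub_critY_sq ha hb hM hm) hs'.ne').congr_deriv ?_
    norm_num
  refine ⟨_, ?_, h1⟩
  refine div_pos ?_ (by positivity)
  have h3 := crit_rel ha hb hM hm
  have h4 := critY_eq (a := a) (b := b) (M := M) hm
  have hM' : 2 * b + 2 * a < M := by linarith
  have hneg := fun h => crit_lt_of_neg ha hb hM hm h hx.le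
  have hpos := fun h => crit_lt_of_neg hb ha hM' (inv_pos.2 hm) (m := m⁻¹) h hy.le
  rw [critY_swap, ← critY] at hpos
  set x := critX a b M m
  set y := critY a b M m
  set D := critD a b M m
  have hN : 0 < m * D * (1 - x ^ 2) * (1 - y ^ 2) - x * b * (1 - y ^ 2) ^ 2 +
      m ^ 3 * a * x * (1 - x ^ 2) ^ 2 := by
    have hid : -x * (m * D * (1 - x ^ 2) * (1 - y ^ 2) - x * b * (1 - y ^ 2) ^ 2 +
        m ^ 3 * a * x * (1 - x ^ 2) ^ 2) =
        b * (1 - y ^ 2) ^ 2 - a * m * (1 - x ^ 2) ^ 2 := by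
      have hy2 : y ^ 2 = m ^ 2 * x ^ 2 := by rw [h4]; ring
      linear_combination (-(1 - x ^ 2) * (1 - y ^ 2)) * h3 +
        (a * m * (1 - x ^ 2) ^ 2) * hy2
    rcases lt_trichotomy x 0 with h | h | h
    · have := hneg h
      by_contra! hcon
      nlinarith
    · have hy0 : y = 0 := by rw [h4, h]; ring
      rw [h, hy0]
      have := mul_pos hm hD
      nlinarith
    · have := hpos (by rw [h4]; nlinarith)
      have h5 : b * (1 - y ^ 2) ^ 2 < a * m * (1 - x ^ 2) ^ 2 := by
        have h6 := mul_lt_mul_of_pos_right this hm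
        field_simp at h6
        linarith
      by_contra! hcon
      nlinarith
  have hform : ((2 * m * (1 - x ^ 2) + m ^ 2 *
      -(2 * x * (b * (1 - y ^ 2) / (m ^ 2 * D)))) * (1 - y ^ 2) -
      m ^ 2 * (1 - x ^ 2) * -(2 * y * -(a * (1 - x ^ 2) / D))) =
      2 / D * (m * D * (1 - x ^ 2) * (1 - y ^ 2) - x * b * (1 - y ^ 2) ^ 2 +
      m ^ 3 * a * x * (1 - x ^ 2) ^ 2) := by
    rw [h4]
    field_simp
    ring
  rw [hform]
  exact mul_pos (div_pos two_pos hD) hN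

theorem critS_sq (hs : 0 ≤ 1 - critX a b M m ^ 2) (hs' : 0 ≤ 1 - critY a b M m ^ 2) :
    critS a b M m ^ 2 = m ^ 2 * (1 - critX a b M m ^ 2) / (1 - critY a b M m ^ 2) := by
  rw [critS, div_pow, mul_pow, Real.sq_sqrt hs, Real.sq_sqrt hs']

theorem continuousAt_critX (ha : 0 < a) (hb : 0 < b) (hM : 2 * a + 2 * b < M) (hm : 0 < m) :
    ContinuousAt (critX a b M) m := (hasDerivAt_critX ha hb hM hm).continuousAt

theorem continuousAt_critY (ha : 0 < a) (hb : 0 < b) (hM : 2 * a + 2 * b < M) (hm : 0 < m) :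
    ContinuousAt (critY a b M) m := (hasDerivAt_critY ha hb hM hm).continuousAt

theorem continuousAt_critD (ha : 0 < a) (hb : 0 < b) (hM : 2 * a + 2 * b < M) (hm : 0 < m) :
    ContinuousAt (critD a b M) m := (hasDerivAt_critD ha hb hM hm).continuousAt

theorem continuousAt_critV (ha : 0 < a) (hb : 0 < b) (hM : 2 * a + 2 * b < M) (hm : 0 < m) :
    ContinuousAt (critV a b M) m :=
  (continuousAt_const.mul (continuousAt_const.sub ((continuousAt_critX ha hb hM hm).pow 2)).sqrt).div
    (continuousAt_critD ha hb hM hm).sqrt (Real.sqrt_pos.2 (critD_pos ha hb hM hm)).ne'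

theorem continuousAt_critW (ha : 0 < a) (hb : 0 < b) (hM : 2 * a + 2 * b < M) (hm : 0 < m) :
    ContinuousAt (critW a b M) m :=
  (continuousAt_critV hb ha (by linarith) (inv_pos.2 hm)).comp (continuousAt_inv₀ hm.ne')

theorem continuousAt_critS (ha : 0 < a) (hb : 0 < b) (hM : 2 * a + 2 * b < M) (hm : 0 < m)
    (hy : -1 < critY a b M m) : ContinuousAt (critS a b M) m := by
  have hy1 := critY_lt_one ha hb hM hm
  have hs : 0 < Real.sqrt (1 - critY a b M m ^ 2) := Real.sqrt_pos.2 (by nlinarith)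
  exact (continuousAt_id.mul
    (continuousAt_const.sub ((continuousAt_critX ha hb hM hm).pow 2)).sqrt).div
    (continuousAt_const.sub ((continuousAt_critY ha hb hM hm).pow 2)).sqrt hs.ne'

theorem continuousAt_critE (ha : 0 < a) (hb : 0 < b) (hM : 2 * a + 2 * b < M) (hm : 0 < m) :
    ContinuousAt (critE a b M) m :=
  (continuousAt_const.mul
    ((continuousAt_const.sub ((continuousAt_critY ha hb hM hm).pow 2)).pow 2)).sub
    ((continuousAt_const.mul (continuousAt_id.pow 3)).mul
    ((continuousAt_const.sub ((continuousAt_critX ha hb hM hm).pow 2)).pow 2))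

theorem strictMonoOn_critS (ha : 0 < a) (hb : 0 < b) (hM : 2 * a + 2 * b < M) {q : ℝ}
    (hq : q < (critStart b a M)⁻¹) : StrictMonoOn (critS a b M) (Icc (critStart a b M) q) := by
  have ht := (critStart_spec ha hb hM).1
  set w : ℝ → ℝ := fun m => m ^ 2 * (1 - critX a b M m ^ 2) / (1 - critY a b M m ^ 2) with hw
  have hy : ∀ m ∈ Icc (critStart a b M) q, -1 < critY a b M m := fun m hm =>
    (neg_one_lt_critY_iff ha hb hM (ht.trans_le hm.1)).2 (hm.2.trans_lt hq)
  have hs' : ∀ m ∈ Icc (critStart a b M) q, 0 < 1 - critY a b M m ^ 2 := fun m hm => by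
    have h1 := hy m hm
    have h2 := critY_lt_one ha hb hM (ht.trans_le hm.1)
    nlinarith
  have hs : ∀ m ∈ Icc (critStart a b M) q, 0 ≤ 1 - critX a b M m ^ 2 := fun m hm => by
    have h1 := (neg_one_le_critX_iff ha hb hM (ht.trans_le hm.1)).2 hm.1
    have h2 := critX_lt_one ha hb hM (ht.trans_le hm.1)
    nlinarith
  have hmono : StrictMonoOn w (Icc (critStart a b M) q) := by
    refine strictMonoOn_of_deriv_pos (convex_Icc _ _) (fun m hm => ?_) fun m hm => ?_
    · have h0 := ht.trans_le hm.1
      refine ContinuousAt.continuousWithinAt ?_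
      exact ((continuousAt_id.pow 2).mul
        (continuousAt_const.sub ((continuousAt_critX ha hb hM h0).pow 2))).div
        (continuousAt_const.sub ((continuousAt_critY ha hb hM h0).pow 2)) (hs' m hm).ne'
    · rw [interior_Icc] at hm
      have h0 := ht.trans hm.1
      obtain ⟨r, hr, hr'⟩ := hasDerivAt_critS_sq ha hb hM h0
        ((neg_one_lt_critX_iff ha hb hM h0).2 hm.1) (hy m (Ioo_subset_Icc_self hm))
      rw [hr'.deriv]
      exact hr
  intro m hm n hn hmn
  have h1 := hmono hm hn hmn
  simp only [hw] at h1
  rw [← critS_sq (hs m hm) (hs' m hm).le, ← critS_sq (hs n hn) (hs' n hn).le] at h1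
  refine lt_of_pow_lt_pow_left₀ 2 ?_ h1
  have h0 := ht.trans_le hn.1
  rw [critS]
  positivity

/-- At the starting parameter x = -1, so the curve leaves the second axis with slope zero. As long
as E > 0 the first coordinate increases, and the increasing slope `critS` makes the curve a convex
graph. -/
theorem exists_upper_arc (ha : 0 < a) (hb : 0 < b) (hM : 2 * a + 2 * b < M) {q : ℝ}
    (hq0 : critStart a b M < q) (hq : q < (critStart b a M)⁻¹)
    (hE : ∀ m ∈ Ioo (critStart a b M) q, 0 < critE a b M m) :
    ∃ φ, HalfArc (critV a b M q) (critW a b M q) (critS a b M q) φ ∧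
      (∀ m ∈ Icc (critStart a b M) q, φ (critV a b M m) = critW a b M m) ∧
      (∀ m ∈ Icc (critStart a b M) q, critV a b M m ∈ Icc 0 (critV a b M q)) ∧
      ∀ t ∈ Icc 0 (critV a b M q), ∃ m ∈ Icc (critStart a b M) q, critV a b M m = t := by
  obtain ⟨ht, ht1, htx⟩ := critStart_spec ha hb hM
  have hty : 0 < 1 - critY a b M (critStart a b M) ^ 2 := by
    have h1 := critY_lt_one ha hb hM ht
    have h2 := critY_eq (a := a) (b := b) (M := M) ht
    rw [htx] at h2
    nlinarith
  refine exists_halfArc_of_param hq0 ?_ ?_ ?_ (strictMonoOn_critS ha hb hM hq) ?_ ?_ ?_ ?_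
  · exact fun m hm => (continuousAt_critV ha hb hM (ht.trans_le hm.1)).continuousWithinAt
  · exact fun m hm => (continuousAt_critW ha hb hM (ht.trans_le hm.1)).continuousWithinAt
  · intro m hm
    have h0 := ht.trans hm.1
    have hx := (neg_one_lt_critX_iff ha hb hM h0).2 hm.1
    have hy := (neg_one_lt_critY_iff ha hb hM h0).2 (hm.2.trans hq)
    have hx1 := critX_lt_one ha hb hM h0
    have hy1 := critY_lt_one ha hb hM h0
    have hs : 0 < Real.sqrt (1 - critX a b M m ^ 2) := Real.sqrt_pos.2 (by nlinarith)
    have hs' : 0 < Real.sqrt (1 - critY a b M m ^ 2) := Real.sqrt_pos.2 (by nlinarith)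
    have hD := critD_pos ha hb hM h0
    have hD' := Real.sqrt_pos.2 hD
    have hEm := hE m hm
    refine ⟨_, ?_, hasDerivAt_critV ha hb hM h0 hx, ?_⟩
    · positivity
    · refine (hasDerivAt_critW ha hb hM h0 hy).congr_deriv ?_
      rw [critS]
      field_simp
  · intro ε hε
    have h0 := ht.trans hq0
    have hc := continuousAt_critS ha hb hM h0 ((neg_one_lt_critY_iff ha hb hM h0).2 hq)
    have h1 : ∀ᶠ m in 𝓝[<] q, critS a b M q - ε < critS a b M m :=
      (hc.mono_left nhdsWithin_le_nhds).eventually (lt_mem_nhds (by linarith))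
    obtain ⟨m, hm, hm'⟩ := (h1.and (Ioo_mem_nhdsLT hq0)).exists
    exact ⟨m, hm', hm⟩
  · rw [critS]
    positivity
  · rw [critV, htx]
    simp
  · rw [critW, critV, critD_swap, ← critY]
    have := Real.sqrt_pos.2 (critD_pos ha hb hM ht)
    have := Real.sqrt_pos.2 hty
    positivity

/-- The two half arcs that meet at the cusp in the first quadrant. -/
theorem exists_arcPair (ha : 0 < a) (hb : 0 < b) (hM : 2 * a + 2 * b < M) :
    ∃ q, critStart a b M < q ∧ q < (critStart b a M)⁻¹ ∧ critE a b M q = 0 ∧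
      (∀ m ∈ Icc (critStart a b M) (critStart b a M)⁻¹, critE a b M m = 0 → m = q) ∧
      ∃ φ ψ, ArcPair (critV a b M q) (critW a b M q) (critS a b M q) φ ψ ∧
      (∀ m ∈ Icc (critStart a b M) q, φ (critV a b M m) = critW a b M m) ∧
      (∀ m ∈ Icc (critStart a b M) q, critV a b M m ∈ Icc 0 (critV a b M q)) ∧
      (∀ t ∈ Icc 0 (critV a b M q), ∃ m ∈ Icc (critStart a b M) q, critV a b M m = t) ∧
      (∀ m ∈ Icc q (critStart b a M)⁻¹, ψ (critW a b M m) = critV a b M m) ∧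
      (∀ m ∈ Icc q (critStart b a M)⁻¹, critW a b M m ∈ Icc 0 (critW a b M q)) ∧
      ∀ t ∈ Icc 0 (critW a b M q), ∃ m ∈ Icc q (critStart b a M)⁻¹, critW a b M m = t := by
  have hM' : 2 * b + 2 * a < M := by linarith
  obtain ⟨hp, -, hpx⟩ := critStart_spec ha hb hM
  obtain ⟨hr, -, hry⟩ := critStart_spec hb ha hM'
  have hpb := critStart_lt ha hb hM
  have hra : b / a < (critStart b a M)⁻¹ := by
    rw [lt_inv_comm₀ (by positivity) hr, inv_div]
    exact critStart_lt hb ha hM'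
  set p := critStart a b M with hpdef
  set r := critStart b a M with hrdef
  have hri : 0 < r⁻¹ := inv_pos.2 hr
  have hpr : p < r⁻¹ := hpb.trans hra
  -- At each end one cosine is -1 and only one of the two terms of `critE` survives, with opposite
  -- signs at the two ends.
  have hEp : 0 < critE a b M p := by
    have h1 := critY_lt_one ha hb hM hp
    have h2 := critY_eq (a := a) (b := b) (M := M) hp
    rw [critE, hpx]
    rw [hpx] at h2
    have : 0 < 1 - critY a b M p ^ 2 := by nlinarith
    norm_num
    positivity
  have hyr : critY a b M r⁻¹ = -1 := by rw [critY, inv_inv]; exact hry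
  have hEr : critE a b M r⁻¹ < 0 :=
    by
    have h1 := critX_lt_one ha hb hM hri
    have h2 := critY_eq (a := a) (b := b) (M := M) hri
    rw [critE, hyr]
    rw [hyr] at h2
    have h3 : 0 < critX a b M r⁻¹ := by
      by_contra! h
      nlinarith
    have : 0 < 1 - critX a b M r⁻¹ ^ 2 := by nlinarith
    have h4 : 0 < a * r⁻¹ ^ 3 * (1 - critX a b M r⁻¹ ^ 2) ^ 2 := by positivity
    norm_num at h4 ⊢
    exact h4
  obtain ⟨q, hq, hq0⟩ : (0 : ℝ) ∈ critE a b M '' Icc p r⁻¹ :=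
    intermediate_value_Icc' hpr.le (fun m hm =>
      (continuousAt_critE ha hb hM (hp.trans_le hm.1)).continuousWithinAt) ⟨hEr.le, hEp.le⟩
  have hpq : p < q := by
    rcases hq.1.lt_or_eq with h | h
    · exact h
    · rw [← h] at hq0; linarith
  have hqr : q < r⁻¹ := by
    rcases hq.2.lt_or_eq with h | h
    · exact h
    · rw [h] at hq0; linarith
  have hqpos := hp.trans hpq
  have hbefore : ∀ m ∈ Ico p q, 0 < critE a b M m := by
    intro m hm
    by_contra! h
    have hm0 := hp.trans_le hm.1
    have := critE_neg ha hb hM hm0 hm.2 ((neg_one_le_critX_iff ha hb hM hm0).2 hm.1)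
      ((neg_one_le_critY_iff ha hb hM hqpos).2 hq.2) h
    linarith
  have hafter : ∀ m ∈ Ioc q r⁻¹, critE a b M m < 0 := by
    intro m hm
    exact critE_neg ha hb hM hqpos hm.1 ((neg_one_le_critX_iff ha hb hM hqpos).2 hq.1)
      ((neg_one_le_critY_iff ha hb hM (hqpos.trans hm.1)).2 hm.2) hq0.le
  have huniq : ∀ m ∈ Icc p r⁻¹, critE a b M m = 0 → m = q := by
    intro m hm h
    rcases lt_trichotomy m q with h1 | h1 | h1
    · exact absurd h (hbefore m ⟨hm.1, h1⟩).ne'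
    · exact h1
    · exact absurd h (hafter m ⟨h1, hm.2⟩).ne
  obtain ⟨φ, hφ, hφ1, hφ2, hφ3⟩ := exists_upper_arc ha hb hM hpq hqr
    fun m hm => hbefore m ⟨hm.1.le, hm.2⟩
  have hrq : r < q⁻¹ := (lt_inv_comm₀ hr hqpos).2 hqr
  have hqp : q⁻¹ < p⁻¹ := inv_strictAnti₀ hp hpq
  -- The part beyond the cusp, seen with exchanged axes, is again an upper arc; there `critE` is
  -- positive because its sign is reversed.
  obtain ⟨ψ, hψ, hψ1, hψ2, hψ3⟩ := exists_upper_arc hb ha hM' hrq hqp fun m hm => by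
    have hm0 := hr.trans hm.1
    have h1 := hafter m⁻¹ ⟨(lt_inv_comm₀ hm0 hqpos).1 hm.2, (inv_strictAnti₀ hr hm.1).le⟩
    have h2 := critE_swap (a := a) (b := b) (M := M) (inv_pos.2 hm0)
    rw [inv_inv] at h2
    rw [h2]
    have : 0 < (m⁻¹ ^ 3)⁻¹ := by positivity
    nlinarith
  have hswap : ∀ m, critW b a M m⁻¹ = critV a b M m := fun m => by rw [critW, inv_inv]
  have hmem : ∀ m ∈ Icc q r⁻¹, m⁻¹ ∈ Icc r q⁻¹ := fun m hm =>
    ⟨(le_inv_comm₀ hr (hqpos.trans_le hm.1)).2 hm.2, inv_anti₀ hqpos hm.1⟩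
  refine ⟨q, hpq, hqr, hq0, huniq, φ, ψ, ⟨hφ, ?_⟩, hφ1, hφ2, hφ3, ?_, ?_, ?_⟩
  · rw [← hswap, ← critS_swap]
    exact hψ
  · intro m hm
    rw [← hswap m]
    exact hψ1 _ (hmem m hm)
  · intro m hm
    exact hψ2 _ (hmem m hm)
  · intro t ht
    obtain ⟨m, hm, rfl⟩ := hψ3 t ht
    refine ⟨m⁻¹, ⟨(le_inv_comm₀ (hr.trans_le hm.1) hqpos).1 hm.2, inv_anti₀ hr hm.1⟩, ?_⟩
    rw [critW, inv_inv]

end crit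

end LatticeVelocity

/-! ### Gradient, Hessian and third derivative of the dispersion relation. -/

namespace LatticeVelocity

section derivatives

variable {ω a b : ℝ}

theorem disp_arg_pos (hω : 0 < ω) (ha : 0 < a) (hb : 0 < b) (s t : ℝ) :
    0 < ω ^ 2 + (2 * a * (1 - Real.cos s) + 2 * b * (1 - Real.cos t)) := by
  have h1 := Real.cos_le_one s
  have h2 := Real.cos_le_one t
  have : 0 ≤ 2 * a * (1 - Real.cos s) := mul_nonneg (by linarith) (by linarith)
  have : 0 ≤ 2 * b * (1 - Real.cos t) := mul_nonneg (by linarith) (by linarith)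
  positivity

theorem disp_pos (hω : 0 < ω) (ha : 0 < a) (hb : 0 < b) (k : Plane) : 0 < disp ω a b k :=
  Real.sqrt_pos.2 (disp_arg_pos hω ha hb _ _)

theorem disp_sq (hω : 0 < ω) (ha : 0 < a) (hb : 0 < b) (k : Plane) : disp ω a b k ^ 2 =
    ω ^ 2 + 2 * a + 2 * b - 2 * a * Real.cos (k 0) - 2 * b * Real.cos (k 1) := by
  rw [disp, Real.sq_sqrt (disp_arg_pos hω ha hb _ _).le]
  ring

/-- The gradient of the dispersion relation. -/
noncomputable def velocity (ω a b : ℝ) (k : Plane) : Plane :=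
  !₂[a * Real.sin (k 0) / disp ω a b k, b * Real.sin (k 1) / disp ω a b k]

theorem velocity_zero (ω a b : ℝ) (k : Plane) :
    velocity ω a b k 0 = a * Real.sin (k 0) / disp ω a b k := by simp [velocity]

theorem velocity_one (ω a b : ℝ) (k : Plane) :
    velocity ω a b k 1 = b * Real.sin (k 1) / disp ω a b k := by simp [velocity]

theorem hasFDerivAt_coord (i : Fin 2) (k : Plane) :
    HasFDerivAt (fun k : Plane => k i) (EuclideanSpace.proj (𝕜 := ℝ) i : Plane →L[ℝ] ℝ) k :=
  (EuclideanSpace.proj (𝕜 := ℝ) i : Plane →L[ℝ] ℝ).hasFDerivAt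

theorem hasFDerivAt_disp (hω : 0 < ω) (ha : 0 < a) (hb : 0 < b) (k : Plane) :
    HasFDerivAt (disp ω a b) (velocity ω a b k 0 • (EuclideanSpace.proj (𝕜 := ℝ) 0 : Plane →L[ℝ] ℝ) +
      velocity ω a b k 1 • (EuclideanSpace.proj (𝕜 := ℝ) 1 : Plane →L[ℝ] ℝ)) k := by
  have h0 := (((hasFDerivAt_coord 0 k).cos.const_sub 1).const_mul (2 * a)).add
    (((hasFDerivAt_coord 1 k).cos.const_sub 1).const_mul (2 * b))
  have h1 := (h0.const_add (ω ^ 2)).sqrt (disp_arg_pos hω ha hb (k 0) (k 1)).ne'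
  refine h1.congr_fderiv ?_
  have h2 := disp_pos hω ha hb k
  have h3 : Real.sqrt (ω ^ 2 + (2 * a * (1 - Real.cos (k 0)) + 2 * b * (1 - Real.cos (k 1)))) =
    disp ω a b k := rfl
  ext ξ
  simp [velocity_zero, velocity_one, h3]
  field_simp

theorem gradient_disp (hω : 0 < ω) (ha : 0 < a) (hb : 0 < b) :
    gradient (disp ω a b) = velocity ω a b := by
  funext k
  refine HasGradientAt.gradient ?_
  rw [hasGradientAt_iff_hasFDerivAt]
  refine (hasFDerivAt_disp hω ha hb k).congr_fderiv ?_
  ext ξ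
  simp [PiLp.inner_apply, mul_comm]

theorem contDiff_velocity (hω : 0 < ω) (ha : 0 < a) (hb : 0 < b) :
    ContDiff ℝ 1 (velocity ω a b) := by
  have hc : ∀ i : Fin 2, ContDiff ℝ 1 fun k : Plane => k i := fun i =>
    (EuclideanSpace.proj (𝕜 := ℝ) i : Plane →L[ℝ] ℝ).contDiff
  have hd : ContDiff ℝ 1 (disp ω a b) := by
    refine ContDiff.sqrt ?_ fun k => (disp_arg_pos hω ha hb (k 0) (k 1)).ne'
    exact contDiff_const.add ((contDiff_const.mul (contDiff_const.sub (hc 0).cos)).add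
      (contDiff_const.mul (contDiff_const.sub (hc 1).cos)))
  rw [contDiff_euclidean]
  intro i
  fin_cases i
  · exact (contDiff_const.mul (hc 0).sin).div hd fun k => (disp_pos hω ha hb k).ne'
  · exact (contDiff_const.mul (hc 1).sin).div hd fun k => (disp_pos hω ha hb k).ne'

theorem hessian_disp (hω : 0 < ω) (ha : 0 < a) (hb : 0 < b) (k : Plane) :
    HasStrictFDerivAt (velocity ω a b) (hessian (disp ω a b) k) k := by
  rw [hessian, gradient_disp hω ha hb]
  exact (contDiff_velocity hω ha hb).contDiffAt.hasStrictFDerivAt one_ne_zero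

/-- Differentiating the product γ · (∂ᵢγ), which is a multiple of sin kᵢ, avoids the quotient rule:
γ D²γ = diag(a cos k₁, b cos k₂) - v vᵀ with v = ∇γ. -/
theorem hessian_apply (hω : 0 < ω) (ha : 0 < a) (hb : 0 < b) (k ξ : Plane) :
    hessian (disp ω a b) k ξ 0 = (a * Real.cos (k 0) * ξ 0 -
      (velocity ω a b k 0 * ξ 0 + velocity ω a b k 1 * ξ 1) * velocity ω a b k 0) / disp ω a b k ∧
    hessian (disp ω a b) k ξ 1 = (b * Real.cos (k 1) * ξ 1 -
      (velocity ω a b k 0 * ξ 0 + velocity ω a b k 1 * ξ 1) * velocity ω a b k 1) /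
        disp ω a b k := by
  have hH := hasStrictFDerivAt_euclidean.1 (hessian_disp hω ha hb k)
  have hd := disp_pos hω ha hb k
  have key : ∀ (i : Fin 2) (r : ℝ), (∀ k, velocity ω a b k i = r * Real.sin (k i) / disp ω a b k) →
      hessian (disp ω a b) k ξ i = (r * Real.cos (k i) * ξ i -
        (velocity ω a b k 0 * ξ 0 + velocity ω a b k 1 * ξ 1) * velocity ω a b k i) /
          disp ω a b k := by
    intro i r hr
    have h1 := (hH i).hasFDerivAt.mul (hasFDerivAt_disp hω ha hb k)
    have h2 : ((fun x => velocity ω a b x i) * disp ω a b) = fun k => r * Real.sin (k i) := by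
      funext k
      rw [Pi.mul_apply, hr, div_mul_cancel₀ _ (disp_pos hω ha hb k).ne']
    rw [h2] at h1
    have h3 := congrArg (fun L : Plane →L[ℝ] ℝ => L ξ)
      (h1.unique ((hasFDerivAt_coord i k).sin.const_mul r))
    simp at h3
    rw [eq_div_iff hd.ne']
    linarith
  exact ⟨key 0 a (velocity_zero ω a b), key 1 b (velocity_one ω a b)⟩

/-- The kernel of the Hessian. -/
theorem hessian_eq_zero_iff (hω : 0 < ω) (ha : 0 < a) (hb : 0 < b) (k ξ : Plane) :
    hessian (disp ω a b) k ξ = 0 ↔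
      a * Real.cos (k 0) * ξ 0 =
        (velocity ω a b k 0 * ξ 0 + velocity ω a b k 1 * ξ 1) * velocity ω a b k 0 ∧
      b * Real.cos (k 1) * ξ 1 =
        (velocity ω a b k 0 * ξ 0 + velocity ω a b k 1 * ξ 1) * velocity ω a b k 1 := by
  obtain ⟨h0, h1⟩ := hessian_apply hω ha hb k ξ
  have hd := disp_pos hω ha hb k
  constructor
  · intro h
    rw [h] at h0 h1
    rw [PiLp.zero_apply, eq_comm, div_eq_zero_iff, or_iff_left hd.ne', sub_eq_zero] at h0 h1
    exact ⟨h0, h1⟩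
  · rintro ⟨e0, e1⟩
    refine plane_ext ?_ ?_
    · rw [h0, e0, sub_self, zero_div]; rfl
    · rw [h1, e1, sub_self, zero_div]; rfl

theorem det_eq_zero_iff (L : Plane →L[ℝ] Plane) : L.det = 0 ↔ ∃ ξ, ξ ≠ 0 ∧ L ξ = 0 := by
  constructor
  · intro h
    obtain ⟨ξ, hξ, h0⟩ := (Submodule.ne_bot_iff _).1 (LinearMap.bot_lt_ker_of_det_eq_zero h).ne'
    exact ⟨ξ, h0, hξ⟩
  · rintro ⟨ξ, hξ, h0⟩
    by_contra h
    apply hξ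
    have := (L.toContinuousLinearEquivOfDetNeZero h).injective (a₁ := ξ) (a₂ := 0)
    apply this
    simpa using h0

/-- On the line through k with direction ξ, f f' = A and f f'' = A' - f'². In a kernel direction
f''(0) = 0, so one more derivative leaves f f''' = A'' at 0. -/
theorem thirdDirDeriv_disp (hω : 0 < ω) (ha : 0 < a) (hb : 0 < b) {k ξ : Plane}
    (hξ : hessian (disp ω a b) k ξ = 0) :
    disp ω a b k * thirdDirDeriv (disp ω a b) ξ k =
      -(a * Real.sin (k 0) * ξ 0 ^ 3 + b * Real.sin (k 1) * ξ 1 ^ 3) := by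
  set f : ℝ → ℝ := fun t => disp ω a b (k + t • ξ) with hf
  have hfpos : ∀ t, 0 < f t := fun t => disp_pos hω ha hb _
  have hl : ∀ (i : Fin 2) (t : ℝ), HasDerivAt (fun t : ℝ => k i + t * ξ i) (ξ i) t := fun i t => by
    simpa using ((hasDerivAt_id t).mul_const (ξ i)).const_add (k i)
  set A : ℝ → ℝ := fun t => a * ξ 0 * Real.sin (k 0 + t * ξ 0) + b * ξ 1 * Real.sin (k 1 + t * ξ 1)
    with hA
  set A' : ℝ → ℝ := fun t => a * ξ 0 ^ 2 * Real.cos (k 0 + t * ξ 0) +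
    b * ξ 1 ^ 2 * Real.cos (k 1 + t * ξ 1) with hA'
  have hAd : ∀ t, HasDerivAt A (A' t) t := fun t => by
    refine (((hl 0 t).sin.const_mul (a * ξ 0)).add ((hl 1 t).sin.const_mul (b * ξ 1))).congr_deriv ?_
    simp only [hA']; ring
  have hA'd : HasDerivAt A' (-(a * Real.sin (k 0) * ξ 0 ^ 3 + b * Real.sin (k 1) * ξ 1 ^ 3)) 0 := by
    refine (((hl 0 0).cos.const_mul (a * ξ 0 ^ 2)).add
      ((hl 1 0).cos.const_mul (b * ξ 1 ^ 2))).congr_deriv ?_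
    simp only [zero_mul, add_zero]; ring
  have hfd : ∀ t, HasDerivAt f (A t / f t) t := fun t => by
    have h1 := ((((hl 0 t).cos.const_sub 1).const_mul (2 * a)).add
      (((hl 1 t).cos.const_sub 1).const_mul (2 * b))).const_add (ω ^ 2)
    have h2 := h1.sqrt (disp_arg_pos hω ha hb (k 0 + t * ξ 0) (k 1 + t * ξ 1)).ne'
    have h3 : f = fun t => Real.sqrt (ω ^ 2 + (2 * a * (1 - Real.cos (k 0 + t * ξ 0)) +
        2 * b * (1 - Real.cos (k 1 + t * ξ 1)))) := by
      funext t; simp [hf, disp]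
    have h4 := congrFun h3 t
    rw [h3]
    refine h2.congr_deriv ?_
    simp only [hA, Pi.add_apply]
    ring
  set S : ℝ → ℝ := fun t => (A' t - (A t / f t) ^ 2) / f t with hS
  have hfd2 : ∀ t, HasDerivAt (fun t => A t / f t) (S t) t := fun t => by
    refine ((hAd t).div (hfd t) (hfpos t).ne').congr_deriv ?_
    have := hfpos t
    simp only [hS]
    field_simp
  have hS0 : S 0 = 0 := by
    obtain ⟨e0, e1⟩ := (hessian_eq_zero_iff hω ha hb k ξ).1 hξ
    have hf0 : f 0 = disp ω a b k := by simp [hf]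
    have h1 : A 0 / f 0 = velocity ω a b k 0 * ξ 0 + velocity ω a b k 1 * ξ 1 := by
      rw [hf0, velocity_zero, velocity_one]
      simp only [hA, zero_mul, add_zero]
      ring
    have h2 : A' 0 = (velocity ω a b k 0 * ξ 0 + velocity ω a b k 1 * ξ 1) ^ 2 := by
      simp only [hA', zero_mul, add_zero]
      linear_combination ξ 0 * e0 + ξ 1 * e1
    simp only [hS]
    rw [h1, h2, sub_self, zero_div]
  have hSd := (hA'd.sub ((hfd2 0).pow 2)).div (hfd 0) (hfpos 0).ne'
  have d1 : deriv f = fun t => A t / f t := funext fun t => (hfd t).deriv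
  have d2 : deriv (fun t => A t / f t) = S := funext fun t => (hfd2 t).deriv
  have hthird : thirdDirDeriv (disp ω a b) ξ k = deriv S 0 := by
    rw [thirdDirDeriv, ← hf, iteratedDeriv_succ, iteratedDeriv_succ, iteratedDeriv_one, d1, d2]
  have hf0 : f 0 = disp ω a b k := by simp [hf]
  have hnum : A' 0 - (A 0 / f 0) ^ 2 = 0 := by
    have := hS0
    simp only [hS] at this
    exact (div_eq_zero_iff.1 this).resolve_right (hfpos 0).ne'
  have hder : deriv S 0 = _ := hSd.deriv
  rw [hthird, hder, hS0, ← hf0]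
  have := (hfpos 0).ne'
  simp only [Pi.sub_apply, Pi.pow_apply, hnum]
  field_simp
  ring

end derivatives

end LatticeVelocity

/-! ### The range of the velocity and its interior points. -/

namespace LatticeVelocity

theorem exists_angle {c s : ℝ} (h : c ^ 2 + s ^ 2 = 1) :
    ∃ θ ∈ Icc (-Real.pi) Real.pi, Real.cos θ = c ∧ Real.sin θ = s := by
  have hc1 : -1 ≤ c := by nlinarith [sq_nonneg s]
  have hc2 : c ≤ 1 := by nlinarith [sq_nonneg s]
  have hpi := Real.pi_pos
  have h0 := Real.arccos_nonneg c
  have h1 := Real.arccos_le_pi c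
  have h2 : 1 - c ^ 2 = s ^ 2 := by linarith
  rcases le_total 0 s with hs | hs
  · refine ⟨Real.arccos c, ⟨by linarith, h1⟩, Real.cos_arccos hc1 hc2, ?_⟩
    rw [Real.sin_arccos, h2, Real.sqrt_sq hs]
  · refine ⟨-Real.arccos c, ⟨by linarith, by linarith⟩, ?_, ?_⟩
    · rw [Real.cos_neg, Real.cos_arccos hc1 hc2]
    · rw [Real.sin_neg, Real.sin_arccos, h2, Real.sqrt_sq_eq_abs, abs_of_nonpos hs, neg_neg]

theorem exists_mem_square {c s c' s' : ℝ} (h : c ^ 2 + s ^ 2 = 1) (h' : c' ^ 2 + s' ^ 2 = 1) :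
    ∃ k ∈ square, Real.cos (k 0) = c ∧ Real.sin (k 0) = s ∧ Real.cos (k 1) = c' ∧
      Real.sin (k 1) = s' := by
  obtain ⟨θ, hθ, h1, h2⟩ := exists_angle h
  obtain ⟨η, hη, h3, h4⟩ := exists_angle h'
  refine ⟨!₂[θ, η], fun i => ?_, by simpa using h1, by simpa using h2, by simpa using h3,
    by simpa using h4⟩
  fin_cases i
  · exact hθ
  · exact hη

theorem isCompact_square : IsCompact square := by
  have h : square = (EuclideanSpace.equiv (Fin 2) ℝ) ⁻¹'
      (Set.pi univ fun _ => Icc (-Real.pi) Real.pi) := by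
    ext k
    exact ⟨fun h i _ => h i, fun h i => h i (mem_univ i)⟩
  rw [h]
  exact (EuclideanSpace.equiv (Fin 2) ℝ).toHomeomorph.isCompact_preimage.2
    (isCompact_univ_pi fun _ => isCompact_Icc)

section image

variable {ω a b : ℝ}

theorem exists_square_velocity (ω a b : ℝ) (k : Plane) : ∃ k' ∈ square,
    Real.cos (k' 0) = Real.cos (k 0) ∧ Real.cos (k' 1) = Real.cos (k 1) ∧
      velocity ω a b k' = velocity ω a b k := by
  obtain ⟨k', hk', h1, h2, h3, h4⟩ := exists_mem_square (Real.cos_sq_add_sin_sq (k 0))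
    (Real.cos_sq_add_sin_sq (k 1))
  refine ⟨k', hk', h1, h3, ?_⟩
  simp only [velocity, disp, h1, h2, h3, h4]

theorem image_velocity_square (ω a b : ℝ) : velocity ω a b '' square = range (velocity ω a b) := by
  refine Subset.antisymm (image_subset_range _ _) ?_
  rintro _ ⟨k, rfl⟩
  obtain ⟨k', hk', -, -, h⟩ := exists_square_velocity ω a b k
  exact ⟨k', hk', h⟩

theorem isCompact_range_velocity (hω : 0 < ω) (ha : 0 < a) (hb : 0 < b) :
    IsCompact (range (velocity ω a b)) := by
  rw [← image_velocity_square]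
  exact isCompact_square.image (contDiff_velocity hω ha hb).continuous

theorem flip₀_mem_range {v : Plane} (hv : v ∈ range (velocity ω a b)) :
    flip₀ v ∈ range (velocity ω a b) := by
  obtain ⟨k, rfl⟩ := hv
  refine ⟨flip₀ k, plane_ext ?_ ?_⟩
  · simp only [velocity_zero, disp, flip₀_apply, Real.sin_neg, Real.cos_neg]
    ring
  · simp only [velocity_one, disp, flip₀_apply, Real.cos_neg]

theorem neg_mem_range {v : Plane} (hv : v ∈ range (velocity ω a b)) :
    -v ∈ range (velocity ω a b) := by
  obtain ⟨k, rfl⟩ := hv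
  refine ⟨-k, plane_ext ?_ ?_⟩
  · simp only [velocity_zero, disp, PiLp.neg_apply, Real.sin_neg, Real.cos_neg]
    ring
  · simp only [velocity_one, disp, PiLp.neg_apply, Real.sin_neg, Real.cos_neg]
    ring

theorem map_mem_interior {S : Set Plane} (ρ : Plane ≃ₗᵢ[ℝ] Plane) (hρ : ∀ v ∈ S, ρ v ∈ S) {v : Plane}
    (hv : v ∈ interior S) : ρ v ∈ interior S := by
  have h1 : ρ '' interior S ⊆ S := by
    rintro _ ⟨w, hw, rfl⟩
    exact hρ w (interior_subset hw)
  have h2 : IsOpen (ρ '' interior S) := ρ.toHomeomorph.isOpenMap _ isOpen_interior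
  exact interior_maximal h1 h2 ⟨v, hv, rfl⟩

/-- A velocity that solves the equations for `∇γ(k) = v` with `γ(k) = h`. -/
theorem mem_range_of_root (hω : 0 < ω) (ha : 0 < a) (hb : 0 < b) {v : Plane} {h ε₀ ε₁ : ℝ}
    (hh : 0 < h) (hε₀ : ε₀ ^ 2 = 1) (hε₁ : ε₁ ^ 2 = 1) (h0 : |v 0| * h ≤ a) (h1 : |v 1| * h ≤ b)
    (he : h ^ 2 - (ω ^ 2 + 2 * a + 2 * b) + 2 * ε₀ * Real.sqrt (a ^ 2 - (v 0 * h) ^ 2) +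
      2 * ε₁ * Real.sqrt (b ^ 2 - (v 1 * h) ^ 2) = 0) : v ∈ range (velocity ω a b) := by
  have key : ∀ {ε r a : ℝ}, ε ^ 2 = 1 → 0 < a → |r| * h ≤ a →
      (ε * Real.sqrt (a ^ 2 - (r * h) ^ 2) / a) ^ 2 + (r * h / a) ^ 2 = 1 := by
    intro ε r a hε ha h0
    have h2 : (r * h) ^ 2 ≤ a ^ 2 := by
      rw [sq_le_sq, abs_mul, abs_of_pos hh, abs_of_pos ha]
      exact h0
    rw [div_pow, mul_pow, Real.sq_sqrt (by linarith), hε]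
    field_simp
    ring
  obtain ⟨k, -, c0, s0, c1, s1⟩ := exists_mem_square (key hε₀ ha h0) (key hε₁ hb h1)
  have hd : disp ω a b k = h := by
    have h2 := disp_sq hω ha hb k
    rw [c0, c1] at h2
    have h3 : disp ω a b k ^ 2 = h ^ 2 := by
      rw [h2, mul_assoc 2 a, mul_assoc 2 b, mul_div_cancel₀ _ ha.ne', mul_div_cancel₀ _ hb.ne']
      linarith
    exact (sq_eq_sq₀ (disp_pos hω ha hb k).le hh.le).1 h3
  refine ⟨k, plane_ext ?_ ?_⟩
  · rw [velocity_zero, hd, s0]; field_simp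
  · rw [velocity_one, hd, s1]; field_simp

/-- Given v, the unknown h = γ(k) determines the sines, and the cosines up to signs, so v is a
velocity once the energy equation has a root h for some choice of signs. The hypothesis is an
inequality for the signs ++, and its strict version is an open condition on v. -/
theorem mem_range_of_le (hω : 0 < ω) (ha : 0 < a) (hb : 0 < b) {v : Plane} {g : ℝ} (hg : 0 < g)
    (h0 : |v 0| * g ≤ a) (h1 : |v 1| * g ≤ b)
    (he : 0 ≤ g ^ 2 - (ω ^ 2 + 2 * a + 2 * b) + 2 * Real.sqrt (a ^ 2 - (v 0 * g) ^ 2) +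
      2 * Real.sqrt (b ^ 2 - (v 1 * g) ^ 2)) : v ∈ range (velocity ω a b) := by
  have hω2 : 0 < ω ^ 2 := by positivity
  by_cases hv : v 0 = 0 ∧ v 1 = 0
  · refine ⟨0, plane_ext ?_ ?_⟩
    · rw [velocity_zero, hv.1]; simp
    · rw [velocity_one, hv.2]; simp
  set f : ℝ → ℝ → ℝ → ℝ := fun ε₀ ε₁ h => h ^ 2 - (ω ^ 2 + 2 * a + 2 * b) +
    2 * ε₀ * Real.sqrt (a ^ 2 - (v 0 * h) ^ 2) + 2 * ε₁ * Real.sqrt (b ^ 2 - (v 1 * h) ^ 2) with hf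
  have hfc : ∀ ε₀ ε₁, Continuous (f ε₀ ε₁) := fun ε₀ ε₁ => by
    simp only [hf]; fun_prop
  have hfg : 0 ≤ f 1 1 g := by simpa [hf] using he
  -- The largest h for which both sines are at most one in modulus; it exists because v ≠ 0.
  obtain ⟨G, hgG, hG0, hG1, hG⟩ : ∃ G, g ≤ G ∧ |v 0| * G ≤ a ∧ |v 1| * G ≤ b ∧
      (|v 0| * G = a ∨ |v 1| * G = b) := by
    rcases le_total (|v 0| * b) (|v 1| * a) with h | h
    · have hv1 : 0 < |v 1| := by
        rw [abs_pos]
        intro hv1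
        rw [hv1] at h
        simp only [abs_zero, zero_mul] at h
        have : |v 0| ≤ 0 := by by_contra! h'; nlinarith
        exact hv ⟨by simpa using this, hv1⟩
      refine ⟨b / |v 1|, (le_div_iff₀' hv1).2 h1, ?_, ?_, Or.inr ?_⟩
      · rw [mul_div_assoc', div_le_iff₀ hv1]; linarith
      · rw [mul_div_cancel₀ _ hv1.ne']
      · rw [mul_div_cancel₀ _ hv1.ne']
    · have hv0 : 0 < |v 0| := by
        rw [abs_pos]
        intro hv0
        rw [hv0] at h
        simp only [abs_zero, zero_mul] at h
        have : |v 1| ≤ 0 := by by_contra! h'; nlinarith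
        exact hv ⟨hv0, by simpa using this⟩
      refine ⟨a / |v 0|, (le_div_iff₀' hv0).2 h0, ?_, ?_, Or.inl ?_⟩
      · rw [mul_div_cancel₀ _ hv0.ne']
      · rw [mul_div_assoc', div_le_iff₀ hv0]; linarith
      · rw [mul_div_cancel₀ _ hv0.ne']
  have hGpos : 0 < G := hg.trans_le hgG
  have bound : ∀ {h}, h ≤ G → |v 0| * h ≤ a ∧ |v 1| * h ≤ b := fun hh =>
    ⟨(mul_le_mul_of_nonneg_left hh (abs_nonneg _)).trans hG0,
      (mul_le_mul_of_nonneg_left hh (abs_nonneg _)).trans hG1⟩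
  rcases le_or_gt (f 1 1 G) 0 with hG' | hG'
  · obtain ⟨h, hh, hh0⟩ := intermediate_value_Icc' hgG (hfc 1 1).continuousOn ⟨hG', hfg⟩
    exact mem_range_of_root hω ha hb (hg.trans_le hh.1) (one_pow 2) (one_pow 2) (bound hh.2).1
      (bound hh.2).2 hh0
  -- At `G` one square root vanishes, so flipping its sign keeps the value there positive, while the
  -- value at h = 0 becomes -ω² - 4a or -ω² - 4b. This yields a root below `G`.
  · have lower : ∀ ε₀ ε₁, ε₀ ^ 2 = 1 → ε₁ ^ 2 = 1 → f ε₀ ε₁ 0 < 0 → 0 ≤ f ε₀ ε₁ G →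
        v ∈ range (velocity ω a b) := by
      intro ε₀ ε₁ hε₀ hε₁ hneg hpos
      obtain ⟨h, hh, hh0⟩ := intermediate_value_Icc hGpos.le (hfc ε₀ ε₁).continuousOn
        ⟨hneg.le, hpos⟩
      have hhpos : 0 < h := by
        rcases hh.1.lt_or_eq with h' | h'
        · exact h'
        · rw [← h'] at hh0; exact absurd hh0 hneg.ne
      exact mem_range_of_root hω ha hb hhpos hε₀ hε₁ (bound hh.2).1 (bound hh.2).2 hh0
    rcases hG with h | h
    · refine lower (-1) 1 (by norm_num) (by norm_num) ?_ ?_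
      · simp only [hf, mul_zero]
        norm_num
        rw [Real.sqrt_sq ha.le, Real.sqrt_sq hb.le]
        linarith
      · have : a ^ 2 - (v 0 * G) ^ 2 = 0 := by
          rw [← h, mul_pow, mul_pow, sq_abs, sub_self]
        simp only [hf, this, Real.sqrt_zero, mul_zero] at hG' ⊢
        exact hG'.le
    · refine lower 1 (-1) (by norm_num) (by norm_num) ?_ ?_
      · simp only [hf, mul_zero]
        norm_num
        rw [Real.sqrt_sq ha.le, Real.sqrt_sq hb.le]
        linarith
      · have : b ^ 2 - (v 1 * G) ^ 2 = 0 := by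
          rw [← h, mul_pow, mul_pow, sq_abs, sub_self]
        simp only [hf, this, Real.sqrt_zero, mul_zero] at hG' ⊢
        exact hG'.le

theorem mem_interior_of_lt (hω : 0 < ω) (ha : 0 < a) (hb : 0 < b) {v : Plane} {g : ℝ} (hg : 0 < g)
    (h0 : |v 0| * g < a) (h1 : |v 1| * g < b)
    (he : 0 < g ^ 2 - (ω ^ 2 + 2 * a + 2 * b) + 2 * Real.sqrt (a ^ 2 - (v 0 * g) ^ 2) +
      2 * Real.sqrt (b ^ 2 - (v 1 * g) ^ 2)) : v ∈ interior (range (velocity ω a b)) := by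
  have hc0 := continuous_coord 0
  have hc1 := continuous_coord 1
  have hc : Continuous fun v : Plane => g ^ 2 - (ω ^ 2 + 2 * a + 2 * b) +
      2 * Real.sqrt (a ^ 2 - (v 0 * g) ^ 2) + 2 * Real.sqrt (b ^ 2 - (v 1 * g) ^ 2) := by fun_prop
  have hopen : IsOpen {v : Plane | (|v 0| * g < a ∧ |v 1| * g < b) ∧
      0 < g ^ 2 - (ω ^ 2 + 2 * a + 2 * b) + 2 * Real.sqrt (a ^ 2 - (v 0 * g) ^ 2) +
      2 * Real.sqrt (b ^ 2 - (v 1 * g) ^ 2)} := by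
    exact ((isOpen_lt (hc0.abs.mul continuous_const) continuous_const).inter
      (isOpen_lt (hc1.abs.mul continuous_const) continuous_const)).inter
      (isOpen_lt continuous_const hc)
  refine interior_maximal ?_ hopen ⟨⟨h0, h1⟩, he⟩
  rintro w ⟨⟨h2, h3⟩, h4⟩
  exact mem_range_of_le hω ha hb hg h2.le h3.le h4.le

theorem zero_mem_interior (hω : 0 < ω) (ha : 0 < a) (hb : 0 < b) :
    (0 : Plane) ∈ interior (range (velocity ω a b)) := by
  refine mem_interior_of_lt hω ha hb (g := ω ^ 2 + 1) (by positivity) (by simpa) (by simpa) ?_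
  simp only [PiLp.zero_apply, zero_mul]
  norm_num
  rw [Real.sqrt_sq ha.le, Real.sqrt_sq hb.le]
  nlinarith [sq_nonneg (ω ^ 2), pow_pos hω 2]

theorem abs_velocity_mul (hω : 0 < ω) (ha : 0 < a) (hb : 0 < b) (k : Plane) :
    velocity ω a b k 0 * disp ω a b k = a * Real.sin (k 0) ∧
      velocity ω a b k 1 * disp ω a b k = b * Real.sin (k 1) := by
  have := (disp_pos hω ha hb k).ne'
  rw [velocity_zero, velocity_one, div_mul_cancel₀ _ this, div_mul_cancel₀ _ this]
  exact ⟨rfl, rfl⟩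

theorem abs_sin_lt_one {θ : ℝ} (h : Real.cos θ ≠ 0) : |Real.sin θ| < 1 := by
  rw [← sq_lt_one_iff_abs_lt_one]
  have := Real.sin_sq_add_cos_sq θ
  have : 0 < Real.cos θ ^ 2 := by positivity
  linarith

/-- With the true signs of the cosines the energy equation holds at h = γ(k). Replacing a negative
cosine by its modulus makes the left side strictly positive. -/
theorem velocity_mem_interior_of_neg (hω : 0 < ω) (ha : 0 < a) (hb : 0 < b) {k : Plane}
    (hx : Real.cos (k 0) ≠ 0) (hy : Real.cos (k 1) ≠ 0)
    (hneg : Real.cos (k 0) < 0 ∨ Real.cos (k 1) < 0) :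
    velocity ω a b k ∈ interior (range (velocity ω a b)) := by
  have hd := disp_pos hω ha hb k
  obtain ⟨e0, e1⟩ := abs_velocity_mul hω ha hb k
  refine mem_interior_of_lt hω ha hb hd ?_ ?_ ?_
  · rw [← abs_of_pos hd, ← abs_mul, e0, abs_mul, abs_of_pos ha]
    nlinarith [abs_sin_lt_one hx]
  · rw [← abs_of_pos hd, ← abs_mul, e1, abs_mul, abs_of_pos hb]
    nlinarith [abs_sin_lt_one hy]
  · have h2 : a ^ 2 - (a * Real.sin (k 0)) ^ 2 = (a * |Real.cos (k 0)|) ^ 2 := by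
      rw [mul_pow, mul_pow, sq_abs, Real.cos_sq']; ring
    have h3 : b ^ 2 - (b * Real.sin (k 1)) ^ 2 = (b * |Real.cos (k 1)|) ^ 2 := by
      rw [mul_pow, mul_pow, sq_abs, Real.cos_sq']; ring
    rw [e0, e1, h2, h3, Real.sqrt_sq (by positivity), Real.sqrt_sq (by positivity),
      disp_sq hω ha hb]
    have p0 := le_abs_self (Real.cos (k 0))
    have p1 := le_abs_self (Real.cos (k 1))
    have q0 := mul_le_mul_of_nonneg_left p0 ha.le
    have q1 := mul_le_mul_of_nonneg_left p1 hb.le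
    rcases hneg with h | h
    · have : a * Real.cos (k 0) < a * |Real.cos (k 0)| :=
        mul_lt_mul_of_pos_left (h.trans_le (abs_nonneg _)) ha
      linarith
    · have : b * Real.cos (k 1) < b * |Real.cos (k 1)| :=
        mul_lt_mul_of_pos_left (h.trans_le (abs_nonneg _)) hb
      linarith

/-- Here both square roots vanish at h = γ(k), which is the largest admissible value, so a strict
inequality is sought at a slightly smaller h. -/
theorem velocity_mem_interior_of_zero (hω : 0 < ω) (ha : 0 < a) (hb : 0 < b) {k : Plane}
    (hx : Real.cos (k 0) = 0) (hy : Real.cos (k 1) = 0) :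
    velocity ω a b k ∈ interior (range (velocity ω a b)) := by
  have hd := disp_pos hω ha hb k
  have hd2 := disp_sq hω ha hb k
  rw [hx, hy] at hd2
  obtain ⟨e0, e1⟩ := abs_velocity_mul hω ha hb k
  have hω2 : 0 < ω ^ 2 := by positivity
  set M := ω ^ 2 + 2 * a + 2 * b with hM
  have hMpos : 0 < M := by positivity
  -- With h = γ √(1 - τ²) the expression equals 2(a + b)τ - Mτ², and this τ maximizes it.
  set τ := (a + b) / M with hτ
  have hτ0 : 0 < τ := by positivity
  have hτM : τ * M = a + b := by rw [hτ]; field_simp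
  have hτ1 : τ < 1 := by rw [hτ, div_lt_one hMpos]; linarith
  set l := Real.sqrt (1 - τ ^ 2) with hl
  have hl0 : 0 < l := Real.sqrt_pos.2 (by nlinarith)
  have hl2 : l ^ 2 = 1 - τ ^ 2 := Real.sq_sqrt (by nlinarith)
  have hl1 : l < 1 := by nlinarith
  have hs0 : Real.sin (k 0) ^ 2 = 1 := by rw [Real.sin_sq, hx]; ring
  have hs1 : Real.sin (k 1) ^ 2 = 1 := by rw [Real.sin_sq, hy]; ring
  have ha0 : |Real.sin (k 0)| = 1 := by rwa [← sq_eq_sq₀ (abs_nonneg _) zero_le_one, sq_abs, one_pow]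
  have ha1 : |Real.sin (k 1)| = 1 := by rwa [← sq_eq_sq₀ (abs_nonneg _) zero_le_one, sq_abs, one_pow]
  refine mem_interior_of_lt hω ha hb (mul_pos hd hl0) ?_ ?_ ?_
  · rw [← mul_assoc, ← abs_of_pos hd, ← abs_mul, e0, abs_mul, abs_of_pos ha, ha0]
    nlinarith
  · rw [← mul_assoc, ← abs_of_pos hd, ← abs_mul, e1, abs_mul, abs_of_pos hb, ha1]
    nlinarith
  · have h2 : a ^ 2 - (a * Real.sin (k 0) * l) ^ 2 = (a * τ) ^ 2 := by
      rw [mul_pow, mul_pow, mul_pow, hs0, hl2]; ring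
    have h3 : b ^ 2 - (b * Real.sin (k 1) * l) ^ 2 = (b * τ) ^ 2 := by
      rw [mul_pow, mul_pow, mul_pow, hs1, hl2]; ring
    rw [← mul_assoc, ← mul_assoc, e0, e1, h2, h3, Real.sqrt_sq (by positivity),
      Real.sqrt_sq (by positivity), mul_pow, hd2, hl2]
    have h5 : (M - 2 * a * 0 - 2 * b * 0) * (1 - τ ^ 2) - M + 2 * (a * τ) + 2 * (b * τ) =
      (a + b) * τ + (a + b - τ * M) * τ := by ring
    rw [h5, hτM]
    have : 0 < (a + b) * τ := by positivity
    linarith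

/-- The inverse function theorem: the velocity maps neighbourhoods of k onto neighbourhoods of its
value. -/
theorem velocity_mem_interior_of_det_ne_zero (hω : 0 < ω) (ha : 0 < a) (hb : 0 < b) {k : Plane}
    (h : (hessian (disp ω a b) k).det ≠ 0) :
    velocity ω a b k ∈ interior (range (velocity ω a b)) := by
  have h1 := hessian_disp hω ha hb k
  rw [← ContinuousLinearMap.coe_toContinuousLinearEquivOfDetNeZero _ h] at h1
  have h2 := h1.map_nhds_eq_of_equiv
  rw [mem_interior_iff_mem_nhds, ← h2]
  exact Filter.range_mem_map

end image

end LatticeVelocity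

/-! ### Degenerate points: the inner and the outer branch. -/

namespace LatticeVelocity

section critical

variable {ω a b : ℝ}

theorem two_mul_add_lt (hω : 0 < ω) : 2 * a + 2 * b < ω ^ 2 + 2 * a + 2 * b := by
  have : 0 < ω ^ 2 := by positivity
  linarith

/-- The equation of the points at which the Hessian is degenerate. -/
theorem critical_relation (hω : 0 < ω) (ha : 0 < a) (hb : 0 < b) {k ξ : Plane} (hξ : ξ ≠ 0)
    (h : hessian (disp ω a b) k ξ = 0) :
    Real.cos (k 0) * Real.cos (k 1) *
      (ω ^ 2 + 2 * a + 2 * b - a * Real.cos (k 0) - b * Real.cos (k 1)) =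
      b * Real.cos (k 0) + a * Real.cos (k 1) := by
  obtain ⟨e0, e1⟩ := (hessian_eq_zero_iff hω ha hb k ξ).1 h
  obtain ⟨m0, m1⟩ := abs_velocity_mul hω ha hb k
  have hd2 := disp_sq hω ha hb k
  have hd := disp_pos hω ha hb k
  have hs0 := Real.sin_sq (k 0)
  have hs1 := Real.sin_sq (k 1)
  set x := Real.cos (k 0)
  set y := Real.cos (k 1)
  set v := velocity ω a b k 0
  set w := velocity ω a b k 1
  set g := disp ω a b k
  have hdet : (a * x - v ^ 2) * (b * y - w ^ 2) - (v * w) ^ 2 = 0 := by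
    have h0 : ((a * x - v ^ 2) * (b * y - w ^ 2) - (v * w) ^ 2) * ξ 0 = 0 := by
      linear_combination (b * y - w ^ 2) * e0 + v * w * e1
    have h1 : ((a * x - v ^ 2) * (b * y - w ^ 2) - (v * w) ^ 2) * ξ 1 = 0 := by
      linear_combination (a * x - v ^ 2) * e1 + v * w * e0
    by_contra hne
    apply hξ
    exact plane_ext ((mul_eq_zero.1 h0).resolve_left hne) ((mul_eq_zero.1 h1).resolve_left hne)
  have hv : v ^ 2 * g ^ 2 = a ^ 2 * (1 - x ^ 2) := by rw [← hs0, ← mul_pow, m0]; ring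
  have hw : w ^ 2 * g ^ 2 = b ^ 2 * (1 - y ^ 2) := by rw [← hs1, ← mul_pow, m1]; ring
  have hab : a * b ≠ 0 := (mul_pos ha hb).ne'
  apply mul_left_cancel₀ hab
  linear_combination g ^ 2 * hdet + b * y * hv + a * x * hw - a * b * x * y * hd2

/-- A degenerate point with positive cosines. -/
def IsOuterCritical (ω a b : ℝ) (k : Plane) : Prop :=
  0 < Real.cos (k 0) ∧ 0 < Real.cos (k 1) ∧ Real.cos (k 0) * Real.cos (k 1) *
      (ω ^ 2 + 2 * a + 2 * b - a * Real.cos (k 0) - b * Real.cos (k 1)) =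
      b * Real.cos (k 0) + a * Real.cos (k 1)

/-- A point of the inner critical curve with parameter `m`. -/
def IsInnerCritical (ω a b m : ℝ) (k : Plane) : Prop :=
  m ∈ Icc (critStart a b (ω ^ 2 + 2 * a + 2 * b)) (critStart b a (ω ^ 2 + 2 * a + 2 * b))⁻¹ ∧
    Real.cos (k 0) = critX a b (ω ^ 2 + 2 * a + 2 * b) m ∧
    Real.cos (k 1) = critY a b (ω ^ 2 + 2 * a + 2 * b) m

/-- For xy < 0 the parameter is m = -y/x, and the critical equation identifies the discriminant with
(M - 2ax - 2by)². At x = y = 0 this ratio is undefined and m = b/a takes its place. -/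
theorem exists_crit_param {M x y : ℝ} (ha : 0 < a) (hb : 0 < b) (hM : 2 * a + 2 * b < M)
    (hx : x ∈ Icc (-1 : ℝ) 1) (hy : y ∈ Icc (-1 : ℝ) 1) (hxy : x * y < 0 ∨ (x = 0 ∧ y = 0))
    (h : x * y * (M - a * x - b * y) = b * x + a * y) :
    ∃ m ∈ Icc (critStart a b M) (critStart b a M)⁻¹, x = critX a b M m ∧ y = critY a b M m := by
  have suff : ∀ m, 0 < m → x = critX a b M m → y = -m * x →
      ∃ m ∈ Icc (critStart a b M) (critStart b a M)⁻¹, x = critX a b M m ∧ y = critY a b M m := by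
    intro m hm h1 h2
    have h3 : y = critY a b M m := by rw [critY_eq hm, ← h1, h2]
    exact ⟨m, ⟨(neg_one_le_critX_iff ha hb hM hm).1 (h1 ▸ hx.1),
      (neg_one_le_critY_iff ha hb hM hm).1 (h3 ▸ hy.1)⟩, h1, h3⟩
  rcases hxy with hxy | ⟨rfl, rfl⟩
  · have hx0 : x ≠ 0 := by rintro rfl; simp at hxy
    have hy0 : y ≠ 0 := by rintro rfl; simp at hxy
    have hm : 0 < -y / x := by
      have : -y / x = -(x * y) / x ^ 2 := by field_simp
      rw [this]
      have : 0 < x ^ 2 := by positivity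
      exact div_pos (by linarith) this
    refine suff (-y / x) hm ?_ (by field_simp)
    have ax : a * x ≤ a := by nlinarith [hx.2]
    have bY : b * y ≤ b := by nlinarith [hy.2]
    have hDpos : 0 < M - 2 * a * x - 2 * b * y := by nlinarith
    have hD : critD a b M (-y / x) = M - 2 * a * x - 2 * b * y := by
      refine (sq_eq_sq₀ (Real.sqrt_nonneg _) hDpos.le).1 ?_
      rw [← critD, critD_sq ha hb hM hm]
      have : (-y / x) + (-y / x)⁻¹ = -(x ^ 2 + y ^ 2) / (x * y) := by field_simp; ring
      rw [this]
      field_simp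
      linear_combination (4 * (a * x + b * y)) * h
    have hden : M - a * x - b * y ≠ 0 := by nlinarith
    rw [critX, hD, eq_div_iff (by intro h0; apply hden; linarith)]
    rw [show (-y / x)⁻¹ = -x / y by field_simp]
    field_simp
    linear_combination 2 * h
  · have hm : 0 < b / a := by positivity
    exact suff (b / a) hm ((critX_eq_zero_iff ha hb hM hm).2 rfl).symm (by simp)

/-- Because M - ax - by > 0, two negative cosines would give the sides of the equation opposite
signs, and one vanishing cosine forces the other to vanish. -/
theorem critical_cases (hω : 0 < ω) (ha : 0 < a) (hb : 0 < b) {k ξ : Plane} (hξ : ξ ≠ 0)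
    (h : hessian (disp ω a b) k ξ = 0) :
    IsOuterCritical ω a b k ∨ ∃ m, IsInnerCritical ω a b m k := by
  have hrel := critical_relation hω ha hb hξ h
  have hx : Real.cos (k 0) ∈ Icc (-1 : ℝ) 1 := ⟨Real.neg_one_le_cos _, Real.cos_le_one _⟩
  have hy : Real.cos (k 1) ∈ Icc (-1 : ℝ) 1 := ⟨Real.neg_one_le_cos _, Real.cos_le_one _⟩
  by_cases hpos : 0 < Real.cos (k 0) ∧ 0 < Real.cos (k 1)
  · exact Or.inl ⟨hpos.1, hpos.2, hrel⟩
  right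
  have hM := two_mul_add_lt (a := a) (b := b) hω
  suffices hs : Real.cos (k 0) * Real.cos (k 1) < 0 ∨ (Real.cos (k 0) = 0 ∧ Real.cos (k 1) = 0) by
    obtain ⟨m, hm, h1, h2⟩ := exists_crit_param ha hb hM hx hy hs hrel
    exact ⟨m, hm, h1, h2⟩
  set x := Real.cos (k 0)
  set y := Real.cos (k 1)
  have hden : 0 < ω ^ 2 + 2 * a + 2 * b - a * x - b * y := by nlinarith [hx.2, hy.2]
  rcases lt_trichotomy x 0 with h1 | h1 | h1
  · rcases lt_trichotomy y 0 with h2 | h2 | h2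
    · have := mul_pos (mul_pos_of_neg_of_neg h1 h2) hden
      nlinarith
    · rw [h2] at hrel
      nlinarith
    · left; exact mul_neg_of_neg_of_pos h1 h2
  · right
    rw [h1] at hrel
    refine ⟨h1, ?_⟩
    have : a * y = 0 := by linarith
    exact (mul_eq_zero.1 this).resolve_left ha.ne'
  · rcases lt_trichotomy y 0 with h2 | h2 | h2
    · left; exact mul_neg_of_pos_of_neg h1 h2
    · rw [h2] at hrel
      nlinarith
    · exact absurd ⟨h1, h2⟩ hpos

namespace IsInnerCritical

variable {m : ℝ} {k : Plane}

theorem pos (ha : 0 < a) (hb : 0 < b) (hω : 0 < ω) (h : IsInnerCritical ω a b m k) : 0 < m :=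
  (critStart_spec ha hb (two_mul_add_lt hω)).1.trans_le h.1.1

theorem disp_sq_eq (ha : 0 < a) (hb : 0 < b) (hω : 0 < ω) (h : IsInnerCritical ω a b m k) :
    disp ω a b k ^ 2 = critD a b (ω ^ 2 + 2 * a + 2 * b) m := by
  rw [disp_sq hω ha hb, critD_eq ha hb (two_mul_add_lt hω) (h.pos ha hb hω), h.2.1, h.2.2]

theorem abs_velocity (ha : 0 < a) (hb : 0 < b) (hω : 0 < ω) (h : IsInnerCritical ω a b m k) :
    |velocity ω a b k 0| = critV a b (ω ^ 2 + 2 * a + 2 * b) m ∧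
      |velocity ω a b k 1| = critW a b (ω ^ 2 + 2 * a + 2 * b) m := by
  have hd := disp_pos hω ha hb k
  have hq : Real.sqrt (critD a b (ω ^ 2 + 2 * a + 2 * b) m) = disp ω a b k := by
    rw [← h.disp_sq_eq ha hb hω, Real.sqrt_sq hd.le]
  constructor
  · rw [velocity_zero, critV, hq, ← h.2.1, ← Real.sin_sq, Real.sqrt_sq_eq_abs, abs_div, abs_mul,
      abs_of_pos ha, abs_of_pos hd]
  · rw [velocity_one, critW, critV, critD_swap, hq, ← critY, ← h.2.2, ← Real.sin_sq,
      Real.sqrt_sq_eq_abs, abs_div, abs_mul, abs_of_pos hb, abs_of_pos hd]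

theorem velocity_mem_interior (ha : 0 < a) (hb : 0 < b) (hω : 0 < ω)
    (h : IsInnerCritical ω a b m k) : velocity ω a b k ∈ interior (range (velocity ω a b)) := by
  have hm := h.pos ha hb hω
  have hy : Real.cos (k 1) = -m * Real.cos (k 0) := by rw [h.2.1, h.2.2, critY_eq hm]
  rcases lt_trichotomy (Real.cos (k 0)) 0 with h1 | h1 | h1
  · refine velocity_mem_interior_of_neg hω ha hb h1.ne ?_ (Or.inl h1)
    rw [hy]; nlinarith
  · exact velocity_mem_interior_of_zero hω ha hb h1 (by rw [hy, h1, mul_zero])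
  · have h2 : Real.cos (k 1) < 0 := by rw [hy]; nlinarith
    exact velocity_mem_interior_of_neg hω ha hb h1.ne' h2.ne (Or.inr h2)

theorem sin_rel (ha : 0 < a) (hb : 0 < b) (hω : 0 < ω) (h : IsInnerCritical ω a b m k) :
    b * Real.sin (k 1) ^ 2 - a * m * Real.sin (k 0) ^ 2 =
      -(m * Real.cos (k 0) * disp ω a b k ^ 2) := by
  have := crit_rel ha hb (two_mul_add_lt hω) (h.pos ha hb hω)
  rwa [← h.2.1, ← h.2.2, ← h.disp_sq_eq ha hb hω, ← Real.sin_sq, ← Real.sin_sq] at this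

theorem critE_eq (h : IsInnerCritical ω a b m k) : critE a b (ω ^ 2 + 2 * a + 2 * b) m =
    b * Real.sin (k 1) ^ 4 - a * m ^ 3 * Real.sin (k 0) ^ 4 := by
  rw [critE, ← h.2.1, ← h.2.2, ← Real.sin_sq, ← Real.sin_sq]
  ring

/-- The kernel of the Hessian at a point of the inner critical curve. -/
theorem exists_kernel (ha : 0 < a) (hb : 0 < b) (hω : 0 < ω) (h : IsInnerCritical ω a b m k) :
    ∃ ξ, ξ ≠ 0 ∧ hessian (disp ω a b) k ξ = 0 ∧
      disp ω a b k * thirdDirDeriv (disp ω a b) ξ k =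
        -critE a b (ω ^ 2 + 2 * a + 2 * b) m := by
  have hm := h.pos ha hb hω
  have hd := disp_pos hω ha hb k
  have hs := h.sin_rel ha hb hω
  have hy : Real.cos (k 1) = -m * Real.cos (k 0) := by rw [h.2.1, h.2.2, critY_eq hm]
  -- The vector (tan k₁, tan k₂) multiplied by cos k₂ = -m cos k₁; this form remains valid where
  -- both cosines vanish.
  set ξ : Plane := !₂[-m * Real.sin (k 0), Real.sin (k 1)] with hξ
  have x0 : ξ 0 = -m * Real.sin (k 0) := by simp [hξ]
  have x1 : ξ 1 = Real.sin (k 1) := by simp [hξ]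
  have hl : velocity ω a b k 0 * ξ 0 + velocity ω a b k 1 * ξ 1 =
      -(m * Real.cos (k 0) * disp ω a b k) := by
    rw [velocity_zero, velocity_one, x0, x1]
    field_simp
    linear_combination hs
  have hker : hessian (disp ω a b) k ξ = 0 := by
    rw [hessian_eq_zero_iff hω ha hb, hl, x0, x1, velocity_zero, velocity_one, hy]
    constructor
    · field_simp
    · field_simp
  refine ⟨ξ, ?_, hker, ?_⟩
  · intro h0
    rw [h0, PiLp.zero_apply] at x0 x1
    have s1 : Real.sin (k 1) = 0 := x1.symm
    have s0 : Real.sin (k 0) = 0 := by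
      rcases mul_eq_zero.1 x0.symm with h' | h'
      · linarith
      · exact h'
    rw [s0, s1] at hs
    have hc : Real.cos (k 0) = 0 := by
      have : m * Real.cos (k 0) * disp ω a b k ^ 2 = 0 := by linarith
      have hd' : disp ω a b k ^ 2 ≠ 0 := by positivity
      exact (mul_eq_zero.1 ((mul_eq_zero.1 this).resolve_right hd')).resolve_left hm.ne'
    have := Real.sin_sq_add_cos_sq (k 0)
    rw [s0, hc] at this
    norm_num at this
  · rw [thirdDirDeriv_disp hω ha hb hker, h.critE_eq, x0, x1]
    ring

theorem critE_eq_zero (ha : 0 < a) (hb : 0 < b) (hω : 0 < ω) (h : IsInnerCritical ω a b m k)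
    {ξ : Plane} (hξ : ξ ≠ 0) (hker : hessian (disp ω a b) k ξ = 0)
    (hthird : thirdDirDeriv (disp ω a b) ξ k = 0) : critE a b (ω ^ 2 + 2 * a + 2 * b) m = 0 := by
  have hm := h.pos ha hb hω
  have hd := disp_pos hω ha hb k
  have hs := h.sin_rel ha hb hω
  have hy : Real.cos (k 1) = -m * Real.cos (k 0) := by rw [h.2.1, h.2.2, critY_eq hm]
  have h3 := thirdDirDeriv_disp hω ha hb hker
  rw [hthird, mul_zero] at h3
  obtain ⟨e0, e1⟩ := (hessian_eq_zero_iff hω ha hb k ξ).1 hker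
  obtain ⟨m0, m1⟩ := abs_velocity_mul hω ha hb k
  rw [h.critE_eq]
  have sc0 := Real.sin_sq_add_cos_sq (k 0)
  have sc1 := Real.sin_sq_add_cos_sq (k 1)
  set s := Real.sin (k 0)
  set t := Real.sin (k 1)
  set x := Real.cos (k 0)
  set g := disp ω a b k
  set v := velocity ω a b k 0
  set w := velocity ω a b k 1
  rw [hy] at e1 sc1
  -- Every kernel vector is parallel to (-m sin k₁, sin k₂). For x ≠ 0 this follows by eliminating
  -- v·ξ from the two kernel equations. For x = 0 the kernel is the orthogonal complement of v, the
  -- sines are ±1 and b = am.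
  have hcross : t * ξ 0 = -(m * s * ξ 1) := by
    by_cases hx : x = 0
    · rw [hx] at e0 hs sc0 sc1
      have hs2 : s ^ 2 = 1 := by linarith
      have ht2 : t ^ 2 = 1 := by linarith
      have hbm : b = a * m := by rw [hs2, ht2] at hs; linarith
      have hv : v ≠ 0 := by
        intro hv
        rw [hv, zero_mul] at m0
        have : s = 0 := (mul_eq_zero.1 m0.symm).resolve_left ha.ne'
        rw [this] at hs2; norm_num at hs2
      have hl : v * ξ 0 + w * ξ 1 = 0 := by
        have : (v * ξ 0 + w * ξ 1) * v = 0 := by linarith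
        exact (mul_eq_zero.1 this).resolve_right hv
      have hl' : a * s * ξ 0 + b * t * ξ 1 = 0 := by
        rw [← m0, ← m1]; linear_combination g * hl
      rw [hbm] at hl'
      have : a * (s * ξ 0 + m * t * ξ 1) = 0 := by linear_combination hl'
      have h5 := (mul_eq_zero.1 this).resolve_left ha.ne'
      linear_combination s * t * h5 - t * ξ 0 * hs2 - m * s * ξ 1 * ht2
    · have f0 : g * x * ξ 0 = (v * ξ 0 + w * ξ 1) * s := by
        apply mul_left_cancel₀ ha.ne'
        linear_combination g * e0 + (v * ξ 0 + w * ξ 1) * m0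
      have f1 : -(g * m * x * ξ 1) = (v * ξ 0 + w * ξ 1) * t := by
        apply mul_left_cancel₀ hb.ne'
        linear_combination g * e1 + (v * ξ 0 + w * ξ 1) * m1
      have hgx : g * x ≠ 0 := mul_ne_zero hd.ne' hx
      apply mul_left_cancel₀ hgx
      linear_combination t * f0 - s * f1
  by_cases hξ1 : ξ 1 = 0
  · have hξ0 : ξ 0 ≠ 0 := fun h0 => hξ (plane_ext h0 hξ1)
    rw [hξ1] at hcross h3
    have ht : t = 0 := by
      have : t * ξ 0 = 0 := by rw [hcross]; ring
      exact (mul_eq_zero.1 this).resolve_right hξ0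
    have hs0 : s = 0 := by
      have : a * s * ξ 0 ^ 3 = 0 := by linear_combination h3
      exact (mul_eq_zero.1 ((mul_eq_zero.1 this).resolve_right (pow_ne_zero 3 hξ0))).resolve_left
        ha.ne'
    rw [ht, hs0]; ring
  · have : ξ 1 ^ 3 * (b * t ^ 4 - a * m ^ 3 * s ^ 4) = 0 := by
      have h6 : (t * ξ 0) ^ 3 = (-(m * s * ξ 1)) ^ 3 := by rw [hcross]
      linear_combination (t ^ 3) * h3 - a * s * h6
    exact (mul_eq_zero.1 this).resolve_left (pow_ne_zero 3 hξ1)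

end IsInnerCritical

/-- Each velocity with the right absolute values comes from the inner critical curve. -/
theorem exists_isInnerCritical (hω : 0 < ω) (ha : 0 < a) (hb : 0 < b) {m : ℝ}
    (hm : m ∈ Icc (critStart a b (ω ^ 2 + 2 * a + 2 * b)) (critStart b a (ω ^ 2 + 2 * a + 2 * b))⁻¹)
    {v : Plane} (h0 : |v 0| = critV a b (ω ^ 2 + 2 * a + 2 * b) m)
    (h1 : |v 1| = critW a b (ω ^ 2 + 2 * a + 2 * b) m) :
    ∃ k ∈ square, IsInnerCritical ω a b m k ∧ velocity ω a b k = v := by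
  have hM := two_mul_add_lt (a := a) (b := b) hω
  set M := ω ^ 2 + 2 * a + 2 * b with hMdef
  have hm0 : 0 < m := (critStart_spec ha hb hM).1.trans_le hm.1
  obtain ⟨ε₀, hε₀, e0⟩ := exists_sign (v 0)
  obtain ⟨ε₁, hε₁, e1⟩ := exists_sign (v 1)
  have unit : ∀ {ε c : ℝ}, |ε| = 1 → -1 ≤ c → c ≤ 1 →
      c ^ 2 + (ε * Real.sqrt (1 - c ^ 2)) ^ 2 = 1 := by
    intro ε c hε hc1 hc2
    rw [mul_pow, ← sq_abs ε, hε, Real.sq_sqrt (by nlinarith)]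
    ring
  obtain ⟨k, hk, c0, s0, c1, s1⟩ := exists_mem_square
    (unit hε₀ ((neg_one_le_critX_iff ha hb hM hm0).2 hm.1) (critX_lt_one ha hb hM hm0).le)
    (unit hε₁ ((neg_one_le_critY_iff ha hb hM hm0).2 hm.2) (critY_lt_one ha hb hM hm0).le)
  have hk' : IsInnerCritical ω a b m k := ⟨hm, c0, c1⟩
  have hd := disp_pos hω ha hb k
  have hq : Real.sqrt (critD a b M m) = disp ω a b k := by
    rw [← hk'.disp_sq_eq ha hb hω, Real.sqrt_sq hd.le]
  refine ⟨k, hk, hk', plane_ext ?_ ?_⟩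
  · rw [velocity_zero, e0, h0, s0, critV, hq]; ring
  · rw [velocity_one, e1, h1, s1, critW, critV, critD_swap, hq, ← critY]; ring

namespace IsOuterCritical

variable {k : Plane}

theorem disp_sq_eq (ha : 0 < a) (hb : 0 < b) (hω : 0 < ω) (h : IsOuterCritical ω a b k) :
    disp ω a b k ^ 2 = a * (Real.sin (k 0) ^ 2 / Real.cos (k 0)) +
      b * (Real.sin (k 1) ^ 2 / Real.cos (k 1)) := by
  obtain ⟨hx, hy, hrel⟩ := h
  rw [disp_sq hω ha hb, Real.sin_sq, Real.sin_sq]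
  field_simp
  linear_combination hrel

theorem exists_kernel (ha : 0 < a) (hb : 0 < b) (hω : 0 < ω) (h : IsOuterCritical ω a b k) :
    ∃ ξ, ξ ≠ 0 ∧ hessian (disp ω a b) k ξ = 0 := by
  have hd := disp_pos hω ha hb k
  have hd2 := h.disp_sq_eq ha hb hω
  obtain ⟨hx, hy, -⟩ := h
  set ξ : Plane := !₂[Real.sin (k 0) / Real.cos (k 0), Real.sin (k 1) / Real.cos (k 1)] with hξ
  have x0 : ξ 0 = Real.sin (k 0) / Real.cos (k 0) := by simp [hξ]
  have x1 : ξ 1 = Real.sin (k 1) / Real.cos (k 1) := by simp [hξ]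
  have hl : velocity ω a b k 0 * ξ 0 + velocity ω a b k 1 * ξ 1 = disp ω a b k := by
    rw [velocity_zero, velocity_one, x0, x1, div_mul_eq_mul_div, div_mul_eq_mul_div, ← add_div,
      div_eq_iff hd.ne', ← sq, hd2]
    ring
  refine ⟨ξ, ?_, ?_⟩
  · intro h0
    rw [h0] at hl
    simp at hl
    exact hd.ne hl
  · rw [hessian_eq_zero_iff hω ha hb, hl, x0, x1, velocity_zero, velocity_one]
    constructor
    · field_simp
    · field_simp

/-- The kernel equations give γ cos kᵢ ξᵢ = (v·ξ) sin kᵢ. So v·ξ times the cubic form is a positive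
combination of the fourth powers ξᵢ⁴, and it vanishes only for ξ = 0. -/
theorem third_ne_zero (ha : 0 < a) (hb : 0 < b) (hω : 0 < ω) (h : IsOuterCritical ω a b k)
    {ξ : Plane} (hξ : ξ ≠ 0) (hker : hessian (disp ω a b) k ξ = 0) :
    thirdDirDeriv (disp ω a b) ξ k ≠ 0 := by
  intro hthird
  have hd := disp_pos hω ha hb k
  obtain ⟨hx, hy, -⟩ := h
  have h3 := thirdDirDeriv_disp hω ha hb hker
  rw [hthird, mul_zero] at h3
  obtain ⟨e0, e1⟩ := (hessian_eq_zero_iff hω ha hb k ξ).1 hker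
  obtain ⟨m0, m1⟩ := abs_velocity_mul hω ha hb k
  set s := Real.sin (k 0)
  set t := Real.sin (k 1)
  set x := Real.cos (k 0)
  set y := Real.cos (k 1)
  set g := disp ω a b k
  set l := velocity ω a b k 0 * ξ 0 + velocity ω a b k 1 * ξ 1
  have f0 : g * x * ξ 0 = l * s := by
    apply mul_left_cancel₀ ha.ne'
    linear_combination g * e0 + l * m0
  have f1 : g * y * ξ 1 = l * t := by
    apply mul_left_cancel₀ hb.ne'
    linear_combination g * e1 + l * m1
  have hA : l * (a * s * ξ 0 ^ 3) = a * (g * x) * ξ 0 ^ 4 := by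
    linear_combination (-a * ξ 0 ^ 3) * f0
  have hB : l * (b * t * ξ 1 ^ 3) = b * (g * y) * ξ 1 ^ 4 := by
    linear_combination (-b * ξ 1 ^ 3) * f1
  have hsum : a * (g * x) * ξ 0 ^ 4 + b * (g * y) * ξ 1 ^ 4 = 0 := by
    rw [← hA, ← hB]; linear_combination l * h3
  have p0 : 0 ≤ a * (g * x) * ξ 0 ^ 4 := by positivity
  have p1 : 0 ≤ b * (g * y) * ξ 1 ^ 4 := by positivity
  have q0 : a * (g * x) * ξ 0 ^ 4 = 0 := by linarith
  have q1 : b * (g * y) * ξ 1 ^ 4 = 0 := by linarith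
  have c0 : a * (g * x) ≠ 0 := by positivity
  have c1 : b * (g * y) ≠ 0 := by positivity
  exact hξ (plane_ext (pow_eq_zero_iff (by norm_num) |>.1 ((mul_eq_zero.1 q0).resolve_left c0))
    (pow_eq_zero_iff (by norm_num) |>.1 ((mul_eq_zero.1 q1).resolve_left c1)))

/-- The supporting line at the velocity of an outer critical point. -/
theorem support (ha : 0 < a) (hb : 0 < b) (hω : 0 < ω) (h : IsOuterCritical ω a b k) :
    ∃ l : Plane →L[ℝ] ℝ, 0 < l (velocity ω a b k) ∧
      ∀ w ∈ range (velocity ω a b), l w ≤ l (velocity ω a b k) := by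
  have hd := disp_pos hω ha hb k
  have hd2 := h.disp_sq_eq ha hb hω
  obtain ⟨hx, hy, hrel⟩ := h
  set T₀ := Real.sin (k 0) / Real.cos (k 0) with hT₀
  set T₁ := Real.sin (k 1) / Real.cos (k 1) with hT₁
  set l : Plane →L[ℝ] ℝ := T₀ • (EuclideanSpace.proj (𝕜 := ℝ) 0 : Plane →L[ℝ] ℝ) +
      T₁ • (EuclideanSpace.proj (𝕜 := ℝ) 1 : Plane →L[ℝ] ℝ) with hl
  have lapp : ∀ w : Plane, l w = T₀ * w 0 + T₁ * w 1 := fun w => by simp [hl]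
  have lk : l (velocity ω a b k) = disp ω a b k := by
    rw [lapp, velocity_zero, velocity_one, mul_div_assoc', mul_div_assoc', ← add_div,
      div_eq_iff hd.ne', ← sq, hd2]
    ring
  refine ⟨l, lk ▸ hd, ?_⟩
  rintro _ ⟨k', rfl⟩
  have hd' := disp_pos hω ha hb k'
  have hd2' := disp_sq hω ha hb k'
  rw [lk, lapp, velocity_zero, velocity_one, mul_div_assoc', mul_div_assoc', ← add_div,
    div_le_iff₀ hd']
  refine le_of_sq_le_sq ?_ (by positivity)
  have hs0 := Real.sin_sq (k 0)
  have hs1 := Real.sin_sq (k 1)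
  have hs0' := Real.sin_sq (k' 0)
  have hs1' := Real.sin_sq (k' 1)
  set x := Real.cos (k 0)
  set y := Real.cos (k 1)
  set x' := Real.cos (k' 0)
  set y' := Real.cos (k' 1)
  set s := Real.sin (k 0)
  set t := Real.sin (k 1)
  set s' := Real.sin (k' 0)
  set t' := Real.sin (k' 1)
  -- The outer relation turns γ(k')² into the weighted sum of squares of the sines, with weights a/x
  -- and b/y, plus squares of the differences of cosines. Cauchy–Schwarz with these weights then
  -- bounds the functional by γ(k) γ(k').
  have hd2'' : disp ω a b k' ^ 2 = a * ((s' ^ 2 + (x - x') ^ 2) / x) +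
      b * ((t' ^ 2 + (y - y') ^ 2) / y) := by
    rw [hd2', hs0', hs1']
    field_simp
    linear_combination hrel
  rw [mul_pow, hd2, hd2'']
  have hcs : (T₀ * (a * s') + T₁ * (b * t')) ^ 2 ≤
      (a * (s ^ 2 / x) + b * (t ^ 2 / y)) * (a * (s' ^ 2 / x) + b * (t' ^ 2 / y)) := by
    have : (a * (s ^ 2 / x) + b * (t ^ 2 / y)) * (a * (s' ^ 2 / x) + b * (t' ^ 2 / y)) -
        (T₀ * (a * s') + T₁ * (b * t')) ^ 2 = a * b * (s * t' - t * s') ^ 2 / (x * y) := by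
      rw [hT₀, hT₁]
      field_simp
      ring
    have h2 : 0 ≤ a * b * (s * t' - t * s') ^ 2 / (x * y) := by positivity
    linarith
  refine hcs.trans ?_
  gcongr
  · nlinarith [sq_nonneg (x - x')]
  · nlinarith [sq_nonneg (y - y')]

end IsOuterCritical

end critical

end LatticeVelocity

/-! ### The sets V₀, V₁, V₂, V₃ and the two curves. -/

namespace LatticeVelocity

theorem mem_range_rectCorner {c d : ℝ} (hc : 0 ≤ c) (hd : 0 ≤ d) (v : Plane) :
    v ∈ range (rectCorner c d) ↔ |v 0| = c ∧ |v 1| = d := by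
  constructor
  · rintro ⟨i, rfl⟩
    fin_cases i <;> simp [rectCorner, abs_of_nonneg hc, abs_of_nonneg hd]
  · rintro ⟨h0, h1⟩
    rcases (abs_eq hc).1 h0 with h0 | h0 <;> rcases (abs_eq hd).1 h1 with h1 | h1
    · exact ⟨0, plane_ext (by simp [rectCorner, h0]) (by simp [rectCorner, h1])⟩
    · exact ⟨3, plane_ext (by simp [rectCorner, h0]) (by simp [rectCorner, h1])⟩
    · exact ⟨1, plane_ext (by simp [rectCorner, h0]) (by simp [rectCorner, h1])⟩
    · exact ⟨2, plane_ext (by simp [rectCorner, h0]) (by simp [rectCorner, h1])⟩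

section

variable {ω a b : ℝ}

/-- The velocities at the inner critical points form an astroid. -/
theorem exists_astroid (hω : 0 < ω) (ha : 0 < a) (hb : 0 < b) :
    ∃ (c d σ : ℝ) (φ ψ : ℝ → ℝ), ArcPair c d σ φ ψ ∧
      (∀ m k, IsInnerCritical ω a b m k → velocity ω a b k ∈ astroid c d φ ψ) ∧
      (∀ v ∈ astroid c d φ ψ, ∃ k ∈ square, ∃ m, IsInnerCritical ω a b m k ∧
        velocity ω a b k = v) ∧
      (∀ m k, IsInnerCritical ω a b m k → critE a b (ω ^ 2 + 2 * a + 2 * b) m = 0 →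
        velocity ω a b k ∈ range (rectCorner c d)) ∧
      (∀ v ∈ range (rectCorner c d), ∃ k ∈ square, ∃ m, IsInnerCritical ω a b m k ∧
        critE a b (ω ^ 2 + 2 * a + 2 * b) m = 0 ∧ velocity ω a b k = v) := by
  obtain ⟨q, hpq, hqr, hq0, huniq, φ, ψ, hA, hφ1, hφ2, hφ3, hψ1, hψ2, hψ3⟩ :=
    exists_arcPair ha hb (two_mul_add_lt (a := a) (b := b) hω)
  set M := ω ^ 2 + 2 * a + 2 * b with hM
  refine ⟨_, _, _, φ, ψ, hA, ?_, ?_, ?_, ?_⟩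
  · intro m k h
    obtain ⟨h0, h1⟩ := h.abs_velocity ha hb hω
    rcases le_total m q with hm | hm
    · have hm' : m ∈ Icc (critStart a b M) q := ⟨h.1.1, hm⟩
      have hle := (hφ2 m hm').2
      rw [← h0] at hle
      exact Or.inl ⟨hle, by rw [evenExt_of_le hle, h0, hφ1 m hm', h1]⟩
    · have hm' : m ∈ Icc q (critStart b a M)⁻¹ := ⟨hm, h.1.2⟩
      have hle := (hψ2 m hm').2
      rw [← h1] at hle
      exact Or.inr ⟨hle, by rw [evenExt_of_le hle, h1, hψ1 m hm', h0]⟩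
  · rintro v (⟨hle, hv⟩ | ⟨hle, hv⟩)
    · obtain ⟨m, hm, h0⟩ := hφ3 _ ⟨abs_nonneg _, hle⟩
      rw [evenExt_of_le hle, ← h0, hφ1 m hm] at hv
      obtain ⟨k, hk, h, hkv⟩ :=
        exists_isInnerCritical hω ha hb ⟨hm.1, hm.2.trans hqr.le⟩ h0.symm hv
      exact ⟨k, hk, m, h, hkv⟩
    · obtain ⟨m, hm, h0⟩ := hψ3 _ ⟨abs_nonneg _, hle⟩
      rw [evenExt_of_le hle, ← h0, hψ1 m hm] at hv
      obtain ⟨k, hk, h, hkv⟩ :=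
        exists_isInnerCritical hω ha hb ⟨hpq.le.trans hm.1, hm.2⟩ hv h0.symm
      exact ⟨k, hk, m, h, hkv⟩
  · intro m k h hE
    obtain ⟨h0, h1⟩ := h.abs_velocity ha hb hω
    rw [huniq m h.1 hE] at h0 h1
    exact (mem_range_rectCorner hA.fst.pos.le hA.fst.d_pos.le _).2 ⟨h0, h1⟩
  · intro v hv
    obtain ⟨h0, h1⟩ := (mem_range_rectCorner hA.fst.pos.le hA.fst.d_pos.le _).1 hv
    obtain ⟨k, hk, h, hkv⟩ := exists_isInnerCritical hω ha hb ⟨hpq.le, hqr.le⟩ h0 h1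
    exact ⟨k, hk, q, h, hq0, hkv⟩

theorem critical_of_det (hω : 0 < ω) (ha : 0 < a) (hb : 0 < b) {k : Plane}
    (h : (hessian (disp ω a b) k).det = 0) :
    IsOuterCritical ω a b k ∨ ∃ m, IsInnerCritical ω a b m k := by
  obtain ⟨ξ, hξ, hker⟩ := (det_eq_zero_iff _).1 h
  exact critical_cases hω ha hb hξ hker

/-- Nondegenerate points and inner critical points have interior velocities, so only the outer
branch remains. -/
theorem exists_outer_of_mem_frontier (hω : 0 < ω) (ha : 0 < a) (hb : 0 < b) {v : Plane}
    (hv : v ∈ frontier (range (velocity ω a b))) :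
    ∃ k ∈ square, IsOuterCritical ω a b k ∧ velocity ω a b k = v := by
  have hcl := (isCompact_range_velocity hω ha hb).isClosed
  obtain ⟨k, hk, rfl⟩ := (image_velocity_square ω a b).symm ▸ hcl.frontier_subset hv
  refine ⟨k, hk, ?_, rfl⟩
  by_cases hdet : (hessian (disp ω a b) k).det = 0
  · rcases critical_of_det hω ha hb hdet with h | ⟨m, h⟩
    · exact h
    · exact absurd (h.velocity_mem_interior ha hb hω) hv.2
  · exact absurd (velocity_mem_interior_of_det_ne_zero hω ha hb hdet) hv.2

/-- Scaling v by a factor slightly above one would increase the positive value of the functional. -/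
theorem notMem_interior_of_support {S : Set Plane} {v : Plane} {l : Plane →L[ℝ] ℝ}
    (hl : 0 < l v) (h : ∀ w ∈ S, l w ≤ l v) : v ∉ interior S := by
  intro hv
  have hc : Continuous fun s : ℝ => s • v := by fun_prop
  have h1 : ∀ᶠ s : ℝ in 𝓝[>] 1, s • v ∈ S :=
    (hc.tendsto' 1 v (one_smul _ _)).mono_left nhdsWithin_le_nhds
      (mem_interior_iff_mem_nhds.1 hv)
  obtain ⟨s, hs, hs1⟩ := (h1.and self_mem_nhdsWithin).exists
  have h2 := h _ hs
  rw [map_smul, smul_eq_mul] at h2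
  have : (1 : ℝ) < s := hs1
  nlinarith

theorem IsOuterCritical.velocity_mem_frontier (hω : 0 < ω) (ha : 0 < a) (hb : 0 < b) {k : Plane}
    (h : IsOuterCritical ω a b k) : velocity ω a b k ∈ frontier (range (velocity ω a b)) := by
  obtain ⟨l, hl, hl'⟩ := h.support ha hb hω
  exact ⟨subset_closure ⟨k, rfl⟩, notMem_interior_of_support hl hl'⟩

theorem convex_range_velocity (hω : 0 < ω) (ha : 0 < a) (hb : 0 < b) :
    Convex ℝ (range (velocity ω a b)) := by
  refine convex_of_support (isCompact_range_velocity hω ha hb).isClosed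
    (zero_mem_interior hω ha hb) fun f hf => ?_
  obtain ⟨k, -, hk, rfl⟩ := exists_outer_of_mem_frontier hω ha hb hf
  obtain ⟨l, hl, hl'⟩ := hk.support ha hb hω
  exact ⟨l, fun h0 => by simp [h0] at hl, hl'⟩

theorem V₃_disp (hω : 0 < ω) (ha : 0 < a) (hb : 0 < b) {v : Plane} :
    v ∈ V₃ (disp ω a b) ↔ ∃ k ∈ square, ∃ m, IsInnerCritical ω a b m k ∧
      critE a b (ω ^ 2 + 2 * a + 2 * b) m = 0 ∧ velocity ω a b k = v := by
  simp only [V₃, K₃, gradient_disp hω ha hb, mem_ofPred_eq]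
  constructor
  · rintro ⟨k, ⟨hk, hdet, ξ, hξ, hker, h3⟩, rfl⟩
    rcases critical_of_det hω ha hb hdet with h | ⟨m, h⟩
    · exact absurd h3 (h.third_ne_zero ha hb hω hξ hker)
    · exact ⟨k, hk, m, h, h.critE_eq_zero ha hb hω hξ hker h3, rfl⟩
  · rintro ⟨k, hk, m, h, hE, rfl⟩
    obtain ⟨ξ, hξ, hker, h3⟩ := h.exists_kernel ha hb hω
    rw [hE, neg_zero] at h3
    exact ⟨k, ⟨hk, (det_eq_zero_iff _).2 ⟨ξ, hξ, hker⟩, ξ, hξ, hker,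
      (mul_eq_zero.1 h3).resolve_left (disp_pos hω ha hb k).ne'⟩, rfl⟩

/-- Outside V₃ the third-derivative condition of K₂ is automatic: a kernel vector violating it would
put the velocity into V₃. -/
theorem V₂_disp (hω : 0 < ω) (ha : 0 < a) (hb : 0 < b) {v : Plane} :
    v ∈ V₂ (disp ω a b) ↔ v ∉ V₃ (disp ω a b) ∧ ∃ k ∈ square,
      (IsOuterCritical ω a b k ∨ ∃ m, IsInnerCritical ω a b m k) ∧ velocity ω a b k = v := by
  simp only [V₂, K₂, gradient_disp hω ha hb, mem_ofPred_eq]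
  refine and_congr_right fun hv => ⟨?_, ?_⟩
  · rintro ⟨k, ⟨hk, hdet, -⟩, rfl⟩
    exact ⟨k, hk, critical_of_det hω ha hb hdet, rfl⟩
  · rintro ⟨k, hk, h, rfl⟩
    obtain ⟨ξ, hξ, hker⟩ : ∃ ξ, ξ ≠ 0 ∧ hessian (disp ω a b) k ξ = 0 := by
      rcases h with h | ⟨m, h⟩
      · exact h.exists_kernel ha hb hω
      · obtain ⟨ξ, hξ, hker, -⟩ := h.exists_kernel ha hb hω
        exact ⟨ξ, hξ, hker⟩
    have hdet := (det_eq_zero_iff _).2 ⟨ξ, hξ, hker⟩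
    refine ⟨k, ⟨hk, hdet, ξ, hξ, hker, fun h3 => hv ?_⟩, rfl⟩
    exact ⟨k, ⟨hk, hdet, ξ, hξ, hker, h3⟩, by rw [gradient_disp hω ha hb]⟩

theorem V₁_disp (hω : 0 < ω) (ha : 0 < a) (hb : 0 < b) :
    V₁ (disp ω a b) =
      range (velocity ω a b) \ (V₂ (disp ω a b) ∪ V₃ (disp ω a b)) := by
  ext v
  constructor
  · rintro ⟨hv, k, -, rfl⟩
    exact ⟨⟨k, by rw [gradient_disp hω ha hb]⟩, hv⟩
  · rintro ⟨hvr, hv⟩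
    obtain ⟨k, hk, rfl⟩ := (image_velocity_square ω a b).symm ▸ hvr
    refine ⟨hv, k, ⟨hk, fun hdet => hv ?_⟩, by rw [gradient_disp hω ha hb]⟩
    by_cases h3 : velocity ω a b k ∈ V₃ (disp ω a b)
    · exact Or.inr h3
    · exact Or.inl ((V₂_disp hω ha hb).2 ⟨h3, k, hk, critical_of_det hω ha hb hdet, rfl⟩)

theorem V₀_disp (hω : 0 < ω) (ha : 0 < a) (hb : 0 < b) :
    V₀ (disp ω a b) = (range (velocity ω a b))ᶜ := by
  ext v
  rw [← image_velocity_square, V₀, gradient_disp hω ha hb]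
  simp [eq_comm]

end

theorem enclosedRegion_frontier {S : Set Plane} (hS : Convex ℝ S) (hcl : IsClosed S)
    (hne : (interior S).Nonempty) (hb : Bornology.IsBounded S) :
    enclosedRegion (frontier S) = interior S := by
  refine enclosedRegion_eq isOpen_interior hcl.isOpen_compl ?_ ?_ (hb.subset interior_subset) ?_
  · exact disjoint_compl_right.mono_left interior_subset
  · rw [compl_frontier_eq_union_interior, hcl.isOpen_compl.interior_eq]
  · exact fun x hx => ⟨Sᶜ, Subset.rfl, hx, isPreconnected_compl_of_convex hS hcl hne hb,
      not_isBounded_compl hb⟩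

end LatticeVelocity

open LatticeVelocity in
theorem mainTheorem6 (ω lam₁ lam₂ : ℝ) (hω : 0 < ω) (hlam₁ : 0 < lam₁) (hlam₂ : 0 < lam₂) :
    ∃ Ψ₁ Ψ₂ R₀ R₁ R₂ : Set LatticeVelocity.Plane,
      -- two disjoint simple closed curves around the origin, the second one inside the first
      LatticeVelocity.IsSimpleClosedCurve Ψ₁ ∧
      LatticeVelocity.IsSimpleClosedCurve Ψ₂ ∧
      0 ∈ LatticeVelocity.enclosedRegion Ψ₁ ∧
      0 ∈ LatticeVelocity.enclosedRegion Ψ₂ ∧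
      Disjoint Ψ₁ Ψ₂ ∧
      Ψ₂ ⊆ LatticeVelocity.enclosedRegion Ψ₁ ∧
      -- they split the plane into three open regions
      (IsOpen R₀ ∧ IsConnected R₀ ∧ ¬ Bornology.IsBounded R₀) ∧
      (IsOpen R₁ ∧ IsConnected R₁ ∧ Bornology.IsBounded R₁) ∧
      (IsOpen R₂ ∧ IsConnected R₂ ∧ Bornology.IsBounded R₂) ∧
      Disjoint R₀ R₁ ∧ Disjoint R₀ R₂ ∧ Disjoint R₁ R₂ ∧
      R₀ ∪ R₁ ∪ R₂ = (Ψ₁ ∪ Ψ₂)ᶜ ∧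
      LatticeVelocity.enclosedRegion Ψ₂ = R₂ ∧
      LatticeVelocity.enclosedRegion Ψ₁ = R₁ ∪ Ψ₂ ∪ R₂ ∧
      -- the region enclosed by the first curve is convex
      Convex ℝ (LatticeVelocity.enclosedRegion Ψ₁) ∧
      -- the second curve consists of four concave arcs that meet at four cusps, which form `V₃`
      (∃ (p : Fin 4 → LatticeVelocity.Plane) (A : Fin 4 → Set LatticeVelocity.Plane) (c₁ c₂ : ℝ),
        0 < c₁ ∧ 0 < c₂ ∧
        p = ![!₂[c₁, c₂], !₂[-c₁, c₂], !₂[-c₁, -c₂], !₂[c₁, -c₂]] ∧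
        (∀ i, LatticeVelocity.IsSimpleArc (A i) (p i) (p (i + 1))) ∧
        (∀ i j, i ≠ j → A i ∩ A j = {p i, p (i + 1)} ∩ {p j, p (j + 1)}) ∧
        ⋃ i, A i = Ψ₂ ∧
        (∀ i, LatticeVelocity.IsConcaveArc (LatticeVelocity.enclosedRegion Ψ₂) (A i)) ∧
        (∀ i, LatticeVelocity.HasCuspAt Ψ₂ (p i)) ∧
        LatticeVelocity.V₃ (LatticeVelocity.disp ω lam₁ lam₂) = Set.range p) ∧
      -- the other sets
      LatticeVelocity.V₂ (LatticeVelocity.disp ω lam₁ lam₂) =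
        (Ψ₁ ∪ Ψ₂) \ LatticeVelocity.V₃ (LatticeVelocity.disp ω lam₁ lam₂) ∧
      LatticeVelocity.V₁ (LatticeVelocity.disp ω lam₁ lam₂) = R₁ ∪ R₂ ∧
      LatticeVelocity.V₀ (LatticeVelocity.disp ω lam₁ lam₂) = R₀ ∧
      frontier (LatticeVelocity.V₀ (LatticeVelocity.disp ω lam₁ lam₂)) = Ψ₁ := by
  obtain ⟨c, d, σ, φ, ψ, h, hin, hex, hcin, hcex⟩ := exists_astroid hω hlam₁ hlam₂
  set S := range (velocity ω lam₁ lam₂) with hS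
  have hcomp : IsCompact S := isCompact_range_velocity hω hlam₁ hlam₂
  have hcl := hcomp.isClosed
  have hbd := hcomp.isBounded
  have hconv : Convex ℝ S := convex_range_velocity hω hlam₁ hlam₂
  have hne : (interior S).Nonempty := ⟨0, zero_mem_interior hω hlam₁ hlam₂⟩
  have hU0 : ∀ v ∈ interior S, flip₀ v ∈ interior S := fun v hv =>
    map_mem_interior _ (fun w hw => flip₀_mem_range hw) hv
  have hUn : ∀ v ∈ interior S, -v ∈ interior S := fun v hv =>
    map_mem_interior (LinearIsometryEquiv.neg ℝ) (fun w hw => neg_mem_range hw) hv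
  have hΨ : astroid c d φ ψ ⊆ interior S := fun v hv => by
    obtain ⟨k, -, m, hk, rfl⟩ := hex v hv
    exact hk.velocity_mem_interior hlam₁ hlam₂ hω
  have hcorner : range (rectCorner c d) ⊆ astroid c d φ ψ := by
    rintro _ ⟨i, rfl⟩
    rw [← h.iUnion_arc]
    exact mem_iUnion.2 ⟨i, (h.corner_mem i).1⟩
  have hcd : (!₂[c, d] : Plane) ∈ interior S := hΨ (hcorner ⟨0, rfl⟩)
  -- The inside lies in the rectangle spanned by the cusps, and the convex, reflection-symmetric set
  -- `interior S` contains that rectangle.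
  have hI : astroidInside c d φ ψ ⊆ interior S := fun v hv => by
    obtain ⟨h0, h1⟩ := h.inside_abs_lt hv
    exact ArcPair.mem_of_abs_le hconv.interior hU0 hUn hcd
      (h0.le.trans (by simpa using le_abs_self c)) (h1.le.trans (by simpa using le_abs_self d))
  have henc₁ : enclosedRegion (frontier S) = interior S :=
    enclosedRegion_frontier hconv hcl hne hbd
  have henc₂ : enclosedRegion (astroid c d φ ψ) = astroidInside c d φ ψ :=
    enclosedRegion_eq h.isOpen_inside h.isOpen_outside ArcPair.disjoint_inside_outside
      h.compl_astroid (hbd.subset (hI.trans interior_subset)) fun x hx => h.escape_outside hx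
  have hann : interior S ∩ astroidOutside c d φ ψ ∪ astroidInside c d φ ψ =
      interior S \ astroid c d φ ψ := by
    rw [sdiff_eq, h.compl_astroid, inter_union_distrib_left, inter_eq_right.2 hI, union_comm]
  have hfr : frontier S = S \ interior S := hcl.frontier_eq
  have hV₃ : V₃ (disp ω lam₁ lam₂) = range (rectCorner c d) := by
    ext v
    rw [V₃_disp hω hlam₁ hlam₂]
    refine ⟨?_, hcex v⟩
    rintro ⟨k, -, m, hk, hE, rfl⟩
    exact hcin m k hk hE
  have hV₂ : V₂ (disp ω lam₁ lam₂) =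
      (frontier S ∪ astroid c d φ ψ) \ V₃ (disp ω lam₁ lam₂) := by
    ext v
    rw [V₂_disp hω hlam₁ hlam₂, Set.mem_sdiff, and_comm]
    refine and_congr_left fun _ => ⟨?_, ?_⟩
    · rintro ⟨k, -, hk | ⟨m, hk⟩, rfl⟩
      · exact Or.inl (hk.velocity_mem_frontier hω hlam₁ hlam₂)
      · exact Or.inr (hin m k hk)
    · rintro (hv | hv)
      · obtain ⟨k, hk, hk', e⟩ := exists_outer_of_mem_frontier hω hlam₁ hlam₂ hv
        exact ⟨k, hk, Or.inl hk', e⟩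
      · obtain ⟨k, hk, m, hk', e⟩ := hex v hv
        exact ⟨k, hk, Or.inr ⟨m, hk'⟩, e⟩
  have hV₀ := V₀_disp hω hlam₁ hlam₂
  have hsub : interior S ⊆ S := interior_subset
  refine ⟨frontier S, astroid c d φ ψ, Sᶜ, interior S ∩ astroidOutside c d φ ψ,
    astroidInside c d φ ψ, isSimpleClosedCurve_frontier hconv hne hbd,
    h.isSimpleClosedCurve_astroid, henc₁ ▸ zero_mem_interior hω hlam₁ hlam₂,
    henc₂ ▸ h.zero_mem_inside, ?_, henc₁ ▸ hΨ, ⟨hcl.isOpen_compl, ⟨?_, ?_⟩, not_isBounded_compl hbd⟩,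
    ⟨isOpen_interior.inter h.isOpen_outside,
      h.isConnected_annulus hconv.interior isOpen_interior hU0 hUn hcd,
      hbd.subset (inter_subset_left.trans hsub)⟩,
    ⟨h.isOpen_inside, ⟨⟨0, h.zero_mem_inside⟩, h.isPreconnected_inside⟩,
      hbd.subset (hI.trans hsub)⟩, ?_, ?_, ?_, ?_, henc₂, ?_, henc₁ ▸ hconv.interior,
    ⟨rectCorner c d, astroidArc c d φ ψ, c, d, h.fst.pos, h.fst.d_pos, rfl, h.isSimpleArc_arc,
      h.arc_inter, h.iUnion_arc, henc₂ ▸ h.isConcaveArc_arc, h.hasCuspAt, hV₃⟩, hV₂, ?_, hV₀, ?_⟩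
  · rw [hfr]
    exact disjoint_sdiff_left.mono_right hΨ
  · by_contra hemp
    rw [Set.not_nonempty_iff_eq_empty] at hemp
    exact not_isBounded_compl hbd (hemp ▸ Bornology.isBounded_empty)
  · exact isPreconnected_compl_of_convex hconv hcl hne hbd
  · exact disjoint_compl_left.mono_right (inter_subset_left.trans hsub)
  · exact disjoint_compl_left.mono_right (hI.trans hsub)
  · exact ArcPair.disjoint_inside_outside.symm.mono_left inter_subset_right
  · rw [union_assoc, hann, hfr]
    ext v
    have := @hΨ v
    have := @hsub v
    simp only [mem_union, mem_compl_iff, Set.mem_sdiff]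
    tauto
  · rw [henc₁, union_right_comm, hann, sdiff_union_of_subset hΨ]
  · have hV : V₃ (disp ω lam₁ lam₂) ⊆ frontier S ∪ astroid c d φ ψ :=
      hV₃ ▸ hcorner.trans subset_union_right
    rw [V₁_disp hω hlam₁ hlam₂, hV₂, sdiff_union_of_subset hV, ← hS, hann, hfr]
    ext v
    have := @hsub v
    simp only [mem_union, Set.mem_sdiff]
    tauto
  · rw [hV₀, frontier_compl]
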